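/- Let $d\ge 1$ be an integer and let $\alpha$ be a real number with $\frac8d<\alpha$ and, if $d\ge5$, also $\alpha<\frac{8}{d-4}$. Put $\gamma_c:=\frac d2-\frac4\alpha$ and $\alpha_c:=\frac{d\alpha}{4}$. Let $\mathcal S_0$ be the space of Schwartz functions on $\mathbb R^d$ whose Fourier transform vanishes to infinite order at $0$, and $\mathcal S_0'$ its topological dual (tempered distributions modulo polynomials). Let $\dot H^\gamma$ be the space of $u\in\mathcal S_0'$ with $\|u\|_{\dot H^\gamma}:=\||\nabla|^\gamma u\|_{L^2}<\infty$. For $1\le q<\infty$, $L^q$ is regarded as a subspace of $\mathcal S_0'$. The spaces $\dot H^{\gamma_c}\cap\dot H^2$ and $L^{\alpha_c}\cap\dot H^2$ carry the sum of the two norms. Let $\mathcal G$ be the set of nonzero maximizers $Q$ of $H(f)=\|f\|_{L^{\alpha+2}}^{\alpha+2}\big/\big(\|f\|_{\dot H^{\gamma_c}}^{\alpha}\|f\|_{\dot H^2}^2\big)$ over $f\in(\dot H^{\gamma_c}\cap\dot H^2)\setminus\{0\}$ that solve $\Delta^2Q+(-\Delta)^{\gamma_c}Q-|Q|^\alpha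 Q=0$ in $\mathcal S_0'$, and let $\mathcal H$ be the set of nonzero maximizers $R$ of $K(f)=\|f\|_{L^{\alpha+2}}^{\alpha+2}\big/\big(\|f\|_{L^{\alpha_c}}^{\alpha}\|f\|_{\dot H^2}^2\big)$ over $f\in(L^{\alpha_c}\cap\dot H^2)\setminus\{0\}$ that solve $\Delta^2R+|R|^{\alpha_c-2}R-|R|^\alpha R=0$ in $\mathcal S_0'$. Then $\mathcal G$ and $\mathcal H$ are nonempty, all elements of $\mathcal G$ have the same $\dot H^{\gamma_c}$-norm $S_{\rm gs}>0$, all elements of $\mathcal H$ have the same $L^{\alpha_c}$-norm $L_{\rm gs}>0$, and the following holds. Let $m\ge0$, $M>0$, and let $(v_n)_n$ be a bounded sequence in $\dot H^{\gamma_c}\cap\dot H^2$ with $$\limsup_{n\to\infty}\|v_n\|_{\dot H^2}\le M,\qquad \limsup_{n\to\infty}\|v_n\|_{L^{\alpha+2}}\ge m .$$ 1. There are a sequence $(x_n)_n$ in $\mathbb R^d$ and $V\in\dot H^{\gamma_c}\cap\dot H^2$ such that, up to a subsequence, $v_n(\cdot+x_n)\rightharpoonup V$ weakly in $\dot H^{\gamma_c}\cap\dot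 H^2$, and $$\|V\|_{\dot H^{\gamma_c}}^\alpha\ge\frac{2}{\alpha+2}\,\frac{m^{\alpha+2}}{M^2}\,S_{\rm gs}^\alpha .$$ 2. There are a sequence $(y_n)_n$ in $\mathbb R^d$ and $W\in L^{\alpha_c}\cap\dot H^2$ such that, up to a subsequence, $v_n(\cdot+y_n)\rightharpoonup W$ weakly in $L^{\alpha_c}\cap\dot H^2$, and $$\|W\|_{L^{\alpha_c}}^\alpha\ge\frac{2}{\alpha+2}\,\frac{m^{\alpha+2}}{M^2}\,L_{\rm gs}^\alpha .$$ -/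

import Mathlib

open MeasureTheory Filter Topology
open scoped ENNReal NNReal SchwartzMap FourierTransform ContDiff

namespace NL4S

/-- Euclidean space `ℝ^d`. -/
abbrev E (d : ℕ) : Type := EuclideanSpace ℝ (Fin d)

/-- The space `𝒮₀` of Schwartz functions whose Fourier transform vanishes to infinite order at the
origin. -/
def S0 (d : ℕ) : Submodule ℂ 𝓢(E d, ℂ) where
  carrier := {φ | ∀ k : ℕ, iteratedFDeriv ℝ k (𝓕 φ : 𝓢(E d, ℂ)) 0 = 0}
  zero_mem' := by
    intro k
    have h : ((𝓕 (0 : 𝓢(E d, ℂ)) : 𝓢(E d, ℂ)) : E d → ℂ) = 0 := by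
      rw [FourierTransform.fourier_zero]; rfl
    rw [h]
    simp
  add_mem' := by
    intro φ ψ hφ hψ k
    have h : ((𝓕 (φ + ψ) : 𝓢(E d, ℂ)) : E d → ℂ)
        = ((𝓕 φ : 𝓢(E d, ℂ)) : E d → ℂ) + ((𝓕 ψ : 𝓢(E d, ℂ)) : E d → ℂ) := by
      rw [FourierTransform.fourier_add]; rfl
    rw [h, iteratedFDeriv_add ((𝓕 φ : 𝓢(E d, ℂ)).smooth k) ((𝓕 ψ : 𝓢(E d, ℂ)).smooth k)]
    simp only [Pi.add_apply]
    rw [hφ k, hψ k, add_zero]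
  smul_mem' := by
    intro c φ hφ k
    have h : ((𝓕 (c • φ) : 𝓢(E d, ℂ)) : E d → ℂ)
        = c • ((𝓕 φ : 𝓢(E d, ℂ)) : E d → ℂ) := by
      rw [FourierTransform.fourier_smul]; rfl
    rw [h, iteratedFDeriv_const_smul_apply ((𝓕 φ : 𝓢(E d, ℂ)).smooth k).contDiffAt, hφ k,
      smul_zero]

/-- The topological dual `𝒮₀'`, i.e. tempered distributions modulo polynomials. -/
abbrev S0Dual (d : ℕ) : Type := S0 d →L[ℂ] ℂ

theorem fourier_compSubConst {d : ℕ} (φ : 𝓢(E d, ℂ)) (a ξ : E d) :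
    (𝓕 (φ.compSubConstCLM ℂ a) : 𝓢(E d, ℂ)) ξ
      = Complex.exp (((-2 * Real.pi * inner ℝ a ξ : ℝ) : ℂ) * Complex.I)
        * (𝓕 φ : 𝓢(E d, ℂ)) ξ := by
  rw [SchwartzMap.fourier_coe, SchwartzMap.fourier_coe, Real.fourier_eq', Real.fourier_eq',
    ← integral_const_mul, ← integral_add_right_eq_self _ a]
  refine integral_congr_ae (Eventually.of_forall fun x => ?_)
  simp only [SchwartzMap.compSubConstCLM_apply, add_sub_cancel_right, smul_eq_mul]
  rw [← mul_assoc, ← Complex.exp_add, inner_add_left]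
  congr 2
  push_cast
  ring

theorem compSubConst_mem_S0 {d : ℕ} (a : E d) {φ : 𝓢(E d, ℂ)} (hφ : φ ∈ S0 d) :
    φ.compSubConstCLM ℂ a ∈ S0 d := by
  intro k
  have h : ((𝓕 (φ.compSubConstCLM ℂ a) : 𝓢(E d, ℂ)) : E d → ℂ)
      = fun ξ => Complex.exp (((-2 * Real.pi * inner ℝ a ξ : ℝ) : ℂ) * Complex.I)
        * (𝓕 φ : 𝓢(E d, ℂ)) ξ := funext (fourier_compSubConst φ a)
  rw [h, ← norm_le_zero_iff]
  have he : ContDiff ℝ ∞ fun ξ : E d =>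
      Complex.exp (((-2 * Real.pi * inner ℝ a ξ : ℝ) : ℂ) * Complex.I) := by
    have h1 : ContDiff ℝ ∞ fun ξ : E d => -2 * Real.pi * inner ℝ a ξ :=
      contDiff_const.mul (contDiff_const.inner ℝ contDiff_id)
    exact ((Complex.ofRealCLM.contDiff.comp h1).mul contDiff_const).cexp
  refine (norm_iteratedFDeriv_mul_le he ((𝓕 φ : 𝓢(E d, ℂ)).smooth ⊤) 0
    (n := k) (by exact_mod_cast le_top)).trans (le_of_eq ?_)
  refine Finset.sum_eq_zero fun i _ => ?_
  rw [hφ (k - i), norm_zero, mul_zero]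

/-- Translation `φ ↦ φ(· - a)` on `𝒮₀`. -/
noncomputable def shiftS0 {d : ℕ} (a : E d) : S0 d →L[ℂ] S0 d :=
  ((SchwartzMap.compSubConstCLM ℂ a).comp (S0 d).subtypeL).codRestrict (S0 d)
    fun φ => compSubConst_mem_S0 a φ.2

/-- The translate `u(· + a)` of `u ∈ 𝒮₀'`, defined by duality. -/
noncomputable def translate {d : ℕ} (u : S0Dual d) (a : E d) : S0Dual d :=
  u.comp (shiftS0 a)

/-- `u ∈ 𝒮₀'` is given by the function `f`. -/
def IsFunction {d : ℕ} (u : S0Dual d) (f : E d → ℂ) : Prop :=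
  ∀ φ : S0 d, u φ = ∫ x, f x * (φ : 𝓢(E d, ℂ)) x

/-- The Fourier transform of `u ∈ 𝒮₀'`, a functional on `𝓕⁻¹ 𝒮₀`, is given by the function `g`.
The Fourier transform is `û(ξ) = ∫ e^{-2πi⟨x,ξ⟩} u(x) dx`. -/
def IsFourier {d : ℕ} (u : S0Dual d) (g : E d → ℂ) : Prop :=
  ∀ φ : S0 d, u φ = ∫ ξ, g ξ * (𝓕⁻ (φ : 𝓢(E d, ℂ)) : 𝓢(E d, ℂ)) ξ

/-- The symbol `(2π|ξ|)^s` of `|∇|^s = (-Δ)^{s/2}`. -/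
noncomputable def symb {d : ℕ} (s : ℝ) (ξ : E d) : ℂ := (((2 * Real.pi * ‖ξ‖) ^ s : ℝ) : ℂ)

/-- `g` is the Fourier transform of `u` and `|∇|^γ u ∈ L²`. -/
def IsHdotFourier {d : ℕ} (γ : ℝ) (u : S0Dual d) (g : E d → ℂ) : Prop :=
  IsFourier u g ∧ MemLp (fun ξ => symb γ ξ * g ξ) 2 volume

/-- The `Ḣ^γ` norm `‖|∇|^γ u‖_{L²} = ‖(2π|ξ|)^γ û‖_{L²}` of `u ∈ 𝒮₀'`; it is `∞` if `|∇|^γ u` is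
not in `L²`. (The function `û` is unique almost everywhere, so the infimum is over at most one
class.) -/
noncomputable def hdotNorm {d : ℕ} (γ : ℝ) (u : S0Dual d) : ℝ≥0∞ :=
  ⨅ (g : E d → ℂ) (_ : IsHdotFourier γ u g), eLpNorm (fun ξ => symb γ ξ * g ξ) 2 volume

/-- `u ∈ 𝒮₀'` is given by the function `f ∈ L^q`. -/
def IsLpFunction {d : ℕ} (q : ℝ) (u : S0Dual d) (f : E d → ℂ) : Prop :=
  IsFunction u f ∧ MemLp f (ENNReal.ofReal q) volume

/-- The `L^q` norm of `u ∈ 𝒮₀'`, for `1 ≤ q < ∞`; it is `∞` if `u` is not given by an `L^q`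
function. (Such a function is unique almost everywhere, as `L^q` contains no polynomial but `0`.) -/
noncomputable def lpNorm {d : ℕ} (q : ℝ) (u : S0Dual d) : ℝ≥0∞ :=
  ⨅ (f : E d → ℂ) (_ : IsLpFunction q u f), eLpNorm f (ENNReal.ofReal q) volume

/-- The critical Sobolev exponent `γ_c = d/2 - 4/α`. -/
noncomputable def gammaC (d : ℕ) (α : ℝ) : ℝ := d / 2 - 4 / α

/-- The critical Lebesgue exponent `α_c = dα/4`. -/
noncomputable def alphaC (d : ℕ) (α : ℝ) : ℝ := d * α / 4

/-- The norm of `Ḣ^{γ_c} ∩ Ḣ²`; the space consists of the `u` where it is finite. -/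
noncomputable def sobNorm {d : ℕ} (α : ℝ) (u : S0Dual d) : ℝ≥0∞ :=
  hdotNorm (gammaC d α) u + hdotNorm 2 u

/-- The norm of `L^{α_c} ∩ Ḣ²`; the space consists of the `u` where it is finite. -/
noncomputable def lebNorm {d : ℕ} (α : ℝ) (u : S0Dual d) : ℝ≥0∞ :=
  lpNorm (alphaC d α) u + hdotNorm 2 u

/-- Weak convergence in the normed space `X = {u ∈ 𝒮₀' | N u < ∞}` with the norm `N`: all members
and the limit lie in `X`, and every bounded linear functional on `X` converges along the sequence.
Every linear functional on the subspace `X` is the restriction of one on `𝒮₀'` (no continuity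
on `𝒮₀'` is asked for), so `ℓ` runs through exactly the dual of `X`. -/
def WeakConv {d : ℕ} (N : S0Dual d → ℝ≥0∞) (w : ℕ → S0Dual d) (V : S0Dual d) : Prop :=
  (∀ n, N (w n) < ⊤) ∧ N V < ⊤ ∧
    ∀ ℓ : S0Dual d →ₗ[ℂ] ℂ,
      (∃ C : ℝ≥0, ∀ u, N u < ⊤ → ‖ℓ u‖ₑ ≤ C * N u) →
        Tendsto (fun n => ℓ (w n)) atTop (𝓝 (ℓ V))

/-- `H(f) = ‖f‖_{L^{α+2}}^{α+2} / (‖f‖_{Ḣ^{γ_c}}^α ‖f‖_{Ḣ²}²)`. -/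
noncomputable def funH {d : ℕ} (α : ℝ) (u : S0Dual d) : ℝ≥0∞ :=
  lpNorm (α + 2) u ^ (α + 2) / (hdotNorm (gammaC d α) u ^ α * hdotNorm 2 u ^ 2)

/-- `K(f) = ‖f‖_{L^{α+2}}^{α+2} / (‖f‖_{L^{α_c}}^α ‖f‖_{Ḣ²}²)`. -/
noncomputable def funK {d : ℕ} (α : ℝ) (u : S0Dual d) : ℝ≥0∞ :=
  lpNorm (α + 2) u ^ (α + 2) / (lpNorm (alphaC d α) u ^ α * hdotNorm 2 u ^ 2)

/-- `u` is a nonzero maximizer of `J` on the nonzero elements of `{N < ∞}`. -/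
def IsMaximizer {d : ℕ} (N J : S0Dual d → ℝ≥0∞) (u : S0Dual d) : Prop :=
  N u < ⊤ ∧ u ≠ 0 ∧ ∀ w, N w < ⊤ → w ≠ 0 → J w ≤ J u

/-- `Q ∈ Ḣ^{γ_c} ∩ Ḣ²` solves `Δ²Q + (-Δ)^{γ_c} Q - |Q|^α Q = 0` in `𝒮₀'`. -/
def SolvesSobolev {d : ℕ} (α : ℝ) (Q : S0Dual d) : Prop :=
  ∃ f g : E d → ℂ, IsLpFunction (α + 2) Q f ∧
    IsHdotFourier (gammaC d α) Q g ∧ IsHdotFourier 2 Q g ∧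
    ∀ φ : S0 d,
      (∫ ξ, symb 4 ξ * g ξ * (𝓕⁻ (φ : 𝓢(E d, ℂ)) : 𝓢(E d, ℂ)) ξ)
        + (∫ ξ, symb (2 * gammaC d α) ξ * g ξ * (𝓕⁻ (φ : 𝓢(E d, ℂ)) : 𝓢(E d, ℂ)) ξ)
        - (∫ x, ((‖f x‖ ^ α : ℝ) : ℂ) * f x * (φ : 𝓢(E d, ℂ)) x) = 0

/-- `R ∈ L^{α_c} ∩ Ḣ²` solves `Δ²R + |R|^{α_c - 2} R - |R|^α R = 0` in `𝒮₀'`. -/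
def SolvesLebesgue {d : ℕ} (α : ℝ) (R : S0Dual d) : Prop :=
  ∃ f g : E d → ℂ, IsLpFunction (alphaC d α) R f ∧ IsLpFunction (α + 2) R f ∧
    IsHdotFourier 2 R g ∧
    ∀ φ : S0 d,
      (∫ ξ, symb 4 ξ * g ξ * (𝓕⁻ (φ : 𝓢(E d, ℂ)) : 𝓢(E d, ℂ)) ξ)
        + (∫ x, ((‖f x‖ ^ (alphaC d α - 2) : ℝ) : ℂ) * f x * (φ : 𝓢(E d, ℂ)) x)
        - (∫ x, ((‖f x‖ ^ α : ℝ) : ℂ) * f x * (φ : 𝓢(E d, ℂ)) x) = 0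

/-- The set `𝒢` of Sobolev ground states. -/
def sobolevGroundStates (d : ℕ) (α : ℝ) : Set (S0Dual d) :=
  {g | IsMaximizer (sobNorm α) (funH α) g ∧ SolvesSobolev α g}

/-- The set `ℋ` of Lebesgue ground states. -/
def lebesgueGroundStates (d : ℕ) (α : ℝ) : Set (S0Dual d) :=
  {h | IsMaximizer (lebNorm α) (funK α) h ∧ SolvesLebesgue α h}

/-- `S` is the well-defined common value of the norm `N` on the set `G`. -/
def IsCommonNorm {d : ℕ} (N : S0Dual d → ℝ≥0∞) (G : Set (S0Dual d)) (S : ℝ) : Prop :=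
  G.Nonempty ∧ 0 < S ∧ ∀ g ∈ G, N g = ENNReal.ofReal S

end NL4S

/-! ### Test functions of `S0` on the frequency side -/

namespace NL4S

variable {d : ℕ}

/-! Write D(u) for the squared Ḣ² norm, I(u) for ∫|u|^{α+2}, and N for either of the two critical
norms. Amplitude and the dilation u ↦ l^{4/α} u(l·) leave I/(N^α D) unchanged, and with the best
constant C one has I ≤ C N^α D. Call a profile of a bounded sequence any limit, on 𝒮₀, of translates
of a subsequence. Everything rests on one principle, `Elt.le_of_profiles`: if every profile W
satisfies the linear inequality I(W) ≤ B D(W), then the limits of I and D along the sequence satisfy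
it too. The reason is that subtracting a profile splits I additively (Brezis–Lieb) and D additively
(expansion of a Hilbert norm), see `Elt.tendsto_sub`, and that the remainder has no new nonzero
profiles, see `Elt.IsProfile.of_sub`. The extraction stops because ∫|u|^{α_c} splits as well, and as
long as I stays away from zero each step uses up a fixed amount of it (`Elt.exists_profile`).

Concentration (`Elt.exists_profile_norm_ge`). Let m > 0 and suppose C N(W)^α < B := m^{α+2}/M² for
every profile W. Then I(W) ≤ B D(W) for all profiles, strictly for nonzero ones. Remove one nonzero
profile V and apply the principle to the rest: lim I − I(V) ≤ B (lim D − D(V)), so lim I < B lim D ≤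
m^{α+2}, contradicting the choice of the subsequence. Hence some profile has N(V)^α ≥ B/C. The
existence of maximizers (`CritNorm.exists_isMax`) is the same argument for a maximizing sequence
with N = D = 1.

A nonzero profile comes from a refined Sobolev inequality (`lintegral_rpow_le_of_low`), in which the
L^r norm is small if all low-frequency parts are small in a weighted supremum. Taken with r slightly
above α+2 and interpolated with L^{α_c}, it yields a point and a frequency where the low-frequency
part is large. The bounds in L^{α_c} and Ḣ² confine this frequency to a compact range
(`exists_low_ge`), so translations suffice and no dilations appear.

Ground states. A maximizer satisfies an Euler–Lagrange equation with two coefficients, and amplitude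
and dilation can be used to make both equal to α+2, which gives the required equation. Conversely, a
maximizer that solves the equation must satisfy 2I = (α+2)D, for otherwise the two equations
together force the Fourier transform to live on a sphere, so that the maximizer vanishes. With I = C
N^α D this fixes N^α = (α+2)/(2C), the common value of the norm, and turns B/C into the asserted
bound. Both norms are handled at once through the structure `CritNorm`. -/

theorem fourierInv_apply_neg (φ : 𝓢(E d, ℂ)) (ξ : E d) :
    (𝓕⁻ φ : 𝓢(E d, ℂ)) ξ = (𝓕 φ : 𝓢(E d, ℂ)) (-ξ) := by
  rw [SchwartzMap.fourierInv_coe, SchwartzMap.fourier_coe, Real.fourierInv_eq_fourier_neg]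

theorem fourier_apply_neg (φ : 𝓢(E d, ℂ)) (ξ : E d) :
    (𝓕 φ : 𝓢(E d, ℂ)) ξ = (𝓕⁻ φ : 𝓢(E d, ℂ)) (-ξ) := by
  rw [fourierInv_apply_neg, neg_neg]

theorem fourierInv_fourier_schwartz (φ : 𝓢(E d, ℂ)) : (𝓕⁻ (𝓕 φ : 𝓢(E d, ℂ)) : 𝓢(E d, ℂ)) = φ :=
  FourierTransform.fourierInv_fourier_eq φ

theorem fourier_fourierInv_schwartz (φ : 𝓢(E d, ℂ)) : (𝓕 (𝓕⁻ φ : 𝓢(E d, ℂ)) : 𝓢(E d, ℂ)) = φ :=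
  FourierTransform.fourier_fourierInv_eq φ

theorem mem_S0_of_eventually {φ : 𝓢(E d, ℂ)}
    (h : ∀ᶠ ξ in 𝓝 0, (𝓕 φ : 𝓢(E d, ℂ)) ξ = 0) : φ ∈ S0 d := by
  intro k
  have h' : ((𝓕 φ : 𝓢(E d, ℂ)) : E d → ℂ) =ᶠ[𝓝 0] fun _ => 0 := h
  have := (h'.iteratedFDeriv ℝ k).eq_of_nhds
  rw [this]
  simp

/-- Source of test functions: since `𝓕⁻ (𝓕 ψ) = ψ`, any frequency profile vanishing near the origin
may be used to test an element of 𝒮₀'. -/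
theorem fourier_mem_S0 {ψ : 𝓢(E d, ℂ)} (h : ∀ᶠ ξ in 𝓝 0, ψ ξ = 0) :
    (𝓕 ψ : 𝓢(E d, ℂ)) ∈ S0 d := by
  apply mem_S0_of_eventually
  have h2 : Tendsto (fun ξ : E d => -ξ) (𝓝 0) (𝓝 0) := by
    simpa using (continuous_neg (G := E d)).tendsto 0
  filter_upwards [h2.eventually h] with ξ hξ
  rw [fourier_apply_neg, fourierInv_fourier_schwartz, hξ]

theorem fourierInv_S0_zero (φ : S0 d) : (𝓕⁻ (φ : 𝓢(E d, ℂ)) : 𝓢(E d, ℂ)) 0 = 0 := by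
  have h := φ.2 0
  rw [fourierInv_apply_neg, neg_zero]
  have := congrArg norm h
  rwa [norm_iteratedFDeriv_zero, norm_zero, norm_eq_zero] at this

theorem fderiv_fourierInv_S0_zero (φ : S0 d) :
    fderiv ℝ (𝓕⁻ (φ : 𝓢(E d, ℂ)) : 𝓢(E d, ℂ)) 0 = 0 := by
  have h := φ.2 1
  have h3 : ((𝓕⁻ (φ : 𝓢(E d, ℂ)) : 𝓢(E d, ℂ)) : E d → ℂ)
      = fun ξ => (𝓕 (φ : 𝓢(E d, ℂ)) : 𝓢(E d, ℂ)) (-ξ) := funext (fourierInv_apply_neg _)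
  have h4 : fderiv ℝ ((𝓕 (φ : 𝓢(E d, ℂ)) : 𝓢(E d, ℂ)) : E d → ℂ) 0 = 0 := by
    rw [← norm_eq_zero, ← norm_iteratedFDeriv_one, h, norm_zero]
  have h5 : HasFDerivAt ((𝓕 (φ : 𝓢(E d, ℂ)) : 𝓢(E d, ℂ)) : E d → ℂ)
      (0 : E d →L[ℝ] ℂ) (-(0 : E d)) := by
    rw [neg_zero, ← h4]
    exact ((𝓕 (φ : 𝓢(E d, ℂ)) : 𝓢(E d, ℂ)).differentiable 0).hasFDerivAt
  have h6 := h5.comp (0 : E d) (hasFDerivAt_id (𝕜 := ℝ) (0 : E d)).neg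
  rw [h3]
  rw [ContinuousLinearMap.zero_comp] at h6
  exact h6.fderiv

/-- The inverse Fourier transform of an element of `𝒮₀` vanishes to second order at `0`. -/
theorem norm_fourierInv_S0_le (φ : S0 d) (ξ : E d) :
    ‖(𝓕⁻ (φ : 𝓢(E d, ℂ)) : 𝓢(E d, ℂ)) ξ‖
      ≤ SchwartzMap.seminorm ℝ 0 2 (𝓕⁻ (φ : 𝓢(E d, ℂ))) * ‖ξ‖ ^ 2 := by
  set ψ : 𝓢(E d, ℂ) := 𝓕⁻ (φ : 𝓢(E d, ℂ)) with hψ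
  set C := SchwartzMap.seminorm ℝ 0 2 ψ with hC
  -- Only the orders 0 and 1 of the infinite vanishing are used: two applications of the mean value
  -- inequality then give a quadratic bound, which is what the weight |ξ|^{-2} of Ḣ² requires.
  have h0 : ψ 0 = 0 := fourierInv_S0_zero φ
  have h1 : fderiv ℝ ψ 0 = 0 := fderiv_fourierInv_S0_zero φ
  have hC0 : 0 ≤ C := apply_nonneg _ _
  have hsm : ContDiff ℝ 2 ψ := ψ.smooth 2
  have hd1 : Differentiable ℝ (fderiv ℝ ψ) :=
    (hsm.fderiv_right (m := 1) (by norm_num)).differentiable (by norm_num)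
  have hb : ∀ x, ‖fderiv ℝ (fderiv ℝ ψ) x‖ ≤ C := by
    intro x
    have := SchwartzMap.norm_iteratedFDeriv_le_seminorm ℝ ψ 2 x
    refine le_trans (le_of_eq ?_) this
    rw [← norm_iteratedFDeriv_fderiv (n := 1), norm_iteratedFDeriv_one]
  have h2 : ∀ x, ‖fderiv ℝ ψ x‖ ≤ C * ‖x‖ := by
    intro x
    have := (convex_univ (𝕜 := ℝ) (E := E d)).norm_image_sub_le_of_norm_fderiv_le
      (f := fderiv ℝ ψ) (fun y _ => hd1 y) (fun y _ => hb y) (Set.mem_univ 0) (Set.mem_univ x)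
    simpa [h1] using this
  have := (convex_closedBall (0 : E d) ‖ξ‖).norm_image_sub_le_of_norm_fderiv_le
      (f := ψ) (C := C * ‖ξ‖) (fun y _ => hsm.differentiable (by norm_num) y)
      (fun y hy => (h2 y).trans (by
        gcongr
        simpa using hy)) (x := 0) (y := ξ) (by simp) (by simp)
  simp only [h0, sub_zero] at this
  calc _ ≤ _ := this
    _ = _ := by ring

/-! ### Symbols of powers of the Laplacian and uniqueness of the Fourier transform -/

theorem symb_ne_zero (s : ℝ) {ξ : E d} (hξ : ξ ≠ 0) : symb s ξ ≠ 0 := by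
  unfold symb
  have : (0:ℝ) < 2 * Real.pi * ‖ξ‖ := by positivity
  exact_mod_cast (Real.rpow_pos_of_pos this s).ne'

theorem symb_add (s t : ℝ) {ξ : E d} (hξ : ξ ≠ 0) : symb (s + t) ξ = symb s ξ * symb t ξ := by
  unfold symb
  have : (0:ℝ) < 2 * Real.pi * ‖ξ‖ := by positivity
  rw [Real.rpow_add this]
  push_cast
  ring

theorem symb_zero (ξ : E d) : symb 0 ξ = 1 := by simp [symb]

theorem symb_mul_neg (s : ℝ) {ξ : E d} (hξ : ξ ≠ 0) : symb s ξ * symb (-s) ξ = 1 := by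
  rw [← symb_add _ _ hξ, add_neg_cancel, symb_zero]

theorem norm_symb (s : ℝ) (ξ : E d) : ‖symb s ξ‖ = (2 * Real.pi * ‖ξ‖) ^ s := by
  unfold symb
  rw [Complex.norm_real, Real.norm_of_nonneg (by positivity)]

theorem measurable_symb (s : ℝ) : Measurable (symb (d := d) s) := by
  unfold symb
  fun_prop

theorem continuousAt_symb (s : ℝ) {ξ : E d} (hξ : ξ ≠ 0) : ContinuousAt (symb (d := d) s) ξ := by
  unfold symb
  have h : (2 * Real.pi * ‖ξ‖) ≠ 0 := by positivity
  have : ContinuousAt (fun ξ : E d => (2 * Real.pi * ‖ξ‖) ^ s) ξ :=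
    ContinuousAt.rpow_const (by fun_prop) (Or.inl h)
  exact Complex.continuous_ofReal.continuousAt.comp this

theorem ae_ne_zero (hd : 1 ≤ d) : ∀ᵐ ξ : E d, ξ ≠ 0 := by
  have : Nonempty (Fin d) := ⟨⟨0, hd⟩⟩
  have : Nontrivial (E d) := inferInstance
  exact Measure.ae_ne volume 0

theorem aestronglyMeasurable_of_hdot {s : ℝ} (hd : 1 ≤ d) {g : E d → ℂ}
    (hg : AEStronglyMeasurable (fun ξ => symb s ξ * g ξ) volume) :
    AEStronglyMeasurable g volume := by
  have h := (measurable_symb (d := d) (-s)).aestronglyMeasurable.mul hg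
  refine h.congr ?_
  filter_upwards [ae_ne_zero hd] with ξ hξ
  simp only [Pi.mul_apply]
  rw [← mul_assoc, mul_comm (symb (-s) ξ), symb_mul_neg s hξ, one_mul]

/-- The symbol is continuous and nonzero away from the origin, so dividing by it keeps local
integrability there. Nothing is claimed at the origin, which test functions supported off 0 do not
see. -/
theorem locallyIntegrableOn_of_hdot {s : ℝ} (hd : 1 ≤ d) {g : E d → ℂ}
    (hg : MemLp (fun ξ => symb s ξ * g ξ) 2 volume) :
    LocallyIntegrableOn g {0}ᶜ volume := by
  have h1 : LocallyIntegrable (fun ξ => symb s ξ * g ξ) volume :=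
    hg.locallyIntegrable (by norm_num)
  have h2 : LocallyIntegrableOn (fun ξ => symb (-s) ξ * (symb s ξ * g ξ)) {0}ᶜ volume := by
    refine (h1.locallyIntegrableOn _).continuousOn_mul ?_ ?_
    · intro ξ hξ
      exact (continuousAt_symb _ hξ).continuousWithinAt
    · exact isOpen_compl_singleton.isLocallyClosed
  intro x hx
  obtain ⟨t, ht, hi⟩ := h2 x hx
  refine ⟨t ∩ {0}ᶜ, inter_mem ht self_mem_nhdsWithin, (hi.mono_set Set.inter_subset_left).congr ?_⟩
  filter_upwards [ae_restrict_of_ae (ae_ne_zero hd)] with ξ hξ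
  rw [← mul_assoc, mul_comm (symb (-s) ξ), symb_mul_neg s hξ, one_mul]

theorem integrable_mul_of_tsupport {g : E d → ℂ} (hg : LocallyIntegrableOn g {0}ᶜ volume)
    {ψ : 𝓢(E d, ℂ)} (hc : HasCompactSupport ψ) (hs : tsupport ψ ⊆ {0}ᶜ) :
    Integrable fun ξ => g ξ * ψ ξ := by
  have hK : IsCompact (tsupport ψ) := hc
  have : IntegrableOn g (tsupport ψ) := hg.integrableOn_compact_subset hs hK
  have h3 : IntegrableOn (fun ξ => g ξ * ψ ξ) (tsupport ψ) :=
    this.mul_continuousOn ψ.continuous.continuousOn hK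
  refine h3.integrable_of_forall_notMem_eq_zero fun ξ hξ => ?_
  rw [image_eq_zero_of_notMem_tsupport hξ, mul_zero]

/-- A function on frequency space that vanishes as a functional on `𝓕⁻¹ 𝒮₀` is zero almost
everywhere. -/
theorem ae_eq_zero_of_fourierInv (hd : 1 ≤ d) {k : E d → ℂ}
    (hk : LocallyIntegrableOn k {0}ᶜ volume)
    (h : ∀ φ : S0 d, HasCompactSupport (𝓕⁻ (φ : 𝓢(E d, ℂ)) : 𝓢(E d, ℂ)) →
      tsupport (𝓕⁻ (φ : 𝓢(E d, ℂ)) : 𝓢(E d, ℂ)) ⊆ {0}ᶜ →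
      ∫ ξ, k ξ * (𝓕⁻ (φ : 𝓢(E d, ℂ)) : 𝓢(E d, ℂ)) ξ = 0) : k =ᵐ[volume] 0 := by
  have key := isOpen_compl_singleton.ae_eq_zero_of_integral_contDiff_smul_eq_zero
    (f := k) (μ := volume) (U := ({0}ᶜ : Set (E d))) hk ?_
  · filter_upwards [key, ae_ne_zero hd] with ξ h hξ
    exact h hξ
  intro θ hθ hc hs
  have hcc : HasCompactSupport (fun ξ => (θ ξ : ℂ)) := hc.comp_left (g := fun x : ℝ => (x : ℂ)) rfl
  have hsm : ContDiff ℝ ∞ (fun ξ => (θ ξ : ℂ)) := Complex.ofRealCLM.contDiff.comp hθ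
  let ψ : 𝓢(E d, ℂ) := hcc.toSchwartzMap hsm
  have hψ : ∀ ξ, ψ ξ = θ ξ := fun ξ => rfl
  have hts : tsupport ψ ⊆ {0}ᶜ :=
    (tsupport_comp_subset (g := fun x : ℝ => (x : ℂ)) rfl θ).trans hs
  have h0 : ∀ᶠ ξ in 𝓝 (0 : E d), ψ ξ = 0 := by
    have : (0 : E d) ∉ tsupport ψ := fun h => (hts h) rfl
    have := (isClosed_tsupport ψ).isOpen_compl.mem_nhds this
    filter_upwards [this] with ξ hξ
    rw [image_eq_zero_of_notMem_tsupport hξ]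
  have hφ : (𝓕⁻ (𝓕 ψ : 𝓢(E d, ℂ)) : 𝓢(E d, ℂ)) = ψ := fourierInv_fourier_schwartz ψ
  have e1 := h ⟨𝓕 ψ, fourier_mem_S0 h0⟩
  simp only [hφ] at e1
  rw [← e1 hcc hts]
  congr 1
  ext ξ
  rw [hψ, Complex.real_smul, mul_comm]

/-- The Fourier transform of an element of `𝒮₀'` is unique almost everywhere. -/
theorem IsFourier.ae_eq {s t : ℝ} (hd : 1 ≤ d) {u : S0Dual d} {g₁ g₂ : E d → ℂ}
    (h₁ : IsHdotFourier s u g₁) (h₂ : IsHdotFourier t u g₂) : g₁ =ᵐ[volume] g₂ := by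
  have l1 := locallyIntegrableOn_of_hdot hd h₁.2
  have l2 := locallyIntegrableOn_of_hdot hd h₂.2
  have key := ae_eq_zero_of_fourierInv hd (k := fun ξ => g₁ ξ - g₂ ξ) (l1.sub l2)
    fun φ hc hs => by
      simp only [sub_mul]
      rw [integral_sub (integrable_mul_of_tsupport l1 hc hs) (integrable_mul_of_tsupport l2 hc hs),
        ← h₁.1 φ, ← h₂.1 φ, sub_self]
  filter_upwards [key] with ξ h
  exact sub_eq_zero.1 h

theorem hdotNorm_eq {s : ℝ} (hd : 1 ≤ d) {u : S0Dual d} {g : E d → ℂ} (h : IsHdotFourier s u g) :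
    hdotNorm s u = eLpNorm (fun ξ => symb s ξ * g ξ) 2 volume := by
  refine le_antisymm (iInf₂_le g h) (le_iInf₂ fun g' h' => le_of_eq ?_)
  refine eLpNorm_congr_ae ?_
  filter_upwards [IsFourier.ae_eq hd h h'] with ξ hξ
  rw [hξ]

theorem exists_of_hdotNorm_lt_top {s : ℝ} {u : S0Dual d} (h : hdotNorm s u < ⊤) :
    ∃ g, IsHdotFourier s u g := by
  by_contra hn
  push Not at hn
  unfold hdotNorm at h
  simp [hn] at h

theorem exists_of_lpNorm_lt_top {q : ℝ} {u : S0Dual d} (h : lpNorm q u < ⊤) :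
    ∃ f, IsLpFunction q u f := by
  by_contra hn
  push Not at hn
  unfold lpNorm at h
  simp [hn] at h

/-- `g` is the Fourier transform at once for two regularities, if each has one. -/
theorem IsHdotFourier.of_hdot {s t : ℝ} (hd : 1 ≤ d) {u : S0Dual d} {g : E d → ℂ}
    (h : IsHdotFourier s u g) (ht : hdotNorm t u < ⊤) : IsHdotFourier t u g := by
  obtain ⟨g', hg'⟩ := exists_of_hdotNorm_lt_top ht
  refine ⟨h.1, hg'.2.ae_eq ?_⟩
  filter_upwards [IsFourier.ae_eq hd h hg'] with ξ hξ
  rw [hξ]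

/-! ### Identification of Ḣ² with L² -/

/-- The weighted function `|ξ|^{-2} 𝓕⁻ φ` is in `L²` for `φ ∈ 𝒮₀`. -/
theorem exists_bound_symb_neg_two : ∃ C : ℝ, 0 ≤ C ∧ ∀ φ : S0 d,
    MemLp (fun ξ => symb (-2) ξ * (𝓕⁻ (φ : 𝓢(E d, ℂ)) : 𝓢(E d, ℂ)) ξ) 2 volume ∧
    eLpNorm (fun ξ => symb (-2) ξ * (𝓕⁻ (φ : 𝓢(E d, ℂ)) : 𝓢(E d, ℂ)) ξ) 2 volume ≤
      ENNReal.ofReal (C * SchwartzMap.seminorm ℝ 0 2 (𝓕⁻ (φ : 𝓢(E d, ℂ)))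
        + ‖(𝓕⁻ (φ : 𝓢(E d, ℂ)) : 𝓢(E d, ℂ)).toLp 2 volume‖) := by
  set μB := eLpNorm ((Metric.closedBall (0 : E d) 1).indicator fun _ => (1 : ℝ)) 2 volume with hμB
  have hmB : MemLp ((Metric.closedBall (0 : E d) 1).indicator fun _ => (1 : ℝ)) 2 volume :=
    memLp_indicator_const 2 measurableSet_closedBall 1
      (Or.inr (isCompact_closedBall (0 : E d) 1).measure_lt_top.ne)
  refine ⟨μB.toReal, ENNReal.toReal_nonneg, fun φ => ?_⟩
  set ψ : 𝓢(E d, ℂ) := 𝓕⁻ (φ : 𝓢(E d, ℂ)) with hψ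
  set S := SchwartzMap.seminorm ℝ 0 2 ψ with hS
  have hS0 : 0 ≤ S := apply_nonneg _ _
  have hle : ∀ ξ, ‖symb (-2) ξ * ψ ξ‖
      ≤ ‖S * (Metric.closedBall (0 : E d) 1).indicator (fun _ => (1 : ℝ)) ξ + ‖ψ ξ‖‖ := by
    intro ξ
    have hi : 0 ≤ (Metric.closedBall (0 : E d) 1).indicator (fun _ => (1 : ℝ)) ξ :=
      Set.indicator_nonneg (fun _ _ => zero_le_one) _
    rw [norm_mul, norm_symb, Real.norm_of_nonneg (by positivity)]
    -- At the origin the symbol takes the value `0 ^ (-2) = 0`. Elsewhere in the unit ball the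
    -- quadratic vanishing cancels the singularity, and outside the ball the weight is at most 1.
    by_cases h0 : ξ = 0
    · rw [h0, norm_zero, mul_zero, Real.zero_rpow (by norm_num), zero_mul]
      rw [h0] at hi
      positivity
    have hξ : 0 < ‖ξ‖ := norm_pos_iff.2 h0
    have h2pi : (2 * Real.pi * ‖ξ‖) ^ (-2 : ℝ) ≤ (‖ξ‖ ^ 2)⁻¹ := by
      rw [Real.rpow_neg (by positivity), Real.rpow_two]
      gcongr
      nlinarith [Real.pi_gt_three]
    by_cases h1 : ξ ∈ Metric.closedBall (0 : E d) 1
    · rw [Set.indicator_of_mem h1, mul_one]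
      calc _ ≤ (‖ξ‖ ^ 2)⁻¹ * (S * ‖ξ‖ ^ 2) := by
            gcongr
            exact norm_fourierInv_S0_le φ ξ
        _ = S := by field_simp
        _ ≤ _ := by linarith [norm_nonneg (ψ ξ)]
    · rw [Set.indicator_of_notMem h1, mul_zero, zero_add]
      have : (2 * Real.pi * ‖ξ‖) ^ (-2 : ℝ) ≤ 1 := by
        refine h2pi.trans (inv_le_one_of_one_le₀ ?_)
        have : 1 < ‖ξ‖ := by simpa using h1
        nlinarith
      calc _ ≤ 1 * ‖ψ ξ‖ := by gcongr
        _ = _ := one_mul _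
  have hm : MemLp (fun ξ => S * (Metric.closedBall (0 : E d) 1).indicator (fun _ => (1 : ℝ)) ξ
      + ‖ψ ξ‖) 2 volume := (hmB.const_mul S).add (ψ.memLp 2 volume).norm
  refine ⟨hm.mono ((measurable_symb _).aestronglyMeasurable.mul
    ψ.continuous.aestronglyMeasurable) (Eventually.of_forall hle), ?_⟩
  refine (eLpNorm_mono hle).trans ?_
  refine (eLpNorm_add_le (hmB.const_mul S).1 (ψ.memLp 2 volume).norm.1 (by norm_num)).trans ?_
  rw [ENNReal.ofReal_add (by positivity) (norm_nonneg _), mul_comm, ENNReal.ofReal_mul hS0,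
    ENNReal.ofReal_toReal hmB.2.ne]
  gcongr
  · have := eLpNorm_const_smul_le (c := S)
      (f := (Metric.closedBall (0 : E d) 1).indicator fun _ => (1 : ℝ)) (p := 2)
      (μ := (volume : Measure (E d)))
    refine le_trans this (le_of_eq ?_)
    rw [← Real.enorm_of_nonneg hS0]
  · rw [eLpNorm_norm, Lp.norm_def, ENNReal.ofReal_toReal (Lp.memLp _).2.ne]
    exact le_of_eq (eLpNorm_congr_ae (ψ.coeFn_toLp 2 volume).symm)

theorem memLp_symb_neg_two (φ : S0 d) :
    MemLp (fun ξ => symb (-2) ξ * (𝓕⁻ (φ : 𝓢(E d, ℂ)) : 𝓢(E d, ℂ)) ξ) 2 volume := by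
  obtain ⟨C, -, h⟩ := exists_bound_symb_neg_two (d := d)
  exact (h φ).1

theorem norm_integral_mul_le {p q : ℝ≥0∞} [ENNReal.HolderConjugate p q] {f g : E d → ℂ}
    (hf : MemLp f p volume) (hg : MemLp g q volume) :
    ‖∫ ξ, f ξ * g ξ‖ ≤ (eLpNorm f p volume).toReal * (eLpNorm g q volume).toReal := by
  have h1 : ‖∫ ξ, f ξ * g ξ‖ₑ ≤ eLpNorm f p volume * eLpNorm g q volume := by
    refine (enorm_integral_le_lintegral_enorm _).trans ?_
    have := eLpNorm_smul_le_mul_eLpNorm (p := p) (q := q) (r := 1) hg.1 hf.1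
    rw [eLpNorm_one_eq_lintegral_enorm] at this
    exact this
  rw [← ENNReal.toReal_mul, ← toReal_enorm]
  exact ENNReal.toReal_mono (ENNReal.mul_ne_top hf.2.ne hg.2.ne) h1

theorem integrable_mul_memLp {p q : ℝ≥0∞} [ENNReal.HolderConjugate p q] {f g : E d → ℂ}
    (hf : MemLp f p volume) (hg : MemLp g q volume) :
    Integrable (fun ξ => f ξ * g ξ) :=
  (hf.integrable_mul hg : _)

/-- The linear functional `φ ↦ ∫ h |2πξ|^{-2} 𝓕⁻φ` on `𝒮₀`, for `h ∈ L²`. -/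
noncomputable def ofL2Linear (h : Lp ℂ 2 (volume : Measure (E d))) : S0 d →ₗ[ℂ] ℂ where
  toFun φ := ∫ ξ, h ξ * (symb (-2) ξ * (𝓕⁻ (φ : 𝓢(E d, ℂ)) : 𝓢(E d, ℂ)) ξ)
  map_add' φ ψ := by
    rw [← integral_add (integrable_mul_memLp (Lp.memLp h) (memLp_symb_neg_two φ))
      (integrable_mul_memLp (Lp.memLp h) (memLp_symb_neg_two ψ))]
    congr 1
    ext ξ
    rw [Submodule.coe_add, FourierTransform.fourierInv_add, add_apply]
    ring
  map_smul' c φ := by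
    rw [RingHom.id_apply, smul_eq_mul, ← integral_const_mul]
    congr 1
    ext ξ
    rw [Submodule.coe_smul, FourierTransform.fourierInv_smul, smul_apply,
      smul_eq_mul]
    ring

/-- The element of `𝒮₀'` with the Fourier transform `|2πξ|^{-2} h`, for `h ∈ L²`. -/
noncomputable def ofL2 (h : Lp ℂ 2 (volume : Measure (E d))) : S0Dual d where
  toLinearMap := ofL2Linear h
  cont := by
    obtain ⟨C, hC, hb⟩ := exists_bound_symb_neg_two (d := d)
    have hbound : ∀ φ : S0 d, ‖ofL2Linear h φ‖ ≤ ‖h‖ * (C * SchwartzMap.seminorm ℝ 0 2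
        (𝓕⁻ (φ : 𝓢(E d, ℂ)) : 𝓢(E d, ℂ)) + ‖(𝓕⁻ (φ : 𝓢(E d, ℂ)) : 𝓢(E d, ℂ)).toLp 2 volume‖) := by
      intro φ
      refine (norm_integral_mul_le (Lp.memLp h) (memLp_symb_neg_two φ)).trans ?_
      rw [← Lp.norm_def]
      gcongr
      refine ENNReal.toReal_le_of_le_ofReal (by positivity) (hb φ).2
    have hc1 : Continuous fun φ : S0 d => (𝓕⁻ (φ : 𝓢(E d, ℂ)) : 𝓢(E d, ℂ)) :=
      (FourierTransform.fourierInvCLM ℂ 𝓢(E d, ℂ)).continuous.comp continuous_subtype_val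
    have hc2 : Continuous fun φ : S0 d => ‖h‖ * (C * SchwartzMap.seminorm ℝ 0 2
        (𝓕⁻ (φ : 𝓢(E d, ℂ)) : 𝓢(E d, ℂ))
        + ‖(𝓕⁻ (φ : 𝓢(E d, ℂ)) : 𝓢(E d, ℂ)).toLp 2 volume‖) := by
      have hs : Continuous (SchwartzMap.seminorm ℝ 0 2 : Seminorm ℝ 𝓢(E d, ℂ)) :=
        (schwartz_withSeminorms ℝ (E d) ℂ).continuous_seminorm (0, 2)
      have ht : Continuous fun ψ : 𝓢(E d, ℂ) => ψ.toLp 2 volume := SchwartzMap.continuous_toLp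
      exact continuous_const.mul
        ((continuous_const.mul (hs.comp hc1)).add (ht.comp hc1).norm)
    show Continuous (ofL2Linear h)
    refine continuous_of_continuousAt_zero (ofL2Linear h) ?_
    unfold ContinuousAt
    rw [map_zero]
    refine squeeze_zero_norm hbound ?_
    have h0 : (0 : 𝓢(E d, ℂ)).toLp 2 volume = 0 :=
      (SchwartzMap.toLpCLM ℂ ℂ 2 (volume : Measure (E d))).map_zero
    have := hc2.tendsto 0
    simpa [h0] using this

theorem ofL2_apply (h : Lp ℂ 2 (volume : Measure (E d))) (φ : S0 d) :
    ofL2 h φ = ∫ ξ, h ξ * (symb (-2) ξ * (𝓕⁻ (φ : 𝓢(E d, ℂ)) : 𝓢(E d, ℂ)) ξ) := rfl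

theorem ofL2_isHdotFourier (hd : 1 ≤ d) (h : Lp ℂ 2 (volume : Measure (E d))) :
    IsHdotFourier 2 (ofL2 h) fun ξ => symb (-2) ξ * h ξ := by
  refine ⟨fun φ => ?_, (Lp.memLp h).ae_eq ?_⟩
  · rw [ofL2_apply]
    congr 1
    ext ξ
    ring
  · filter_upwards [ae_ne_zero hd] with ξ hξ
    rw [← mul_assoc, symb_mul_neg 2 hξ, one_mul]

theorem integrable_fourier_pairing (hd : 1 ≤ d) {g : E d → ℂ}
    (hg : MemLp (fun ξ => symb 2 ξ * g ξ) 2 volume) (φ : S0 d) :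
    Integrable fun ξ => g ξ * (𝓕⁻ (φ : 𝓢(E d, ℂ)) : 𝓢(E d, ℂ)) ξ := by
  refine (integrable_mul_memLp hg (memLp_symb_neg_two φ)).congr ?_
  filter_upwards [ae_ne_zero hd] with ξ hξ
  calc _ = (symb 2 ξ * symb (-2) ξ) * (g ξ * (𝓕⁻ (φ : 𝓢(E d, ℂ)) : 𝓢(E d, ℂ)) ξ) := by ring
    _ = _ := by rw [symb_mul_neg 2 hξ, one_mul]

theorem fourier_pairing_eq (hd : 1 ≤ d) (g : E d → ℂ) (φ : S0 d) :
    ∫ ξ, g ξ * (𝓕⁻ (φ : 𝓢(E d, ℂ)) : 𝓢(E d, ℂ)) ξ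
      = ∫ ξ, (symb 2 ξ * g ξ) * (symb (-2) ξ * (𝓕⁻ (φ : 𝓢(E d, ℂ)) : 𝓢(E d, ℂ)) ξ) := by
  refine integral_congr_ae ?_
  filter_upwards [ae_ne_zero hd] with ξ hξ
  calc _ = (symb 2 ξ * symb (-2) ξ) * (g ξ * (𝓕⁻ (φ : 𝓢(E d, ℂ)) : 𝓢(E d, ℂ)) ξ) := by
        rw [symb_mul_neg 2 hξ, one_mul]
    _ = _ := by ring

/-- With `ofL2_isHdotFourier` this makes Ḣ² a copy of L², so weak compactness in Ḣ² is weak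
compactness in a separable Hilbert space. -/
theorem IsHdotFourier.eq_ofL2 (hd : 1 ≤ d) {u : S0Dual d} {g : E d → ℂ}
    (h : IsHdotFourier 2 u g) : u = ofL2 h.2.toLp := by
  ext φ
  rw [h.1 φ, fourier_pairing_eq hd, ofL2_apply]
  refine integral_congr_ae ?_
  filter_upwards [h.2.coeFn_toLp] with ξ hξ
  rw [hξ]

/-! ### Smoothing of `L^q` functions and the low-high frequency splitting -/

/-- The exponent dual to `q`, as an extended number. -/
noncomputable def dualExp (q : ℝ) : ℝ≥0∞ := ENNReal.ofReal q.conjExponent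

theorem holderConjugate_dualExp {q : ℝ} (hq : 1 < q) :
    ENNReal.HolderConjugate (ENNReal.ofReal q) (dualExp q) :=
  (Real.HolderConjugate.conjExponent hq).ennrealOfReal

theorem integrable_mul_schwartz {q : ℝ} (hq : 1 < q) {f : E d → ℂ}
    (hf : MemLp f (ENNReal.ofReal q) volume) (φ : 𝓢(E d, ℂ)) :
    Integrable fun x => f x * φ x := by
  have := holderConjugate_dualExp hq
  exact integrable_mul_memLp hf (φ.memLp (dualExp q) volume)

theorem fourier_sub_schwartz (φ ψ : 𝓢(E d, ℂ)) :
    (𝓕 (φ - ψ) : 𝓢(E d, ℂ)) = 𝓕 φ - 𝓕 ψ :=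
  map_sub (FourierTransform.fourierCLM ℂ 𝓢(E d, ℂ)) φ ψ

theorem fourierInv_sub_schwartz (φ ψ : 𝓢(E d, ℂ)) :
    (𝓕⁻ (φ - ψ) : 𝓢(E d, ℂ)) = 𝓕⁻ φ - 𝓕⁻ ψ :=
  map_sub (FourierTransform.fourierInvCLM ℂ 𝓢(E d, ℂ)) φ ψ

/-- The smoothing `x ↦ ∫ f(y) κ(y - x) dy` of `f`. -/
noncomputable def smooth (κ : 𝓢(E d, ℂ)) (f : E d → ℂ) (x : E d) : ℂ := ∫ y, f y * κ (y - x)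

theorem eLpNorm_compSubConst (κ : 𝓢(E d, ℂ)) (x : E d) (p : ℝ≥0∞) :
    eLpNorm (κ.compSubConstCLM ℂ x) p volume = eLpNorm κ p volume := by
  have := eLpNorm_comp_measurePreserving (p := p) (κ.continuous.aestronglyMeasurable)
    (measurePreserving_sub_right (volume : Measure (E d)) x)
  rw [← this]
  rfl

theorem integrable_smooth {q : ℝ} (hq : 1 < q) {f : E d → ℂ}
    (hf : MemLp f (ENNReal.ofReal q) volume) (κ : 𝓢(E d, ℂ)) (x : E d) :
    Integrable fun y => f y * κ (y - x) :=
  integrable_mul_schwartz hq hf (κ.compSubConstCLM ℂ x)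

theorem integral_norm_smooth_le {q : ℝ} (hq : 1 < q) {f : E d → ℂ}
    (hf : MemLp f (ENNReal.ofReal q) volume) (κ : 𝓢(E d, ℂ)) (x : E d) :
    ∫ y, ‖f y * κ (y - x)‖ ≤ (eLpNorm f (ENNReal.ofReal q) volume).toReal
      * (eLpNorm κ (dualExp q) volume).toReal := by
  have := holderConjugate_dualExp hq
  have hκ : MemLp (κ.compSubConstCLM ℂ x) (dualExp q) volume := SchwartzMap.memLp _ _ volume
  rw [integral_norm_eq_lintegral_enorm (integrable_smooth hq hf κ x).1, ← ENNReal.toReal_mul]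
  refine ENNReal.toReal_mono (ENNReal.mul_ne_top hf.2.ne (SchwartzMap.memLp κ _ volume).2.ne) ?_
  have := eLpNorm_smul_le_mul_eLpNorm (p := ENNReal.ofReal q) (q := dualExp q) (r := 1) hκ.1 hf.1
  rw [eLpNorm_one_eq_lintegral_enorm, eLpNorm_compSubConst] at this
  exact this

theorem norm_smooth_le {q : ℝ} (hq : 1 < q) {f : E d → ℂ}
    (hf : MemLp f (ENNReal.ofReal q) volume) (κ : 𝓢(E d, ℂ)) (x : E d) :
    ‖smooth κ f x‖ ≤ (eLpNorm f (ENNReal.ofReal q) volume).toReal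
      * (eLpNorm κ (dualExp q) volume).toReal :=
  (norm_integral_le_integral_norm _).trans (integral_norm_smooth_le hq hf κ x)

theorem aestronglyMeasurable_smooth_kernel {f : E d → ℂ} (hf : AEStronglyMeasurable f volume)
    (κ : 𝓢(E d, ℂ)) : AEStronglyMeasurable (fun z : E d × E d => f z.2 * κ (z.2 - z.1))
      (volume.prod volume) :=
  hf.comp_snd.mul
    ((κ.continuous.comp (continuous_snd.sub continuous_fst)).aestronglyMeasurable)

theorem aestronglyMeasurable_smooth {f : E d → ℂ} (hf : AEStronglyMeasurable f volume)
    (κ : 𝓢(E d, ℂ)) : AEStronglyMeasurable (smooth κ f) volume :=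
  (aestronglyMeasurable_smooth_kernel hf κ).integral_prod_right'

/-- Convolution with `κ` on Schwartz functions, the transpose of `smooth κ`. -/
noncomputable def conv (κ φ : 𝓢(E d, ℂ)) : 𝓢(E d, ℂ) :=
  SchwartzMap.convolution (ContinuousLinearMap.mul ℂ ℂ) φ κ

theorem conv_apply (κ φ : 𝓢(E d, ℂ)) (y : E d) : conv κ φ y = ∫ x, φ x * κ (y - x) := by
  rw [conv, SchwartzMap.convolution_apply]
  rfl

theorem fourier_conv (κ φ : 𝓢(E d, ℂ)) (ξ : E d) :
    (𝓕 (conv κ φ) : 𝓢(E d, ℂ)) ξ = (𝓕 φ : 𝓢(E d, ℂ)) ξ * (𝓕 κ : 𝓢(E d, ℂ)) ξ := by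
  rw [conv, SchwartzMap.fourier_convolution, SchwartzMap.pairing_apply_apply]
  rfl

theorem fourierInv_conv_fourier (χ φ : 𝓢(E d, ℂ)) (ξ : E d) :
    (𝓕⁻ (conv (𝓕 χ) φ) : 𝓢(E d, ℂ)) ξ = χ ξ * (𝓕⁻ φ : 𝓢(E d, ℂ)) ξ := by
  rw [fourierInv_apply_neg, fourier_conv, fourier_apply_neg (𝓕 χ), fourierInv_fourier_schwartz,
    neg_neg, ← fourierInv_apply_neg, mul_comm]

theorem integral_smooth_mul {q : ℝ} (hq : 1 < q) {f : E d → ℂ}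
    (hf : MemLp f (ENNReal.ofReal q) volume) (κ φ : 𝓢(E d, ℂ)) :
    ∫ x, smooth κ f x * φ x = ∫ y, f y * conv κ φ y := by
  have hint : Integrable (Function.uncurry fun x y : E d => f y * κ (y - x) * φ x)
      (volume.prod volume) := by
    have hm : AEStronglyMeasurable (Function.uncurry fun x y : E d => f y * κ (y - x) * φ x)
        (volume.prod volume) :=
      (aestronglyMeasurable_smooth_kernel hf.1 κ).mul
        (φ.continuous.comp continuous_fst).aestronglyMeasurable
    rw [integrable_prod_iff hm]
    refine ⟨Eventually.of_forall fun x => (integrable_smooth hq hf κ x).mul_const (φ x), ?_⟩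
    refine Integrable.mono' (g := fun x => (eLpNorm f (ENNReal.ofReal q) volume).toReal
      * (eLpNorm κ (dualExp q) volume).toReal * ‖φ x‖) (φ.integrable.norm.const_mul _)
      hm.norm.integral_prod_right' (Eventually.of_forall fun x => ?_)
    rw [Real.norm_of_nonneg (integral_nonneg fun y => norm_nonneg _)]
    simp only [Function.uncurry_apply_pair, norm_mul (_ * _) (φ x), integral_mul_const]
    gcongr
    exact integral_norm_smooth_le hq hf κ x
  have h1 : ∀ x, smooth κ f x * φ x = ∫ y, f y * κ (y - x) * φ x := fun x => by
    rw [smooth, integral_mul_const]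
  simp_rw [h1]
  rw [integral_integral_swap hint]
  congr 1
  ext y
  rw [conv_apply, ← integral_const_mul]
  congr 1
  ext x
  ring

/-- The Fourier transform of the difference is (1 − χ(−ξ)) times that of `φ`, hence zero near 0. In
this way an arbitrary Schwartz function becomes a member of 𝒮₀ up to a low-frequency error. -/
theorem sub_conv_mem_S0 {χ : 𝓢(E d, ℂ)} (hχ : ∀ᶠ ξ in 𝓝 0, χ ξ = 1) (φ : 𝓢(E d, ℂ)) :
    φ - conv (𝓕 χ) φ ∈ S0 d := by
  apply mem_S0_of_eventually
  have h2 : Tendsto (fun ξ : E d => -ξ) (𝓝 0) (𝓝 0) := by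
    simpa using (continuous_neg (G := E d)).tendsto 0
  filter_upwards [h2.eventually hχ] with ξ hξ
  rw [fourier_sub_schwartz, sub_apply, fourier_conv, fourier_apply_neg (𝓕 χ),
    fourierInv_fourier_schwartz, hξ, mul_one, sub_self]

theorem integral_fourierInv_L2_mul (h : Lp ℂ 2 (volume : Measure (E d))) (φ : 𝓢(E d, ℂ)) :
    ∫ x, (𝓕⁻ h : Lp ℂ 2 (volume : Measure (E d))) x * φ x = ∫ ξ, h ξ * (𝓕⁻ φ : 𝓢(E d, ℂ)) ξ := by
  have h1 := congrArg (fun T => T φ) (Lp.fourierInv_toTemperedDistribution_eq h)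
  simp only [TemperedDistribution.fourierInv_apply, Lp.toTemperedDistribution_apply,
    smul_eq_mul] at h1
  simp only [mul_comm _ (φ _), ← h1, mul_comm (h _)]

theorem ae_eq_zero_of_schwartz {k : E d → ℂ} (hk : LocallyIntegrable k volume)
    (h : ∀ φ : 𝓢(E d, ℂ), ∫ x, k x * φ x = 0) : k =ᵐ[volume] 0 := by
  refine ae_eq_zero_of_integral_contDiff_smul_eq_zero hk fun θ hθ hc => ?_
  have hcc : HasCompactSupport (fun ξ => (θ ξ : ℂ)) := hc.comp_left (g := fun x : ℝ => (x : ℂ)) rfl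
  have hsm : ContDiff ℝ ∞ (fun ξ => (θ ξ : ℂ)) := Complex.ofRealCLM.contDiff.comp hθ
  rw [← h (hcc.toSchwartzMap hsm)]
  congr 1
  ext x
  rw [Complex.real_smul, mul_comm]
  rfl

/-- Splitting of a function into low and high frequencies. -/
theorem ae_eq_smooth_add {q : ℝ} (hq : 1 < q) {f g : E d → ℂ}
    (hf : MemLp f (ENNReal.ofReal q) volume)
    (hfg : ∀ φ : S0 d, ∫ x, f x * (φ : 𝓢(E d, ℂ)) x = ∫ ξ, g ξ * (𝓕⁻ (φ : 𝓢(E d, ℂ)) : 𝓢(E d, ℂ)) ξ)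
    {χ : 𝓢(E d, ℂ)} (hχ : ∀ᶠ ξ in 𝓝 0, χ ξ = 1)
    (hg : MemLp (fun ξ => (1 - χ ξ) * g ξ) 2 volume) :
    f =ᵐ[volume] fun x => smooth (𝓕 χ) f x
      + (𝓕⁻ hg.toLp : Lp ℂ 2 (volume : Measure (E d))) x := by
  set F : Lp ℂ 2 (volume : Measure (E d)) := 𝓕⁻ hg.toLp with hF
  have hsm := aestronglyMeasurable_smooth hf.1 (𝓕 χ)
  have hq1 : 1 ≤ ENNReal.ofReal q := by
    rw [← ENNReal.ofReal_one]
    exact ENNReal.ofReal_le_ofReal hq.le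
  have hsmL : MemLp (smooth (𝓕 χ) f) ⊤ volume :=
    memLp_top_of_bound hsm _ (Eventually.of_forall fun x => norm_smooth_le hq hf (𝓕 χ) x)
  have i1 : ∀ φ : 𝓢(E d, ℂ), Integrable fun x => smooth (𝓕 χ) f x * φ x := fun φ => by
    refine φ.integrable.bdd_mul (c := (eLpNorm f (ENNReal.ofReal q) volume).toReal
      * (eLpNorm (𝓕 χ : 𝓢(E d, ℂ)) (dualExp q) volume).toReal) hsm ?_
    exact Eventually.of_forall fun x => norm_smooth_le hq hf _ x
  have i2 : ∀ φ : 𝓢(E d, ℂ), Integrable fun x => F x * φ x := fun φ =>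
    integrable_mul_memLp (Lp.memLp F) (φ.memLp 2 volume)
  have key : (fun x => f x - smooth (𝓕 χ) f x - F x) =ᵐ[volume] 0 := by
    refine ae_eq_zero_of_schwartz ?_ fun φ => ?_
    · exact ((hf.locallyIntegrable hq1).sub (hsmL.locallyIntegrable le_top)).sub
        ((Lp.memLp F).locallyIntegrable (by norm_num))
    -- Testing with φ minus its low-frequency part: in space this transposes to f minus its
    -- smoothing, in frequency it multiplies g by 1 − χ, which is the transform of `F`.
    · have e1 := hfg ⟨_, sub_conv_mem_S0 hχ φ⟩
      have e2 : ∫ x, f x * (φ - conv (𝓕 χ) φ) x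
          = (∫ x, f x * φ x) - ∫ x, smooth (𝓕 χ) f x * φ x := by
        rw [integral_smooth_mul hq hf, ← integral_sub (integrable_mul_schwartz hq hf _)
          (integrable_mul_schwartz hq hf _)]
        congr 1
        ext x
        rw [sub_apply]
        ring
      have e3 : ∫ ξ, g ξ * (𝓕⁻ (φ - conv (𝓕 χ) φ) : 𝓢(E d, ℂ)) ξ = ∫ x, F x * φ x := by
        rw [hF, integral_fourierInv_L2_mul]
        refine integral_congr_ae ?_
        filter_upwards [hg.coeFn_toLp] with ξ hξ
        rw [hξ, fourierInv_sub_schwartz, sub_apply, fourierInv_conv_fourier]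
        ring
      simp only [] at e1
      rw [e2, e3] at e1
      calc _ = ∫ x, (f x * φ x - smooth (𝓕 χ) f x * φ x - F x * φ x) := by
            congr 1
            ext x
            ring
        _ = 0 := by
          have i3 : Integrable fun x => f x * φ x - smooth (𝓕 χ) f x * φ x :=
            (integrable_mul_schwartz hq hf φ).sub (i1 φ)
          rw [integral_sub i3 (i2 φ),
            integral_sub (integrable_mul_schwartz hq hf _) (i1 φ), e1, sub_self]
  filter_upwards [key] with x hx
  have : f x - smooth (𝓕 χ) f x - F x = 0 := hx
  rw [sub_sub, sub_eq_zero] at this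
  exact this

/-! ### Dilations, frequency cutoffs and uniqueness of `L^q` representatives -/

/-- The dilation `φ ↦ φ(a ·)` on Schwartz functions. -/
noncomputable def dil (a : ℝ) (ha : 0 < a) : 𝓢(E d, ℂ) →L[ℂ] 𝓢(E d, ℂ) :=
  SchwartzMap.compCLMOfContinuousLinearEquiv ℂ
    (ContinuousLinearEquiv.smulLeft (R₁ := ℝ) (M₁ := E d) (Units.mk0 a ha.ne'))

theorem dil_apply (a : ℝ) (ha : 0 < a) (φ : 𝓢(E d, ℂ)) (x : E d) : dil a ha φ x = φ (a • x) := rfl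

theorem integral_comp_dil {F : Type*} [NormedAddCommGroup F] [NormedSpace ℝ F] {a : ℝ} (ha : 0 < a)
    (f : E d → F) : ∫ x, f (a • x) = (a ^ d)⁻¹ • ∫ x, f x := by
  rw [Measure.integral_comp_smul, finrank_euclideanSpace_fin, abs_of_pos (by positivity)]

theorem fourier_dil {a : ℝ} (ha : 0 < a) (φ : 𝓢(E d, ℂ)) (ξ : E d) :
    (𝓕 (dil a ha φ) : 𝓢(E d, ℂ)) ξ = ((a ^ d)⁻¹ : ℝ) * (𝓕 φ : 𝓢(E d, ℂ)) (a⁻¹ • ξ) := by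
  rw [SchwartzMap.fourier_coe, SchwartzMap.fourier_coe, Real.fourier_eq', Real.fourier_eq']
  have := integral_comp_dil ha (fun x : E d => Complex.exp
    (((-2 * Real.pi * inner ℝ x (a⁻¹ • ξ) : ℝ) : ℂ) * Complex.I) • φ x)
  rw [Complex.real_smul] at this
  rw [← this]
  congr 1
  ext x
  rw [dil_apply, inner_smul_left, inner_smul_right]
  congr 5
  simp
  field_simp

theorem fourierInv_dil {a : ℝ} (ha : 0 < a) (φ : 𝓢(E d, ℂ)) (ξ : E d) :
    (𝓕⁻ (dil a ha φ) : 𝓢(E d, ℂ)) ξ = ((a ^ d)⁻¹ : ℝ) * (𝓕⁻ φ : 𝓢(E d, ℂ)) (a⁻¹ • ξ) := by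
  rw [fourierInv_apply_neg, fourierInv_apply_neg, fourier_dil, smul_neg]

theorem dil_mem_S0 {a : ℝ} (ha : 0 < a) {φ : 𝓢(E d, ℂ)} (hφ : φ ∈ S0 d) : dil a ha φ ∈ S0 d := by
  intro k
  have h1 : ((𝓕 (dil a ha φ) : 𝓢(E d, ℂ)) : E d → ℂ)
      = (((a ^ d)⁻¹ : ℝ) : ℂ) • ((𝓕 φ : 𝓢(E d, ℂ)) ∘
        (a⁻¹ • ContinuousLinearMap.id ℝ (E d))) := by
    ext ξ
    rw [fourier_dil]
    rfl
  have hs : ContDiff ℝ k ((𝓕 φ : 𝓢(E d, ℂ)) ∘ (a⁻¹ • ContinuousLinearMap.id ℝ (E d))) :=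
    ((𝓕 φ : 𝓢(E d, ℂ)).smooth k).comp (ContinuousLinearMap.contDiff _)
  rw [h1, iteratedFDeriv_const_smul_apply hs.contDiffAt,
    ContinuousLinearMap.iteratedFDeriv_comp_right _ ((𝓕 φ : 𝓢(E d, ℂ)).smooth k) _ le_rfl,
    map_zero, hφ k]
  ext v
  simp

theorem eLpNorm_comp_dil {F : Type*} [NormedAddCommGroup F] {a : ℝ} (ha : 0 < a) {p : ℝ}
    (hp : 0 < p) (f : E d → F) :
    eLpNorm (fun x => f (a • x)) (ENNReal.ofReal p) volume
      = ENNReal.ofReal (a ^ (-(d / p) : ℝ)) * eLpNorm f (ENNReal.ofReal p) volume := by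
  have h1 := (measurableEmbedding_const_smul₀ (α := E d) ha.ne').eLpNorm_map_measure
    (g := f) (p := ENNReal.ofReal p) (μ := volume)
  rw [Measure.map_addHaar_smul _ ha.ne', eLpNorm_smul_measure_of_ne_top ENNReal.ofReal_ne_top] at h1
  change _ = eLpNorm (fun x => f (a • x)) _ _ at h1
  rw [← h1, smul_eq_mul, finrank_euclideanSpace_fin, abs_of_pos (by positivity), one_div,
    ENNReal.toReal_inv, ENNReal.toReal_ofReal hp.le,
    ENNReal.ofReal_rpow_of_nonneg (by positivity) (by positivity)]
  congr 2
  rw [← Real.rpow_natCast, ← Real.rpow_neg ha.le, ← Real.rpow_mul ha.le]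
  congr 1
  ring

/-- A fixed smooth cutoff, equal to `1` on the unit ball and to `0` outside the ball of radius
`2`. -/
noncomputable def bump (d : ℕ) : ContDiffBump (0 : E d) := ⟨1, 2, one_pos, one_lt_two⟩

/-- The frequency cutoff at frequency `1`, as a Schwartz function. -/
noncomputable def chi (d : ℕ) : 𝓢(E d, ℂ) :=
  HasCompactSupport.toSchwartzMap (f := fun ξ => ((bump d ξ : ℝ) : ℂ))
    ((bump d).hasCompactSupport.comp_left (g := fun x : ℝ => (x : ℂ)) rfl)
    (Complex.ofRealCLM.contDiff.comp (bump d).contDiff)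

theorem chi_apply (ξ : E d) : chi d ξ = ((bump d ξ : ℝ) : ℂ) := rfl

/-- The frequency cutoff at frequency `A`. -/
noncomputable def cutoff (A : ℝ) (hA : 0 < A) : 𝓢(E d, ℂ) := dil A⁻¹ (inv_pos.2 hA) (chi d)

theorem cutoff_apply {A : ℝ} (hA : 0 < A) (ξ : E d) :
    cutoff A hA ξ = ((bump d (A⁻¹ • ξ) : ℝ) : ℂ) := rfl

theorem cutoff_eq_one {A : ℝ} (hA : 0 < A) {ξ : E d} (h : ‖ξ‖ ≤ A) : cutoff A hA ξ = 1 := by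
  rw [cutoff_apply, (bump d).one_of_mem_closedBall, Complex.ofReal_one]
  rw [mem_closedBall_zero_iff, norm_smul, norm_inv, Real.norm_of_nonneg hA.le]
  change _ ≤ (1 : ℝ)
  field_simp
  exact h

theorem cutoff_eq_zero {A : ℝ} (hA : 0 < A) {ξ : E d} (h : 2 * A ≤ ‖ξ‖) : cutoff A hA ξ = 0 := by
  rw [cutoff_apply, (bump d).zero_of_le_dist, Complex.ofReal_zero]
  rw [dist_zero_right, norm_smul, norm_inv, Real.norm_of_nonneg hA.le]
  change (2 : ℝ) ≤ _
  field_simp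
  linarith

theorem norm_one_sub_cutoff_le {A : ℝ} (hA : 0 < A) (ξ : E d) : ‖1 - cutoff A hA ξ‖ ≤ 1 := by
  rw [cutoff_apply, ← Complex.ofReal_one, ← Complex.ofReal_sub, Complex.norm_real, Real.norm_eq_abs,
    abs_le]
  constructor <;> linarith [(bump d).nonneg (x := A⁻¹ • ξ), (bump d).le_one (x := A⁻¹ • ξ)]

theorem norm_cutoff_le {A : ℝ} (hA : 0 < A) (ξ : E d) : ‖cutoff A hA ξ‖ ≤ 1 := by
  rw [cutoff_apply, Complex.norm_real, Real.norm_eq_abs, abs_le]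
  constructor <;> linarith [(bump d).nonneg (x := A⁻¹ • ξ), (bump d).le_one (x := A⁻¹ • ξ)]

theorem cutoff_eventually {A : ℝ} (hA : 0 < A) : ∀ᶠ ξ in 𝓝 (0 : E d), cutoff A hA ξ = 1 := by
  filter_upwards [Metric.closedBall_mem_nhds (0 : E d) hA] with ξ hξ
  exact cutoff_eq_one hA (by simpa using hξ)

theorem fourier_cutoff {A : ℝ} (hA : 0 < A) (x : E d) :
    (𝓕 (cutoff A hA) : 𝓢(E d, ℂ)) x = ((A ^ d : ℝ) : ℂ) * (𝓕 (chi d) : 𝓢(E d, ℂ)) (A • x) := by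
  rw [cutoff, fourier_dil, inv_inv]
  congr 3
  rw [inv_pow, inv_inv]

/-- The size of the kernel of the frequency cutoff in `L^{q'}`. -/
noncomputable def kerNorm (d : ℕ) (q : ℝ) : ℝ :=
  (eLpNorm (𝓕 (chi d) : 𝓢(E d, ℂ)) (dualExp q) volume).toReal

/-- The kernel is A^d times a dilate by A of a fixed function, so its L^{q'} norm scales like A^{d −
d/q'} = A^{d/q}. With Hölder this is Bernstein's inequality, `norm_smooth_cutoff_le`. -/
theorem eLpNorm_fourier_cutoff {q : ℝ} (hq : 1 < q) {A : ℝ} (hA : 0 < A) :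
    (eLpNorm (𝓕 (cutoff A hA) : 𝓢(E d, ℂ)) (dualExp q) volume).toReal
      = A ^ (d / q : ℝ) * kerNorm d q := by
  have hc := Real.HolderConjugate.conjExponent hq
  have h1 : ((𝓕 (cutoff A hA) : 𝓢(E d, ℂ)) : E d → ℂ) = ((A ^ d : ℝ) : ℂ) •
      fun x => (𝓕 (chi d) : 𝓢(E d, ℂ)) (A • x) := funext (fourier_cutoff hA)
  rw [h1, eLpNorm_const_smul, dualExp, eLpNorm_comp_dil hA hc.symm.pos]
  rw [ENNReal.toReal_mul, ENNReal.toReal_mul, ENNReal.toReal_ofReal (by positivity), ← mul_assoc,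
    toReal_enorm, Complex.norm_real, Real.norm_of_nonneg (by positivity), kerNorm, dualExp,
    ← Real.rpow_natCast, ← Real.rpow_add hA]
  congr 2
  have := hc.inv_add_inv_eq_one
  have h2 : q.conjExponent⁻¹ = 1 - q⁻¹ := by linarith
  rw [div_eq_mul_inv, h2, div_eq_mul_inv]
  ring

theorem norm_smooth_cutoff_le {q : ℝ} (hq : 1 < q) {f : E d → ℂ}
    (hf : MemLp f (ENNReal.ofReal q) volume) {A : ℝ} (hA : 0 < A) (x : E d) :
    ‖smooth (𝓕 (cutoff A hA)) f x‖ ≤ (eLpNorm f (ENNReal.ofReal q) volume).toReal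
      * (A ^ (d / q : ℝ) * kerNorm d q) := by
  rw [← eLpNorm_fourier_cutoff hq hA]
  exact norm_smooth_le hq hf _ x

/-- A function in `L^q` that vanishes in `𝒮₀'` is zero. -/
theorem ae_eq_zero_of_S0 (hd : 1 ≤ d) {q : ℝ} (hq : 1 < q) {f : E d → ℂ}
    (hf : MemLp f (ENNReal.ofReal q) volume)
    (h : ∀ φ : S0 d, ∫ x, f x * (φ : 𝓢(E d, ℂ)) x = 0) : f =ᵐ[volume] 0 := by
  set c : ℝ := (eLpNorm f (ENNReal.ofReal q) volume).toReal with hc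
  -- With g = 0 there is no high-frequency part, so f equals its own smoothing at every cutoff. At
  -- cutoff 1/(n+1) Bernstein bounds it by a multiple of (n+1)^{-d/q}, which tends to 0.
  have key : ∀ n : ℕ, ∀ᵐ x : E d, ‖f x‖ ≤ c * ((1 / ((n : ℝ) + 1)) ^ (d / q : ℝ) * kerNorm d q) := by
    intro n
    have hA : (0 : ℝ) < 1 / ((n : ℝ) + 1) := by positivity
    have h0 : (fun ξ : E d => (1 - cutoff _ hA ξ) * (0 : E d → ℂ) ξ) = 0 := by
      ext ξ
      simp
    have hg : MemLp (fun ξ : E d => (1 - cutoff _ hA ξ) * (0 : E d → ℂ) ξ) 2 volume := by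
      rw [h0]
      exact MemLp.zero
    have hs := ae_eq_smooth_add hq hf (g := 0) (fun φ => by simpa using h φ)
      (cutoff_eventually hA) hg
    have h1 : hg.toLp = 0 := by
      rw [MemLp.toLp_eq_toLp_iff (g := 0) hg MemLp.zero |>.2 (by rw [h0])]
      exact MemLp.toLp_zero _
    have h2 : (𝓕⁻ hg.toLp : Lp ℂ 2 (volume : Measure (E d))) = 0 := by
      rw [h1]
      exact map_zero (FourierTransform.fourierInvCLM ℂ (Lp ℂ 2 (volume : Measure (E d))))
    rw [h2] at hs
    filter_upwards [hs, Lp.coeFn_zero ℂ 2 (volume : Measure (E d))] with x hx h0x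
    rw [hx, h0x, Pi.zero_apply, add_zero]
    exact norm_smooth_cutoff_le hq hf hA x
  filter_upwards [ae_all_iff.2 key] with x hx
  have hlim : Tendsto (fun n : ℕ => c * ((1 / ((n : ℝ) + 1)) ^ (d / q : ℝ) * kerNorm d q)) atTop
      (𝓝 (c * (0 ^ (d / q : ℝ) * kerNorm d q))) := by
    refine Tendsto.const_mul _ (Tendsto.mul_const _ ?_)
    have hdq : 0 < (d / q : ℝ) := by
      have : (0 : ℝ) < d := by exact_mod_cast hd
      positivity
    exact (Real.continuousAt_rpow_const 0 _ (Or.inr hdq.le)).tendsto.comp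
      tendsto_one_div_add_atTop_nhds_zero_nat
  have hdq : (d / q : ℝ) ≠ 0 := by
    have : (0 : ℝ) < d := by exact_mod_cast hd
    positivity
  rw [Real.zero_rpow hdq, zero_mul, mul_zero] at hlim
  have := ge_of_tendsto' hlim hx
  simpa using this

theorem IsFunction.ae_eq (hd : 1 ≤ d) {q : ℝ} (hq : 1 < q) {u : S0Dual d} {f₁ f₂ : E d → ℂ}
    (h₁ : IsLpFunction q u f₁) (h₂ : IsLpFunction q u f₂) : f₁ =ᵐ[volume] f₂ := by
  have := ae_eq_zero_of_S0 hd hq (h₁.2.sub h₂.2) fun φ => by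
    simp only [Pi.sub_apply, sub_mul]
    rw [integral_sub (integrable_mul_schwartz hq h₁.2 _) (integrable_mul_schwartz hq h₂.2 _),
      ← h₁.1 φ, ← h₂.1 φ, sub_self]
  filter_upwards [this] with x hx
  exact sub_eq_zero.1 hx

theorem lpNorm_eq (hd : 1 ≤ d) {q : ℝ} (hq : 1 < q) {u : S0Dual d} {f : E d → ℂ}
    (h : IsLpFunction q u f) : lpNorm q u = eLpNorm f (ENNReal.ofReal q) volume := by
  refine le_antisymm (iInf₂_le f h) (le_iInf₂ fun f' h' => le_of_eq ?_)
  exact eLpNorm_congr_ae (IsFunction.ae_eq hd hq h h')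

/-! ### Interpolation by the layer-cake formula -/

theorem lintegral_enorm_sq_eq {F : Type*} [NormedAddCommGroup F] (f : E d → F) :
    ∫⁻ x, ‖f x‖ₑ ^ 2 = eLpNorm f 2 volume ^ 2 := by
  rw [eLpNorm_eq_lintegral_rpow_enorm_toReal (by norm_num) (by norm_num), ← ENNReal.rpow_two,
    ← ENNReal.rpow_mul]
  simp

theorem lintegral_enorm_rpow_eq {F : Type*} [NormedAddCommGroup F] (f : E d → F) {p : ℝ}
    (hp : 0 < p) : ∫⁻ x, ‖f x‖ₑ ^ p = eLpNorm f (ENNReal.ofReal p) volume ^ p := by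
  rw [eLpNorm_eq_lintegral_rpow_enorm_toReal (by simpa using hp) (by simp), ENNReal.toReal_ofReal hp.le,
    ← ENNReal.rpow_mul, one_div, inv_mul_cancel₀ hp.ne', ENNReal.rpow_one]

theorem lintegral_Ioc_rpow {r T : ℝ} (hr : 2 < r) (hT : 0 ≤ T) :
    ∫⁻ t in Set.Ioc 0 T, ENNReal.ofReal (t ^ (r - 3)) = ENNReal.ofReal (T ^ (r - 2) / (r - 2)) := by
  have hi : IntervalIntegrable (fun t : ℝ => t ^ (r - 3)) volume 0 T :=
    intervalIntegral.intervalIntegrable_rpow' (by linarith)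
  rw [← ofReal_integral_eq_lintegral_ofReal
    ((intervalIntegrable_iff_integrableOn_Ioc_of_le hT).1 hi),
    ← intervalIntegral.integral_of_le hT, integral_rpow (Or.inl (by linarith))]
  · congr 1
    rw [Real.zero_rpow (by linarith)]
    ring_nf
  · filter_upwards [ae_restrict_mem measurableSet_Ioc] with t ht
    exact Real.rpow_nonneg ht.1.le _

/-- An `L^r` bound from bounds of the low frequencies in `L^∞` and the high frequencies in
`L²`. -/
theorem lintegral_rpow_le_of_split {f : E d → ℂ} (hf : AEStronglyMeasurable f volume)
    {G : E d → ℝ≥0∞} (hG : AEMeasurable G volume) {B β r s : ℝ} (hB : 0 < B) (hβ : 0 < β)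
    (hr : 2 < r) (hs : β * (r - 2) = 2 * s)
    (H : ∀ A : ℝ, 0 < A → ∃ L F : E d → ℂ, (∀ᵐ x, f x = L x + F x) ∧
      (∀ᵐ x, ‖L x‖ ≤ B * A ^ β) ∧ AEStronglyMeasurable F volume ∧
      ∫⁻ x, ‖F x‖ₑ ^ 2 ≤ ∫⁻ ξ in {ξ | A ≤ 2 * ‖ξ‖}, G ξ) :
    ∫⁻ x, ‖f x‖ₑ ^ r ≤ ENNReal.ofReal (4 * r * 2 ^ (r - 2) * 2 ^ (2 * s) / (r - 2) * B ^ (r - 2))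
      * ∫⁻ ξ, ENNReal.ofReal (‖ξ‖ ^ (2 * s)) * G ξ := by
  -- The cutoff A used at height t satisfies A ≤ 2‖ξ‖ only if t ≤ `T ξ`. So `T ξ` is the largest
  -- height whose high-frequency part can involve ξ.
  set T : E d → ℝ := fun ξ => 2 * B * (2 * ‖ξ‖) ^ β with hT
  have hTm : Measurable T := by fun_prop
  have hT0 : ∀ ξ, 0 ≤ T ξ := fun ξ => by positivity
  have h1 : ∫⁻ x, ‖f x‖ₑ ^ r = ENNReal.ofReal r *
      ∫⁻ t in Set.Ioi (0 : ℝ), volume {x | t < ‖f x‖} * ENNReal.ofReal (t ^ (r - 1)) := by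
    rw [← lintegral_rpow_eq_lintegral_meas_lt_mul volume
      (Eventually.of_forall fun x => norm_nonneg (f x)) hf.norm.aemeasurable (by linarith)]
    congr 1
    ext x
    rw [← ENNReal.ofReal_rpow_of_nonneg (norm_nonneg _) (by linarith), ofReal_norm]
  have h2 : ∀ t : ℝ, 0 < t → volume {x | t < ‖f x‖} * ENNReal.ofReal (t ^ (r - 1))
      ≤ ∫⁻ ξ, ENNReal.ofReal (4 * t ^ (r - 3)) *
        (({z : ℝ × E d | z.1 ≤ T z.2}.indicator 1 (t, ξ) : ℝ≥0∞) * G ξ) := by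
    intro t ht
    -- This cutoff makes the low part at most t/2, so the high part is at least t/2 wherever |f| >
    -- t, and Chebyshev in L² applies to it.
    set A : ℝ := (t / (2 * B)) ^ (β⁻¹) with hA
    have hA0 : 0 < A := by positivity
    have hAβ : B * A ^ β = t / 2 := by
      rw [hA, ← Real.rpow_mul (by positivity), inv_mul_cancel₀ hβ.ne', Real.rpow_one]
      field_simp
    obtain ⟨L, F, hsum, hL, hF, hFG⟩ := H A hA0
    have m1 : volume {x | t < ‖f x‖} ≤ volume {x | ENNReal.ofReal (t ^ 2 / 4) ≤ ‖F x‖ₑ ^ 2} := by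
      refine measure_mono_ae ?_
      filter_upwards [hsum, hL] with x hx hLx htx
      have htx : t < ‖f x‖ := htx
      have : t / 2 ≤ ‖F x‖ := by
        rw [hAβ] at hLx
        have := norm_add_le (L x) (F x)
        rw [← hx] at this
        linarith
      change ENNReal.ofReal (t ^ 2 / 4) ≤ ‖F x‖ₑ ^ 2
      rw [← ofReal_norm, ← ENNReal.ofReal_pow (norm_nonneg _)]
      refine ENNReal.ofReal_le_ofReal ?_
      nlinarith
    have ht4 : 0 < t ^ 2 / 4 := by positivity
    have m2 : volume {x | ENNReal.ofReal (t ^ 2 / 4) ≤ ‖F x‖ₑ ^ 2}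
        ≤ (∫⁻ x, ‖F x‖ₑ ^ 2) / ENNReal.ofReal (t ^ 2 / 4) :=
      meas_ge_le_lintegral_div (hF.enorm.pow_const 2) (ENNReal.ofReal_pos.2 ht4).ne'
        ENNReal.ofReal_ne_top
    have m3 : ∫⁻ ξ in {ξ | A ≤ 2 * ‖ξ‖}, G ξ
        ≤ ∫⁻ ξ, ({z : ℝ × E d | z.1 ≤ T z.2}.indicator 1 (t, ξ) : ℝ≥0∞) * G ξ := by
      rw [← lintegral_indicator (measurableSet_le measurable_const (by fun_prop))]
      refine lintegral_mono fun ξ => ?_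
      by_cases hξ : ξ ∈ {ξ : E d | A ≤ 2 * ‖ξ‖}
      · have : (t, ξ) ∈ {z : ℝ × E d | z.1 ≤ T z.2} := by
          change t ≤ 2 * B * (2 * ‖ξ‖) ^ β
          have : A ^ β ≤ (2 * ‖ξ‖) ^ β := Real.rpow_le_rpow hA0.le hξ hβ.le
          nlinarith
        rw [Set.indicator_of_mem hξ, Set.indicator_of_mem this, Pi.one_apply, one_mul]
      · rw [Set.indicator_of_notMem hξ]
        exact zero_le
    have hIm : AEMeasurable (fun ξ => ({z : ℝ × E d | z.1 ≤ T z.2}.indicator 1 (t, ξ) : ℝ≥0∞)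
        * G ξ) volume := by
      refine AEMeasurable.mul ?_ hG
      have : Measurable ({z : ℝ × E d | z.1 ≤ T z.2}.indicator (1 : ℝ × E d → ℝ≥0∞)) :=
        measurable_one.indicator (measurableSet_le measurable_fst (hTm.comp measurable_snd))
      exact (this.comp (measurable_const.prodMk measurable_id)).aemeasurable
    rw [lintegral_const_mul'' _ hIm]
    calc volume {x | t < ‖f x‖} * ENNReal.ofReal (t ^ (r - 1))
        ≤ (∫⁻ ξ, ({z : ℝ × E d | z.1 ≤ T z.2}.indicator 1 (t, ξ) : ℝ≥0∞) * G ξ)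
          / ENNReal.ofReal (t ^ 2 / 4) * ENNReal.ofReal (t ^ (r - 1)) := by
          gcongr
          exact m1.trans (m2.trans (ENNReal.div_le_div_right (hFG.trans m3) _))
      _ = _ := by
          rw [ENNReal.div_eq_inv_mul, mul_right_comm, ← ENNReal.ofReal_inv_of_pos ht4,
            ← ENNReal.ofReal_mul (by positivity)]
          congr 2
          have : t ^ (r - 1) = t ^ (r - 3) * t ^ 2 := by
            rw [← Real.rpow_two, ← Real.rpow_add ht]
            congr 1
            ring
          rw [this]
          field_simp
  have hIm2 : Measurable ({z : ℝ × E d | z.1 ≤ T z.2}.indicator (1 : ℝ × E d → ℝ≥0∞)) :=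
    measurable_one.indicator (measurableSet_le measurable_fst (hTm.comp measurable_snd))
  rw [h1]
  calc ENNReal.ofReal r *
      ∫⁻ t in Set.Ioi (0 : ℝ), volume {x | t < ‖f x‖} * ENNReal.ofReal (t ^ (r - 1))
      ≤ ENNReal.ofReal r * ∫⁻ t in Set.Ioi (0 : ℝ), ∫⁻ ξ, ENNReal.ofReal (4 * t ^ (r - 3)) *
        (({z : ℝ × E d | z.1 ≤ T z.2}.indicator 1 (t, ξ) : ℝ≥0∞) * G ξ) := by
        gcongr 1
        exact setLIntegral_mono' measurableSet_Ioi fun t ht => h2 t ht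
    _ = ENNReal.ofReal r * ∫⁻ ξ, ∫⁻ t in Set.Ioi (0 : ℝ), ENNReal.ofReal (4 * t ^ (r - 3)) *
        (({z : ℝ × E d | z.1 ≤ T z.2}.indicator 1 (t, ξ) : ℝ≥0∞) * G ξ) := by
        congr 1
        refine lintegral_lintegral_swap ?_
        refine AEMeasurable.mul ?_ (AEMeasurable.mul hIm2.aemeasurable hG.comp_snd)
        exact Measurable.aemeasurable (by fun_prop)
    -- After Tonelli the integral in t runs over (0, `T ξ`], where t^{r−3} is integrable because r >
    -- 2. It produces `T ξ`^{r−2}, a multiple of ‖ξ‖^{β(r−2)} = ‖ξ‖^{2s}.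
    _ = ENNReal.ofReal r * ∫⁻ ξ, ENNReal.ofReal (4 * ((T ξ) ^ (r - 2) / (r - 2))) * G ξ := by
        congr 1
        refine lintegral_congr fun ξ => ?_
        have e1 : ∀ t ∈ Set.Ioi (0 : ℝ), ENNReal.ofReal (4 * t ^ (r - 3)) *
            (({z : ℝ × E d | z.1 ≤ T z.2}.indicator 1 (t, ξ) : ℝ≥0∞) * G ξ)
            = (Set.Iic (T ξ)).indicator (fun t => ENNReal.ofReal 4 * ENNReal.ofReal (t ^ (r - 3))) t
              * G ξ := by
          intro t ht
          by_cases h : t ≤ T ξ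
          · rw [Set.indicator_of_mem (s := {z : ℝ × E d | z.1 ≤ T z.2}) h,
              Set.indicator_of_mem (s := Set.Iic (T ξ)) h, Pi.one_apply, one_mul,
              ENNReal.ofReal_mul (by norm_num)]
          · rw [Set.indicator_of_notMem (s := {z : ℝ × E d | z.1 ≤ T z.2}) h,
              Set.indicator_of_notMem (s := Set.Iic (T ξ)) h, zero_mul, mul_zero]
        have hmm : Measurable fun t : ℝ => ENNReal.ofReal 4 * ENNReal.ofReal (t ^ (r - 3)) := by
          fun_prop
        rw [setLIntegral_congr_fun measurableSet_Ioi e1,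
          lintegral_mul_const _ (hmm.indicator measurableSet_Iic),
          lintegral_indicator measurableSet_Iic, Measure.restrict_restrict measurableSet_Iic,
          Set.Iic_inter_Ioi, lintegral_const_mul _ (by fun_prop), lintegral_Ioc_rpow hr (hT0 ξ),
          ← ENNReal.ofReal_mul (by norm_num)]
    _ = _ := by
        rw [← lintegral_const_mul' _ _ ENNReal.ofReal_ne_top,
          ← lintegral_const_mul' _ _ ENNReal.ofReal_ne_top]
        refine lintegral_congr fun ξ => ?_
        rw [← mul_assoc, ← mul_assoc, ← ENNReal.ofReal_mul (by linarith),
          ← ENNReal.ofReal_mul]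
        swap
        · have : 0 < r - 2 := by linarith
          positivity
        congr 2
        have e1 : (T ξ) ^ (r - 2) = 2 ^ (r - 2) * B ^ (r - 2) * (2 ^ (2 * s) * ‖ξ‖ ^ (2 * s)) := by
          rw [hT]
          simp only
          rw [Real.mul_rpow (by positivity) (by positivity), Real.mul_rpow (by norm_num) hB.le,
            ← Real.rpow_mul (by positivity), hs, Real.mul_rpow (by norm_num) (norm_nonneg _)]
        rw [e1]
        ring

/-! ### Arithmetic of the exponents -/

/-- The admissible pairs `(d, α)`: energy-subcritical and mass-supercritical. -/
structure Adm (d : ℕ) (α : ℝ) : Prop where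
  one_le : 1 ≤ d
  lower : 8 / (d : ℝ) < α
  upper : 5 ≤ d → α < 8 / ((d : ℝ) - 4)

namespace Adm

variable {α : ℝ}

theorem dpos (h : Adm d α) : (0 : ℝ) < d := by exact_mod_cast h.one_le

theorem pos (h : Adm d α) : 0 < α := lt_trans (by have := h.dpos; positivity) h.lower

theorem eight_lt (h : Adm d α) : 8 < d * α := by
  have := h.lower
  rw [div_lt_iff₀ h.dpos] at this
  linarith

/-- For d ≤ 4 the left side is at most 0, so this one inequality expresses energy-subcriticality in
every dimension. -/
theorem lt_eight (h : Adm d α) : α * (d - 4) < 8 := by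
  by_cases h5 : 5 ≤ d
  · have h5' : (5 : ℝ) ≤ d := by exact_mod_cast h5
    have := h.upper h5
    rwa [lt_div_iff₀ (by linarith)] at this
  · have : (d : ℝ) ≤ 4 := by exact_mod_cast (by omega : d ≤ 4)
    nlinarith [h.pos]

theorem two_lt_alphaC (h : Adm d α) : 2 < alphaC d α := by
  unfold alphaC
  linarith [h.eight_lt]

theorem one_lt_alphaC (h : Adm d α) : 1 < alphaC d α := by linarith [h.two_lt_alphaC]

theorem alphaC_lt (h : Adm d α) : alphaC d α < α + 2 := by
  unfold alphaC
  linarith [h.lt_eight]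

theorem one_lt (h : Adm d α) : 1 < α + 2 := by linarith [h.pos]

/-- The Bernstein exponent of L^{α_c} is the scaling exponent 4/α; this is the sense in which α_c is
critical. -/
theorem div_alphaC (h : Adm d α) : d / alphaC d α = 4 / α := by
  unfold alphaC
  have := h.dpos
  have := h.pos
  field_simp

theorem gammaC_pos (h : Adm d α) : 0 < gammaC d α := by
  unfold gammaC
  rw [sub_pos, div_lt_div_iff₀ h.pos (by norm_num)]
  linarith [h.eight_lt]

theorem gammaC_lt_two (h : Adm d α) : gammaC d α < 2 := by
  unfold gammaC
  have : (d : ℝ) / 2 - 2 < 4 / α := by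
    rw [lt_div_iff₀ h.pos]
    linarith [h.lt_eight]
  linarith

theorem gammaC_lt (h : Adm d α) : gammaC d α < d / 2 := by
  unfold gammaC
  have := h.pos
  have : 0 < 4 / α := by positivity
  linarith

end Adm

/-! ### Refined Sobolev and Gagliardo–Nirenberg inequalities -/

theorem one_le_two_pi_mul {A : ℝ} (hA : 0 ≤ A) : A ≤ 2 * Real.pi * A := by
  nlinarith [Real.pi_gt_three]

theorem norm_le_symb_two {A : ℝ} (hA : 0 < A) (g : E d → ℂ) {ξ : E d} (hξ : A ≤ ‖ξ‖) :
    ‖g ξ‖ ≤ A⁻¹ ^ 2 * ‖symb 2 ξ * g ξ‖ := by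
  rw [norm_mul, norm_symb, Real.rpow_two, ← mul_assoc, ← mul_pow]
  have : 1 ≤ A⁻¹ * (2 * Real.pi * ‖ξ‖) := by
    have := one_le_two_pi_mul (norm_nonneg ξ)
    rw [inv_mul_eq_div, le_div_iff₀ hA]
    linarith
  have h1 : 1 ≤ (A⁻¹ * (2 * Real.pi * ‖ξ‖)) ^ 2 := one_le_pow₀ this
  nlinarith [norm_nonneg (g ξ)]

theorem norm_high_le {A : ℝ} (hA : 0 < A) (g : E d → ℂ) (ξ : E d) :
    ‖(1 - cutoff A hA ξ) * g ξ‖ ≤ A⁻¹ ^ 2 * ‖symb 2 ξ * g ξ‖ := by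
  by_cases h : ‖ξ‖ ≤ A
  · rw [cutoff_eq_one hA h, sub_self, zero_mul, norm_zero]
    positivity
  · rw [norm_mul]
    calc _ ≤ 1 * ‖g ξ‖ := by
          gcongr
          exact norm_one_sub_cutoff_le hA ξ
      _ ≤ _ := by
          rw [one_mul]
          exact norm_le_symb_two hA g (not_le.1 h).le

theorem memLp_high (hd : 1 ≤ d) {A : ℝ} (hA : 0 < A) {g : E d → ℂ}
    (hg : MemLp (fun ξ => symb 2 ξ * g ξ) 2 volume) :
    MemLp (fun ξ => (1 - cutoff A hA ξ) * g ξ) 2 volume := by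
  refine (hg.const_mul (((A⁻¹ ^ 2 : ℝ)) : ℂ)).mono ?_ (Eventually.of_forall fun ξ => ?_)
  · exact (continuous_const.sub (cutoff A hA).continuous).aestronglyMeasurable.mul
      (aestronglyMeasurable_of_hdot hd hg.1)
  · rw [norm_mul (((A⁻¹ ^ 2 : ℝ)) : ℂ), Complex.norm_real, Real.norm_of_nonneg (by positivity)]
    exact norm_high_le hA g ξ

/-- The high-frequency part of a function with Fourier transform `g`. -/
noncomputable def high (hd : 1 ≤ d) {A : ℝ} (hA : 0 < A) {g : E d → ℂ}
    (hg : MemLp (fun ξ => symb 2 ξ * g ξ) 2 volume) : Lp ℂ 2 (volume : Measure (E d)) :=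
  𝓕⁻ (memLp_high hd hA hg).toLp

theorem lintegral_fourierInv_L2 {k : E d → ℂ} (hk : MemLp k 2 volume) :
    ∫⁻ x, ‖(𝓕⁻ hk.toLp : Lp ℂ 2 (volume : Measure (E d))) x‖ₑ ^ 2 = ∫⁻ ξ, ‖k ξ‖ₑ ^ 2 := by
  have h1 : ‖(𝓕⁻ hk.toLp : Lp ℂ 2 (volume : Measure (E d)))‖ = ‖hk.toLp‖ :=
    (Lp.fourierTransformₗᵢ (E d) ℂ).symm.norm_map _
  rw [lintegral_enorm_sq_eq, lintegral_enorm_sq_eq, ← Lp.enorm_def,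
    ← eLpNorm_congr_ae hk.coeFn_toLp, ← Lp.enorm_def]
  rw [← ofReal_norm, ← ofReal_norm, h1]

theorem ae_eq_smooth_add_high (hd : 1 ≤ d) {q : ℝ} (hq : 1 < q) {f g : E d → ℂ}
    (hf : MemLp f (ENNReal.ofReal q) volume)
    (hg : MemLp (fun ξ => symb 2 ξ * g ξ) 2 volume)
    (hfg : ∀ φ : S0 d, ∫ x, f x * (φ : 𝓢(E d, ℂ)) x = ∫ ξ, g ξ * (𝓕⁻ (φ : 𝓢(E d, ℂ)) : 𝓢(E d, ℂ)) ξ)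
    {A : ℝ} (hA : 0 < A) :
    ∀ᵐ x, f x = smooth (𝓕 (cutoff A hA)) f x + high hd hA hg x :=
  ae_eq_smooth_add hq hf hfg (cutoff_eventually hA) (memLp_high hd hA hg)

theorem lintegral_high_le (hd : 1 ≤ d) {g : E d → ℂ}
    (hg : MemLp (fun ξ => symb 2 ξ * g ξ) 2 volume) {A : ℝ} (hA : 0 < A) :
    ∫⁻ x, ‖high hd hA hg x‖ₑ ^ 2 ≤ ∫⁻ ξ in {ξ | A ≤ ‖ξ‖}, ‖g ξ‖ₑ ^ 2 := by
  unfold high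
  rw [lintegral_fourierInv_L2, ← lintegral_indicator (measurableSet_le (by fun_prop) (by fun_prop))]
  refine lintegral_mono fun ξ => ?_
  by_cases h : A ≤ ‖ξ‖
  · rw [Set.indicator_of_mem (s := {ξ : E d | A ≤ ‖ξ‖}) h, ← ofReal_norm, ← ofReal_norm]
    gcongr
    rw [norm_mul]
    exact mul_le_of_le_one_left (norm_nonneg _) (norm_one_sub_cutoff_le hA ξ)
  · rw [cutoff_eq_one hA (not_le.1 h).le, sub_self, zero_mul]
    simp

theorem eLpNorm_high_le (hd : 1 ≤ d) {g : E d → ℂ}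
    (hg : MemLp (fun ξ => symb 2 ξ * g ξ) 2 volume) {A : ℝ} (hA : 0 < A) :
    eLpNorm (high hd hA hg) 2 volume
      ≤ ENNReal.ofReal (A⁻¹ ^ 2) * eLpNorm (fun ξ => symb 2 ξ * g ξ) 2 volume := by
  have h1 : eLpNorm (high hd hA hg) 2 volume
      = eLpNorm (fun ξ => (1 - cutoff A hA ξ) * g ξ) 2 volume := by
    have := lintegral_fourierInv_L2 (memLp_high hd hA hg)
    rw [lintegral_enorm_sq_eq, lintegral_enorm_sq_eq] at this
    exact (ENNReal.pow_right_strictMono (n := 2) (by norm_num)).injective this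
  rw [h1]
  exact eLpNorm_le_mul_eLpNorm_of_ae_le_mul (Eventually.of_forall fun ξ => norm_high_le hA g ξ) 2

/-- The refined Sobolev inequality: an `L^r` bound by the size of the low frequencies. -/
theorem lintegral_rpow_le_of_low (hd : 1 ≤ d) {q : ℝ} (hq : 1 < q) {f g : E d → ℂ}
    (hf : MemLp f (ENNReal.ofReal q) volume)
    (hg : MemLp (fun ξ => symb 2 ξ * g ξ) 2 volume)
    (hfg : ∀ φ : S0 d, ∫ x, f x * (φ : 𝓢(E d, ℂ)) x = ∫ ξ, g ξ * (𝓕⁻ (φ : 𝓢(E d, ℂ)) : 𝓢(E d, ℂ)) ξ)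
    {B β r : ℝ} (hB : 0 < B) (hβ : 0 < β) (hr : 2 < r) (hβr : β * (r - 2) = 4)
    (H : ∀ (j : ℤ) (x : E d), ‖smooth (𝓕 (cutoff ((2 : ℝ) ^ j) (zpow_pos two_pos j))) f x‖
      ≤ B * ((2 : ℝ) ^ j) ^ β) :
    ∫⁻ x, ‖f x‖ₑ ^ r ≤ ENNReal.ofReal (4 * r * 2 ^ (r - 2) * 2 ^ (2 * (2 : ℝ)) / (r - 2) * B ^ (r - 2))
      * eLpNorm (fun ξ => symb 2 ξ * g ξ) 2 volume ^ 2 := by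
  have hgm : AEMeasurable (fun ξ => ‖g ξ‖ₑ ^ 2) volume :=
    (aestronglyMeasurable_of_hdot hd hg.1).enorm.pow_const 2
  refine (lintegral_rpow_le_of_split hf.1 hgm hB hβ hr (s := 2) (by linarith) ?_).trans ?_
  · intro A hA
    -- The cutoff is rounded down to 2^j with 2^j ≤ A < 2^{j+1}. The lost factor 2 is the one in the
    -- set A ≤ 2‖ξ‖ of `lintegral_rpow_le_of_split`.
    obtain ⟨j, hj1, hj2⟩ := exists_mem_Ico_zpow hA (one_lt_two)
    have hj0 : (0 : ℝ) < 2 ^ j := zpow_pos two_pos j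
    refine ⟨smooth (𝓕 (cutoff _ hj0)) f, high hd hj0 hg, ae_eq_smooth_add_high hd hq hf hg hfg hj0,
      Eventually.of_forall fun x => (H j x).trans ?_, (Lp.memLp _).1, ?_⟩
    · gcongr
    · refine (lintegral_high_le hd hg hj0).trans (lintegral_mono_set fun ξ hξ => ?_)
      have hξ : (2 : ℝ) ^ j ≤ ‖ξ‖ := hξ
      change A ≤ 2 * ‖ξ‖
      rw [zpow_add_one₀ two_ne_zero] at hj2
      linarith
  · gcongr
    rw [← lintegral_enorm_sq_eq]
    refine lintegral_mono fun ξ => ?_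
    rw [← ofReal_norm, ← ofReal_norm, norm_mul, norm_symb, ENNReal.ofReal_mul (by positivity),
      mul_pow]
    gcongr
    rw [← ENNReal.ofReal_pow (by positivity)]
    refine ENNReal.ofReal_le_ofReal ?_
    have e1 : ‖ξ‖ ^ (2 * 2 : ℝ) = (‖ξ‖ ^ 2) ^ 2 := by
      rw [Real.rpow_mul (norm_nonneg ξ), Real.rpow_two, Real.rpow_two]
    rw [e1, Real.rpow_two]
    gcongr
    exact one_le_two_pi_mul (norm_nonneg ξ)

/-- The constant in the Gagliardo–Nirenberg inequality. -/
noncomputable def gnConst (d : ℕ) (α : ℝ) : ℝ :=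
  4 * (α + 2) * 2 ^ α * 2 ^ (2 * (2 : ℝ)) / α * (kerNorm d (alphaC d α) + 1) ^ α

theorem kerNorm_nonneg (q : ℝ) : 0 ≤ kerNorm d q := ENNReal.toReal_nonneg

theorem gnConst_nonneg {α : ℝ} (ha : 0 < α) : 0 ≤ gnConst d α := by
  have := kerNorm_nonneg (d := d) (alphaC d α)
  unfold gnConst
  positivity

/-- The Gagliardo–Nirenberg inequality in `L^{α_c} ∩ Ḣ²`. -/
theorem gagliardo_nirenberg {α : ℝ} (ha : Adm d α) {f g : E d → ℂ}
    (hf : MemLp f (ENNReal.ofReal (alphaC d α)) volume)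
    (hg : MemLp (fun ξ => symb 2 ξ * g ξ) 2 volume)
    (hfg : ∀ φ : S0 d, ∫ x, f x * (φ : 𝓢(E d, ℂ)) x
      = ∫ ξ, g ξ * (𝓕⁻ (φ : 𝓢(E d, ℂ)) : 𝓢(E d, ℂ)) ξ) :
    ∫⁻ x, ‖f x‖ₑ ^ (α + 2) ≤ ENNReal.ofReal (gnConst d α
      * (eLpNorm f (ENNReal.ofReal (alphaC d α)) volume).toReal ^ α)
      * eLpNorm (fun ξ => symb 2 ξ * g ξ) 2 volume ^ 2 := by
  have hap := ha.pos
  set N := (eLpNorm f (ENNReal.ofReal (alphaC d α)) volume).toReal with hN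
  have hN0 : 0 ≤ N := ENNReal.toReal_nonneg
  rcases hN0.eq_or_lt with h0 | hN0
  · have hz : eLpNorm f (ENNReal.ofReal (alphaC d α)) volume = 0 := by
      rcases (ENNReal.toReal_eq_zero_iff _).1 h0.symm with h | h
      · exact h
      · exact absurd h hf.2.ne
    rw [eLpNorm_eq_zero_iff hf.1 (by simpa using by linarith [ha.two_lt_alphaC])] at hz
    have : ∫⁻ x, ‖f x‖ₑ ^ (α + 2) = 0 := by
      rw [← lintegral_zero (μ := (volume : Measure (E d)))]
      refine lintegral_congr_ae ?_
      filter_upwards [hz] with x hx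
      rw [hx]
      simp [ENNReal.zero_rpow_of_pos (by linarith : 0 < α + 2)]
    rw [this]
    exact zero_le
  have hk := kerNorm_nonneg (d := d) (alphaC d α)
  -- By Bernstein in L^{α_c} the hypothesis on low frequencies holds with β = 4/α, and β((α+2) − 2)
  -- = 4. The summand 1 keeps B positive without knowing that the kernel norm is; the case N = 0 was
  -- set aside for the same reason.
  have := lintegral_rpow_le_of_low ha.one_le ha.one_lt_alphaC hf hg hfg
    (B := N * (kerNorm d (alphaC d α) + 1)) (β := 4 / α) (r := α + 2) (by positivity)
    (by positivity) (by linarith) (by field_simp; ring) ?_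
  · refine this.trans (le_of_eq ?_)
    congr 2
    rw [gnConst, add_sub_cancel_right, Real.mul_rpow hN0.le (by positivity)]
    ring
  · intro j x
    have h1 := norm_smooth_cutoff_le ha.one_lt_alphaC hf (zpow_pos (two_pos (α := ℝ)) j) x
    rw [ha.div_alphaC] at h1
    refine h1.trans ?_
    have : (0 : ℝ) ≤ ((2 : ℝ) ^ j) ^ (4 / α) := by positivity
    nlinarith [mul_nonneg hN0.le this]

/-! ### The Sobolev embedding -/

theorem integral_fourierInv_L1_mul {k : E d → ℂ} (hk : Integrable k) (φ : 𝓢(E d, ℂ)) :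
    ∫ x, (𝓕⁻ k) x * φ x = ∫ ξ, k ξ * (𝓕⁻ φ : 𝓢(E d, ℂ)) ξ := by
  have h1 := VectorFourier.integral_bilin_fourierIntegral_eq_flip (ContinuousLinearMap.mul ℂ ℂ)
    (L := innerₗ (E d)) Real.continuous_fourierChar continuous_inner hk
    (φ.integrable (μ := volume)).comp_neg
  rw [flip_innerₗ] at h1
  have h2 : ∫ x, (𝓕⁻ k) x * φ x = ∫ x, (𝓕 k) x * φ (-x) := by
    rw [← integral_neg_eq_self]
    congr 1
    ext x
    rw [Real.fourierInv_eq_fourier_neg, neg_neg]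
  rw [h2]
  refine Eq.trans h1 ?_
  congr 1
  ext ξ
  rw [SchwartzMap.fourierInv_coe, Real.fourierInv_eq_fourier_comp_neg]
  rfl

theorem norm_fourierInv_le {k : E d → ℂ} (x : E d) : ‖(𝓕⁻ k) x‖ ≤ ∫ ξ, ‖k ξ‖ := by
  rw [Real.fourierInv_eq_fourier_neg]
  exact VectorFourier.norm_fourierIntegral_le_integral_norm _ _ _ _ _

theorem aestronglyMeasurable_fourierInv {k : E d → ℂ} (hk : Integrable k) :
    AEStronglyMeasurable (𝓕⁻ k) volume := by
  have h : Continuous (𝓕 k) := VectorFourier.fourierIntegral_continuous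
    Real.continuous_fourierChar (by exact continuous_inner) hk
  have h2 : 𝓕⁻ k = fun x => (𝓕 k) (-x) := funext (Real.fourierInv_eq_fourier_neg k)
  rw [h2]
  exact (h.comp continuous_neg).aestronglyMeasurable

/-- In polar coordinates the square of the weight becomes a multiple of t^{d−1−2γ}, which is
integrable at 0 because γ < d/2. -/
theorem memLp_low_weight (hd : 1 ≤ d) {γ : ℝ} (hγ : γ < d / 2) :
    MemLp ((Metric.ball (0 : E d) 1).indicator (symb (-γ))) 2 volume := by
  have : Nonempty (Fin d) := ⟨⟨0, hd⟩⟩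
  have hnt : Nontrivial (E d) := inferInstance
  have hm : AEStronglyMeasurable ((Metric.ball (0 : E d) 1).indicator (symb (-γ))) volume :=
    (measurable_symb _).aestronglyMeasurable.indicator measurableSet_ball
  rw [← integrable_norm_rpow_iff hm (by norm_num) (by norm_num)]
  set F : ℝ → ℝ := (Set.Iio (1 : ℝ)).indicator fun t => ((2 * Real.pi * t) ^ (-γ)) ^ (2 : ℝ) with hF
  have h1 : (fun ξ : E d => ‖(Metric.ball (0 : E d) 1).indicator (symb (-γ)) ξ‖ ^ (2 : ℝ≥0∞).toReal)
      = fun ξ => F ‖ξ‖ := by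
    ext ξ
    by_cases h : ‖ξ‖ < 1
    · rw [Set.indicator_of_mem (by simpa using h), norm_symb, hF,
        Set.indicator_of_mem (s := Set.Iio (1 : ℝ)) h]
      norm_num
    · rw [Set.indicator_of_notMem (by simpa using h), hF,
        Set.indicator_of_notMem (s := Set.Iio (1 : ℝ)) h]
      simp
  rw [h1, integrable_fun_norm_addHaar, finrank_euclideanSpace_fin]
  have hcast : ((d - 1 : ℕ) : ℝ) = d - 1 := by
    rw [Nat.cast_sub hd, Nat.cast_one]
  have h2 : IntegrableOn (fun y : ℝ => (2 * Real.pi) ^ (-2 * γ) * y ^ ((d : ℝ) - 1 - 2 * γ))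
      (Set.Ioo 0 1) := by
    refine Integrable.const_mul ?_ _
    have := (intervalIntegral.intervalIntegrable_rpow' (a := 0) (b := 1)
      (r := (d : ℝ) - 1 - 2 * γ) (by linarith))
    rw [intervalIntegrable_iff_integrableOn_Ioo_of_le zero_le_one] at this
    exact this
  have h3 : IntegrableOn ((Set.Ioo (0 : ℝ) 1).indicator fun y : ℝ =>
      (2 * Real.pi) ^ (-2 * γ) * y ^ ((d : ℝ) - 1 - 2 * γ)) (Set.Ioi 0) :=
    ((integrable_indicator_iff measurableSet_Ioo).2 h2).integrableOn
  refine h3.congr_fun (fun y hy => ?_) measurableSet_Ioi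
  have hy : 0 < y := hy
  by_cases h : y < 1
  · rw [Set.indicator_of_mem (show y ∈ Set.Ioo (0 : ℝ) 1 from ⟨hy, h⟩)]
    simp only [hF]
    have e1 : ((2 * Real.pi * y) ^ (-γ)) ^ (2 : ℝ) = (2 * Real.pi) ^ (-2 * γ) * y ^ (-2 * γ) := by
      rw [← Real.rpow_mul (by positivity), ← Real.mul_rpow (by positivity) hy.le]
      congr 1
      ring
    rw [Set.indicator_of_mem (s := Set.Iio (1 : ℝ)) h, smul_eq_mul, ← Real.rpow_natCast, hcast, e1,
      mul_left_comm, ← Real.rpow_add hy]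
    congr 2
    ring
  · rw [Set.indicator_of_notMem (fun hh : y ∈ Set.Ioo (0 : ℝ) 1 => h hh.2)]
    simp only [hF]
    rw [Set.indicator_of_notMem (s := Set.Iio (1 : ℝ)) h, smul_zero]

/-- The `L²` size of `|2πξ|^{-γ}` on the unit ball. -/
noncomputable def lowConst (d : ℕ) (γ : ℝ) : ℝ :=
  (eLpNorm ((Metric.ball (0 : E d) 1).indicator (symb (-γ))) 2 volume).toReal

theorem indicator_ball_symb {γ A : ℝ} (hA : 0 < A) :
    (Metric.ball (0 : E d) A).indicator (symb (-γ))
      = (((A ^ (-γ) : ℝ)) : ℂ) • fun ξ => (Metric.ball (0 : E d) 1).indicator (symb (-γ)) (A⁻¹ • ξ) := by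
  ext ξ
  have hiff : A⁻¹ • ξ ∈ Metric.ball (0 : E d) 1 ↔ ξ ∈ Metric.ball (0 : E d) A := by
    rw [mem_ball_zero_iff, mem_ball_zero_iff, norm_smul, norm_inv, Real.norm_of_nonneg hA.le,
      inv_mul_lt_iff₀ hA, mul_one]
  rw [Pi.smul_apply]
  by_cases h : ξ ∈ Metric.ball (0 : E d) A
  · rw [Set.indicator_of_mem h, Set.indicator_of_mem (hiff.2 h), symb, symb, smul_eq_mul,
      ← Complex.ofReal_mul, ← Real.mul_rpow hA.le (by positivity), norm_smul, norm_inv,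
      Real.norm_of_nonneg hA.le]
    congr 2
    field_simp
  · rw [Set.indicator_of_notMem h, Set.indicator_of_notMem (fun hh => h (hiff.1 hh)), smul_zero]

theorem memLp_low_weight_radius (hd : 1 ≤ d) {γ A : ℝ} (hγ : γ < d / 2) (hA : 0 < A) :
    MemLp ((Metric.ball (0 : E d) A).indicator (symb (-γ))) 2 volume ∧
    (eLpNorm ((Metric.ball (0 : E d) A).indicator (symb (-γ))) 2 volume).toReal
      = lowConst d γ * A ^ (d / 2 - γ) := by
  have h2 : ENNReal.ofReal 2 = 2 := by norm_num
  have e1 : eLpNorm ((Metric.ball (0 : E d) A).indicator (symb (-γ))) 2 volume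
      = ENNReal.ofReal (A ^ (d / 2 - γ))
        * eLpNorm ((Metric.ball (0 : E d) 1).indicator (symb (-γ))) 2 volume := by
    rw [indicator_ball_symb hA, eLpNorm_const_smul]
    have := eLpNorm_comp_dil (inv_pos.2 hA) (p := 2) two_pos
      ((Metric.ball (0 : E d) 1).indicator (symb (-γ)))
    rw [h2] at this
    rw [this, ← mul_assoc, ← ofReal_norm, Complex.norm_real, Real.norm_of_nonneg (by positivity),
      ← ENNReal.ofReal_mul (by positivity), Real.inv_rpow hA.le, ← Real.rpow_neg hA.le,
      ← Real.rpow_add hA]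
    congr 3
    ring
  have hm : AEStronglyMeasurable ((Metric.ball (0 : E d) A).indicator (symb (-γ))) volume :=
    (measurable_symb _).aestronglyMeasurable.indicator measurableSet_ball
  refine ⟨⟨hm, ?_⟩, ?_⟩
  · rw [e1]
    exact ENNReal.mul_lt_top ENNReal.ofReal_lt_top (memLp_low_weight hd hγ).2
  · rw [e1, ENNReal.toReal_mul, ENNReal.toReal_ofReal (by positivity), lowConst, mul_comm]

/-- The constant in the Sobolev inequality. -/
noncomputable def sobConst (d : ℕ) (γ q : ℝ) : ℝ :=
  (4 * q * 2 ^ (q - 2) * 2 ^ (2 * γ) / (q - 2) * (lowConst d γ + 1) ^ (q - 2)) ^ q⁻¹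

/-- The Sobolev inequality `Ḣ^γ ⊂ L^q`. -/
theorem sobolev (hd : 1 ≤ d) {γ q : ℝ} (hγ0 : 0 < γ) (hγ : γ < d / 2) (hq : 2 < q)
    (hγq : (d / 2 - γ) * (q - 2) = 2 * γ) {u : S0Dual d} {g : E d → ℂ} (hu : IsHdotFourier γ u g) :
    ∃ f, IsLpFunction q u f ∧ eLpNorm f (ENNReal.ofReal q) volume
      ≤ ENNReal.ofReal (sobConst d γ q) * eLpNorm (fun ξ => symb γ ξ * g ξ) 2 volume := by
  have hgm := aestronglyMeasurable_of_hdot hd hu.2.1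
  set N := (eLpNorm (fun ξ => symb γ ξ * g ξ) 2 volume).toReal with hN
  have hNN : eLpNorm (fun ξ => symb γ ξ * g ξ) 2 volume = ENNReal.ofReal N :=
    (ENNReal.ofReal_toReal hu.2.2.ne).symm
  have hlc : 0 ≤ lowConst d γ := ENNReal.toReal_nonneg
  rcases (ENNReal.toReal_nonneg : 0 ≤ N).eq_or_lt with h0 | hN0
  · refine ⟨0, ⟨fun φ => ?_, MemLp.zero⟩, by simp⟩
    have hz : eLpNorm (fun ξ => symb γ ξ * g ξ) 2 volume = 0 := by rw [hNN, hN, ← h0]; simp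
    rw [eLpNorm_eq_zero_iff hu.2.1 (by norm_num)] at hz
    rw [hu.1 φ]
    simp only [Pi.zero_apply, zero_mul, integral_zero]
    rw [← integral_zero (α := E d) (G := ℂ) (μ := volume)]
    refine integral_congr_ae ?_
    filter_upwards [hz, ae_ne_zero hd] with ξ h1 h2
    have : g ξ = 0 := by
      have h1 : symb γ ξ * g ξ = 0 := h1
      exact (mul_eq_zero.1 h1).resolve_left (symb_ne_zero γ h2)
    rw [this, zero_mul]
  -- A sharp cut at radius A. The inner part is integrable by Cauchy–Schwarz against |2πξ|^{-γ} on
  -- the ball, so its inverse transform is bounded by a multiple of A^{d/2−γ}; the outer part is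
  -- square integrable because γ > 0.
  set lo : ℝ → E d → ℂ := fun A => (Metric.ball (0 : E d) A).indicator g with hlo
  set hi : ℝ → E d → ℂ := fun A => (Metric.ball (0 : E d) A)ᶜ.indicator g with hhi
  have hlo_eq : ∀ A, lo A =ᵐ[volume] fun ξ => (symb γ ξ * g ξ)
      * (Metric.ball (0 : E d) A).indicator (symb (-γ)) ξ := by
    intro A
    filter_upwards [ae_ne_zero hd] with ξ hξ
    by_cases h : ξ ∈ Metric.ball (0 : E d) A
    · simp only [hlo]
      rw [Set.indicator_of_mem h, Set.indicator_of_mem h, mul_right_comm, symb_mul_neg γ hξ, one_mul]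
    · simp only [hlo]
      rw [Set.indicator_of_notMem h, Set.indicator_of_notMem h, mul_zero]
  have hlo_int : ∀ A, 0 < A → Integrable (lo A) := fun A hA =>
    (integrable_mul_memLp hu.2 (memLp_low_weight_radius hd hγ hA).1).congr (hlo_eq A).symm
  have hlo_le : ∀ A, 0 < A → ∫ ξ, ‖lo A ξ‖ ≤ N * (lowConst d γ * A ^ (d / 2 - γ)) := by
    intro A hA
    have hw := memLp_low_weight_radius hd hγ hA
    rw [← hw.2, integral_norm_eq_lintegral_enorm (hlo_int A hA).1, hN, ← ENNReal.toReal_mul]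
    refine ENNReal.toReal_mono (ENNReal.mul_ne_top hu.2.2.ne hw.1.2.ne) ?_
    have := eLpNorm_smul_le_mul_eLpNorm (p := 2) (q := 2) (r := 1) hw.1.1 hu.2.1
    rw [eLpNorm_one_eq_lintegral_enorm] at this
    refine le_trans (le_of_eq (lintegral_congr_ae ?_)) this
    filter_upwards [hlo_eq A] with ξ hξ
    rw [hξ]
    rfl
  have hhi_mem : ∀ A, 0 < A → MemLp (hi A) 2 volume := by
    intro A hA
    refine (hu.2.const_mul (((A ^ γ)⁻¹ : ℝ) : ℂ)).mono (hgm.indicator measurableSet_ball.compl)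
      (Eventually.of_forall fun ξ => ?_)
    by_cases h : ξ ∈ Metric.ball (0 : E d) A
    · simp only [hhi]
      rw [Set.indicator_of_notMem (s := (Metric.ball (0 : E d) A)ᶜ) (fun hh => hh h), norm_zero]
      exact norm_nonneg _
    · simp only [hhi]
      rw [Set.indicator_of_mem h, norm_mul, norm_mul, norm_symb, Complex.norm_real,
        Real.norm_of_nonneg (by positivity), ← mul_assoc]
      have hξ : A ≤ ‖ξ‖ := by simpa using h
      have : 1 ≤ (A ^ γ)⁻¹ * (2 * Real.pi * ‖ξ‖) ^ γ := by
        rw [inv_mul_eq_div, one_le_div (by positivity)]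
        exact Real.rpow_le_rpow hA.le (hξ.trans (one_le_two_pi_mul (norm_nonneg ξ))) hγ0.le
      exact le_mul_of_one_le_left (norm_nonneg _) this
  have hsum : ∀ A ξ, lo A ξ + hi A ξ = g ξ := fun A ξ =>
    congrFun (Set.indicator_self_add_compl (Metric.ball (0 : E d) A) g) ξ
  have hpair : ∀ A (hA : 0 < A) (φ : 𝓢(E d, ℂ)),
      Integrable (fun x => ((𝓕⁻ (lo A)) x
        + (𝓕⁻ (hhi_mem A hA).toLp : Lp ℂ 2 (volume : Measure (E d))) x) * φ x) ∧
      ∫ x, ((𝓕⁻ (lo A)) x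
        + (𝓕⁻ (hhi_mem A hA).toLp : Lp ℂ 2 (volume : Measure (E d))) x) * φ x
      = ∫ ξ, g ξ * (𝓕⁻ φ : 𝓢(E d, ℂ)) ξ := by
    intro A hA φ
    have i1 : Integrable fun x => (𝓕⁻ (lo A)) x * φ x :=
      φ.integrable.bdd_mul (c := ∫ ξ, ‖lo A ξ‖) (aestronglyMeasurable_fourierInv (hlo_int A hA))
        (Eventually.of_forall fun x => norm_fourierInv_le x)
    have i2 : Integrable fun x =>
        (𝓕⁻ (hhi_mem A hA).toLp : Lp ℂ 2 (volume : Measure (E d))) x * φ x :=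
      integrable_mul_memLp (Lp.memLp _) (φ.memLp 2 volume)
    simp only [add_mul]
    refine ⟨i1.add i2, ?_⟩
    rw [integral_add i1 i2, integral_fourierInv_L1_mul (hlo_int A hA), integral_fourierInv_L2_mul]
    have i3 : Integrable fun ξ => lo A ξ * (𝓕⁻ φ : 𝓢(E d, ℂ)) ξ := by
      have := (hlo_int A hA).bdd_mul (f := fun ξ => (𝓕⁻ φ : 𝓢(E d, ℂ)) ξ)
        (c := SchwartzMap.seminorm ℝ 0 0 (𝓕⁻ φ : 𝓢(E d, ℂ)))
        (𝓕⁻ φ : 𝓢(E d, ℂ)).continuous.aestronglyMeasurable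
        (Eventually.of_forall fun ξ => SchwartzMap.norm_le_seminorm ℝ _ ξ)
      simpa only [mul_comm] using this
    have e4 : ∫ ξ, ((hhi_mem A hA).toLp : Lp ℂ 2 (volume : Measure (E d))) ξ * (𝓕⁻ φ : 𝓢(E d, ℂ)) ξ
        = ∫ ξ, hi A ξ * (𝓕⁻ φ : 𝓢(E d, ℂ)) ξ := by
      refine integral_congr_ae ?_
      filter_upwards [(hhi_mem A hA).coeFn_toLp] with ξ hξ
      rw [hξ]
    rw [e4, ← integral_add i3 (integrable_mul_memLp (hhi_mem A hA)
      ((𝓕⁻ φ : 𝓢(E d, ℂ)).memLp 2 volume))]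
    congr 1
    ext ξ
    rw [← add_mul, hsum]
  have hloc : ∀ A (hA : 0 < A), LocallyIntegrable (fun x => (𝓕⁻ (lo A)) x
        + (𝓕⁻ (hhi_mem A hA).toLp : Lp ℂ 2 (volume : Measure (E d))) x) volume := by
    intro A hA
    have h1 : MemLp (𝓕⁻ (lo A)) ⊤ volume := memLp_top_of_bound
      (aestronglyMeasurable_fourierInv (hlo_int A hA)) _
      (Eventually.of_forall fun x => norm_fourierInv_le x)
    exact (h1.locallyIntegrable le_top).add ((Lp.memLp _).locallyIntegrable (by norm_num))
  -- The cut at radius 1 defines the function. Every other cut gives the same function almost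
  -- everywhere, since all of them pair with Schwartz functions as g does in frequency.
  set f : E d → ℂ := fun x => (𝓕⁻ (lo 1)) x
        + (𝓕⁻ (hhi_mem 1 one_pos).toLp : Lp ℂ 2 (volume : Measure (E d))) x with hf
  have hfA : ∀ A (hA : 0 < A), ∀ᵐ x, f x = (𝓕⁻ (lo A)) x
        + (𝓕⁻ (hhi_mem A hA).toLp : Lp ℂ 2 (volume : Measure (E d))) x := by
    intro A hA
    have := ae_eq_zero_of_schwartz ((hloc 1 one_pos).sub (hloc A hA)) fun φ => by
      simp only [Pi.sub_apply, sub_mul]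
      rw [integral_sub (hpair 1 one_pos φ).1 (hpair A hA φ).1, (hpair 1 one_pos φ).2,
        (hpair A hA φ).2, sub_self]
    filter_upwards [this] with x hx
    exact sub_eq_zero.1 hx
  have hfm : AEStronglyMeasurable f volume :=
    (aestronglyMeasurable_fourierInv (hlo_int 1 one_pos)).add (Lp.memLp _).1
  have key := lintegral_rpow_le_of_split hfm (G := fun ξ => ‖g ξ‖ₑ ^ 2) (hgm.enorm.pow_const 2)
    (B := N * (lowConst d γ + 1)) (β := d / 2 - γ) (r := q) (s := γ) (by positivity)
    (by linarith) hq hγq ?_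
  · have h3 : ∫⁻ ξ : E d, ENNReal.ofReal (‖ξ‖ ^ (2 * γ)) * ‖g ξ‖ₑ ^ 2 ≤ ENNReal.ofReal (N ^ 2) := by
      rw [ENNReal.ofReal_pow hN0.le, ← hNN, ← lintegral_enorm_sq_eq]
      refine lintegral_mono fun ξ => ?_
      rw [← ofReal_norm, ← ofReal_norm, norm_mul, norm_symb, ENNReal.ofReal_mul (by positivity),
        mul_pow]
      gcongr
      rw [← ENNReal.ofReal_pow (by positivity), mul_comm, Real.rpow_mul (norm_nonneg ξ),
        Real.rpow_two]
      gcongr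
      exact one_le_two_pi_mul (norm_nonneg ξ)
    have hq2 : 0 < q - 2 := by linarith
    have hq0 : 0 < q := by linarith
    have h4 : ∫⁻ x, ‖f x‖ₑ ^ q ≤ ENNReal.ofReal ((sobConst d γ q * N) ^ q) := by
      refine (key.trans (mul_le_mul_right h3 _)).trans ?_
      rw [← ENNReal.ofReal_mul (by positivity)]
      refine ENNReal.ofReal_le_ofReal (le_of_eq ?_)
      rw [Real.mul_rpow (by unfold sobConst; positivity) hN0.le, sobConst,
        ← Real.rpow_mul (by positivity), inv_mul_cancel₀ hq0.ne', Real.rpow_one,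
        Real.mul_rpow hN0.le (by positivity)]
      have : N ^ q = N ^ (q - 2) * N ^ 2 := by
        rw [← Real.rpow_two, ← Real.rpow_add hN0]
        congr 1
        ring
      rw [this]
      ring
    have h5 : eLpNorm f (ENNReal.ofReal q) volume ≤ ENNReal.ofReal (sobConst d γ q * N) := by
      rw [lintegral_enorm_rpow_eq f hq0, ← ENNReal.ofReal_rpow_of_nonneg
        (by unfold sobConst; positivity) hq0.le] at h4
      exact (ENNReal.rpow_le_rpow_iff hq0).1 h4
    refine ⟨f, ⟨fun φ => ?_, hfm, h5.trans_lt ENNReal.ofReal_lt_top⟩, ?_⟩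
    · rw [hu.1 φ, (hpair 1 one_pos φ).2]
    · rw [hNN, ← ENNReal.ofReal_mul (by unfold sobConst; positivity)]
      exact h5
  · intro A hA
    refine ⟨𝓕⁻ (lo A), (𝓕⁻ (hhi_mem A hA).toLp : Lp ℂ 2 (volume : Measure (E d))), hfA A hA,
      Eventually.of_forall fun x => ?_, (Lp.memLp _).1, ?_⟩
    · refine (norm_fourierInv_le x).trans ((hlo_le A hA).trans ?_)
      have : 0 ≤ A ^ ((d : ℝ) / 2 - γ) := by positivity
      nlinarith [mul_nonneg hN0.le this]
    · rw [lintegral_fourierInv_L2,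
        ← lintegral_indicator (measurableSet_le (by fun_prop) (by fun_prop))]
      refine lintegral_mono fun ξ => ?_
      by_cases h : ξ ∈ Metric.ball (0 : E d) A
      · simp only [hhi]
        rw [Set.indicator_of_notMem (s := (Metric.ball (0 : E d) A)ᶜ) (fun hh => hh h)]
        simp
      · have h' : ξ ∈ {ξ : E d | A ≤ 2 * ‖ξ‖} := by
          have : A ≤ ‖ξ‖ := by simpa using h
          change A ≤ 2 * ‖ξ‖
          linarith [norm_nonneg ξ]
        simp only [hhi]
        rw [Set.indicator_of_mem h', Set.indicator_of_mem (by exact h)]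

/-! ### Elements of `L^{α_c} ∩ Ḣ²` with their representatives -/

/-- An element of `L^{α_c} ∩ Ḣ²` with a function and a Fourier transform representing it. -/
structure Elt (d : ℕ) (α : ℝ) where
  /-- the distribution -/
  u : S0Dual d
  /-- the function -/
  f : E d → ℂ
  /-- the Fourier transform -/
  g : E d → ℂ
  hf : IsLpFunction (alphaC d α) u f
  hg : IsHdotFourier 2 u g

namespace Elt

variable {α : ℝ}

/-- The Fourier transform of `-Δ e`, in `L²`. -/
noncomputable def h (e : Elt d α) : Lp ℂ 2 (volume : Measure (E d)) := e.hg.2.toLp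

/-- The squared `Ḣ²` norm. -/
noncomputable def D (e : Elt d α) : ℝ := ‖e.h‖ ^ 2

/-- The `r`-th power of the `L^r` norm. -/
noncomputable def I (e : Elt d α) (r : ℝ) : ℝ := ∫ x, ‖e.f x‖ ^ r

theorem D_nonneg (e : Elt d α) : 0 ≤ e.D := sq_nonneg _

theorem I_nonneg (e : Elt d α) (r : ℝ) : 0 ≤ e.I r :=
  integral_nonneg fun _ => Real.rpow_nonneg (norm_nonneg _) _

theorem h_ae (e : Elt d α) : e.h =ᵐ[volume] fun ξ => symb 2 ξ * e.g ξ := e.hg.2.coeFn_toLp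

theorem hfg (e : Elt d α) (φ : S0 d) : ∫ x, e.f x * (φ : 𝓢(E d, ℂ)) x
    = ∫ ξ, e.g ξ * (𝓕⁻ (φ : 𝓢(E d, ℂ)) : 𝓢(E d, ℂ)) ξ := by
  rw [← e.hf.1 φ, e.hg.1 φ]

theorem eLpNorm_symb (e : Elt d α) :
    eLpNorm (fun ξ => symb 2 ξ * e.g ξ) 2 volume = ENNReal.ofReal ‖e.h‖ := by
  rw [← eLpNorm_congr_ae e.h_ae, ← Lp.enorm_def, ofReal_norm]

theorem hdotNorm_eq (hd : 1 ≤ d) (e : Elt d α) : hdotNorm 2 e.u = ENNReal.ofReal ‖e.h‖ := by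
  rw [NL4S.hdotNorm_eq hd e.hg, e.eLpNorm_symb]

theorem eLpNorm_toReal_eq {r : ℝ} (hr : 0 < r) {f : E d → ℂ}
    (hf : MemLp f (ENNReal.ofReal r) volume) :
    eLpNorm f (ENNReal.ofReal r) volume = ENNReal.ofReal ((∫ x, ‖f x‖ ^ r) ^ r⁻¹) := by
  rw [hf.eLpNorm_eq_integral_rpow_norm (by simpa using hr) (by simp), ENNReal.toReal_ofReal hr.le]

theorem lintegral_eq_integral {r : ℝ} (hr : 0 < r) {f : E d → ℂ}
    (hf : MemLp f (ENNReal.ofReal r) volume) :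
    ∫⁻ x, ‖f x‖ₑ ^ r = ENNReal.ofReal (∫ x, ‖f x‖ ^ r) := by
  have h0 : 0 ≤ ∫ x, ‖f x‖ ^ r := integral_nonneg fun x => Real.rpow_nonneg (norm_nonneg _) _
  rw [lintegral_enorm_rpow_eq f hr, eLpNorm_toReal_eq hr hf,
    ENNReal.ofReal_rpow_of_nonneg (Real.rpow_nonneg h0 _) hr.le, ← Real.rpow_mul h0,
    inv_mul_cancel₀ hr.ne', Real.rpow_one]

theorem memLp_add_two (ha : Adm d α) (e : Elt d α) :
    MemLp e.f (ENNReal.ofReal (α + 2)) volume := by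
  refine ⟨e.hf.2.1, ?_⟩
  have h := gagliardo_nirenberg ha e.hf.2 e.hg.2 e.hfg
  rw [lintegral_enorm_rpow_eq e.f (by linarith [ha.pos])] at h
  have h2 : eLpNorm e.f (ENNReal.ofReal (α + 2)) volume ^ (α + 2) < ⊤ := by
    refine h.trans_lt (ENNReal.mul_lt_top ENNReal.ofReal_lt_top ?_)
    exact ENNReal.pow_lt_top e.hg.2.2
  exact (ENNReal.rpow_lt_top_iff_of_pos (by linarith [ha.pos])).1 h2

theorem isLpFunction_add_two (ha : Adm d α) (e : Elt d α) : IsLpFunction (α + 2) e.u e.f :=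
  ⟨e.hf.1, e.memLp_add_two ha⟩

theorem lpNorm_alphaC (ha : Adm d α) (e : Elt d α) :
    lpNorm (alphaC d α) e.u = ENNReal.ofReal ((e.I (alphaC d α)) ^ (alphaC d α)⁻¹) := by
  rw [lpNorm_eq ha.one_le ha.one_lt_alphaC e.hf,
    eLpNorm_toReal_eq (by linarith [ha.two_lt_alphaC]) e.hf.2, I]

theorem lpNorm_add_two (ha : Adm d α) (e : Elt d α) :
    lpNorm (α + 2) e.u = ENNReal.ofReal ((e.I (α + 2)) ^ (α + 2)⁻¹) := by
  rw [lpNorm_eq ha.one_le ha.one_lt (e.isLpFunction_add_two ha),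
    eLpNorm_toReal_eq (by linarith [ha.pos]) (e.memLp_add_two ha), I]

theorem gn (ha : Adm d α) (e : Elt d α) :
    e.I (α + 2) ≤ gnConst d α * (e.I (alphaC d α)) ^ (α / alphaC d α) * e.D := by
  have hq : 0 < alphaC d α := by linarith [ha.two_lt_alphaC]
  have h := gagliardo_nirenberg ha e.hf.2 e.hg.2 e.hfg
  have hgn := gnConst_nonneg (d := d) ha.pos
  have hI := e.I_nonneg (alphaC d α)
  rw [lintegral_eq_integral (by linarith [ha.pos]) (e.memLp_add_two ha), e.eLpNorm_symb,
    eLpNorm_toReal_eq hq e.hf.2, ← I, ← I,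
    ENNReal.toReal_ofReal (Real.rpow_nonneg (e.I_nonneg _) _),
    ← ENNReal.ofReal_pow (norm_nonneg _), ← ENNReal.ofReal_mul (by
      refine mul_nonneg hgn ?_
      exact Real.rpow_nonneg (Real.rpow_nonneg (e.I_nonneg _) _) _),
    ← Real.rpow_mul (e.I_nonneg _)] at h
  have h2 := (ENNReal.ofReal_le_ofReal_iff (mul_nonneg (mul_nonneg hgn
    (Real.rpow_nonneg (e.I_nonneg _) _)) (sq_nonneg _))).1 h
  refine h2.trans (le_of_eq ?_)
  rw [D, inv_mul_eq_div]

theorem integrable_rpow {r : ℝ} (hr : 0 < r) {f : E d → ℂ}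
    (hf : MemLp f (ENNReal.ofReal r) volume) : Integrable fun x => ‖f x‖ ^ r := by
  have := hf.integrable_norm_rpow (by simpa using hr) (by simp)
  rwa [ENNReal.toReal_ofReal hr.le] at this

theorem ae_zero_of_I_eq_zero {r : ℝ} (hr : 0 < r) {e : Elt d α}
    (hf : MemLp e.f (ENNReal.ofReal r) volume) (h : e.I r = 0) : e.f =ᵐ[volume] 0 := by
  rw [I, integral_eq_zero_iff_of_nonneg (fun x => Real.rpow_nonneg (norm_nonneg _) _)
    (integrable_rpow hr hf)] at h
  filter_upwards [h] with x hx
  have hx : ‖e.f x‖ ^ r = 0 := hx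
  rw [Real.rpow_eq_zero (norm_nonneg _) hr.ne'] at hx
  simpa using hx

theorem u_eq_zero_of_f {e : Elt d α} (h : e.f =ᵐ[volume] 0) : e.u = 0 := by
  ext φ
  rw [e.hf.1 φ]
  simp only [zero_apply]
  rw [← integral_zero (α := E d) (G := ℂ) (μ := volume)]
  refine integral_congr_ae ?_
  filter_upwards [h] with x hx
  rw [hx, Pi.zero_apply, zero_mul]

theorem I_pos_of_ne_zero (ha : Adm d α) {e : Elt d α} (h : e.u ≠ 0) : 0 < e.I (alphaC d α) :=
  lt_of_le_of_ne (e.I_nonneg _) fun h0 => h (u_eq_zero_of_f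
    (ae_zero_of_I_eq_zero (by linarith [ha.two_lt_alphaC]) e.hf.2 h0.symm))

theorem I_add_two_pos_of_ne_zero (ha : Adm d α) {e : Elt d α} (h : e.u ≠ 0) : 0 < e.I (α + 2) :=
  lt_of_le_of_ne (e.I_nonneg _) fun h0 => h (u_eq_zero_of_f
    (ae_zero_of_I_eq_zero (by linarith [ha.pos]) (e.memLp_add_two ha) h0.symm))

theorem D_pos_of_ne_zero (ha : Adm d α) {e : Elt d α} (h : e.u ≠ 0) : 0 < e.D := by
  have h1 := I_add_two_pos_of_ne_zero ha h
  refine lt_of_le_of_ne e.D_nonneg fun h0 => ?_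
  have := e.gn ha
  rw [← h0, mul_zero] at this
  linarith

theorem f_ae_zero_of_u (ha : Adm d α) {e : Elt d α} (h : e.u = 0) : e.f =ᵐ[volume] 0 :=
  ae_eq_zero_of_S0 ha.one_le ha.one_lt_alphaC e.hf.2 fun φ => by
    rw [← e.hf.1 φ, h]
    rfl

/-- Two representatives of the same distribution agree. -/
theorem f_ae_eq (ha : Adm d α) {e e' : Elt d α} (h : e.u = e'.u) : e.f =ᵐ[volume] e'.f :=
  IsFunction.ae_eq ha.one_le ha.one_lt_alphaC e.hf (h ▸ e'.hf)

theorem g_ae_eq (ha : Adm d α) {e e' : Elt d α} (h : e.u = e'.u) : e.g =ᵐ[volume] e'.g :=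
  IsFourier.ae_eq ha.one_le e.hg (h ▸ e'.hg)

theorem I_congr (ha : Adm d α) {e e' : Elt d α} (h : e.u = e'.u) (r : ℝ) : e.I r = e'.I r := by
  refine integral_congr_ae ?_
  filter_upwards [f_ae_eq ha h] with x hx
  rw [hx]

theorem h_congr (ha : Adm d α) {e e' : Elt d α} (h : e.u = e'.u) : e.h = e'.h := by
  refine Lp.ext ?_
  filter_upwards [e.h_ae, e'.h_ae, g_ae_eq ha h] with ξ h1 h2 h3
  rw [h1, h2, h3]

theorem D_congr (ha : Adm d α) {e e' : Elt d α} (h : e.u = e'.u) : e.D = e'.D := by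
  rw [D, D, h_congr ha h]

/-- The difference of two elements. -/
noncomputable def sub (ha : Adm d α) (e e' : Elt d α) : Elt d α where
  u := e.u - e'.u
  f := fun x => e.f x - e'.f x
  g := fun ξ => e.g ξ - e'.g ξ
  hf := by
    refine ⟨fun φ => ?_, e.hf.2.sub e'.hf.2⟩
    simp only [sub_mul]
    rw [integral_sub (integrable_mul_schwartz ha.one_lt_alphaC e.hf.2 _)
      (integrable_mul_schwartz ha.one_lt_alphaC e'.hf.2 _), ← e.hf.1 φ, ← e'.hf.1 φ]
    rfl
  hg := by
    refine ⟨fun φ => ?_, ?_⟩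
    · simp only [sub_mul]
      rw [integral_sub (integrable_fourier_pairing ha.one_le e.hg.2 _)
        (integrable_fourier_pairing ha.one_le e'.hg.2 _), ← e.hg.1 φ, ← e'.hg.1 φ]
      rfl
    · simp only [mul_sub]
      exact e.hg.2.sub e'.hg.2

theorem h_sub (ha : Adm d α) (e e' : Elt d α) : (e.sub ha e').h = e.h - e'.h := by
  refine Lp.ext ?_
  filter_upwards [e.h_ae, e'.h_ae, (e.sub ha e').h_ae, Lp.coeFn_sub e.h e'.h] with ξ h1 h2 h3 h4
  rw [h3, h4, Pi.sub_apply, h1, h2, sub]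
  ring

end Elt

/-! ### Translations, and elements coming from `Ḣ^{γ_c} ∩ Ḣ²` -/

/-- The modulation `ξ ↦ e^{2πi⟨a,ξ⟩}`. -/
noncomputable def modul (a ξ : E d) : ℂ :=
  Complex.exp (((2 * Real.pi * inner ℝ a ξ : ℝ) : ℂ) * Complex.I)

theorem norm_modul (a ξ : E d) : ‖modul a ξ‖ = 1 := Complex.norm_exp_ofReal_mul_I _

theorem continuous_modul (a : E d) : Continuous (modul a) := by
  unfold modul
  fun_prop

theorem fourierInv_compSubConst (φ : 𝓢(E d, ℂ)) (a ξ : E d) :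
    (𝓕⁻ (φ.compSubConstCLM ℂ a) : 𝓢(E d, ℂ)) ξ = modul a ξ * (𝓕⁻ φ : 𝓢(E d, ℂ)) ξ := by
  rw [fourierInv_apply_neg, fourier_compSubConst, fourierInv_apply_neg, modul, inner_neg_right]
  congr 4
  ring

theorem translate_apply (u : S0Dual d) (a : E d) (φ : S0 d) : translate u a φ = u (shiftS0 a φ) :=
  rfl

theorem shiftS0_coe (a : E d) (φ : S0 d) :
    ((shiftS0 a φ : S0 d) : 𝓢(E d, ℂ)) = (φ : 𝓢(E d, ℂ)).compSubConstCLM ℂ a := rfl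

theorem IsFunction.translate {u : S0Dual d} {f : E d → ℂ} (h : IsFunction u f) (a : E d) :
    IsFunction (translate u a) fun x => f (x + a) := by
  intro φ
  rw [translate_apply, h, ← integral_add_right_eq_self _ a]
  congr 1
  ext x
  rw [shiftS0_coe, SchwartzMap.compSubConstCLM_apply, add_sub_cancel_right]

theorem IsHdotFourier.translate {s : ℝ} {u : S0Dual d} {g : E d → ℂ} (h : IsHdotFourier s u g)
    (a : E d) : IsHdotFourier s (translate u a) fun ξ => modul a ξ * g ξ := by
  refine ⟨fun φ => ?_, ?_⟩
  · rw [translate_apply, h.1]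
    congr 1
    ext ξ
    rw [shiftS0_coe, fourierInv_compSubConst]
    ring
  · refine h.2.mono (((continuous_modul a).aestronglyMeasurable.mul h.2.1).congr
      (Eventually.of_forall fun ξ => ?_)) (Eventually.of_forall fun ξ => ?_)
    · simp only [Pi.mul_apply]
      ring
    · rw [norm_mul, norm_mul, norm_mul, norm_modul, one_mul]

theorem hdotNorm_translate (hd : 1 ≤ d) {s : ℝ} {u : S0Dual d} {g : E d → ℂ}
    (h : IsHdotFourier s u g) (a : E d) : hdotNorm s (translate u a) = hdotNorm s u := by
  rw [hdotNorm_eq hd h, hdotNorm_eq hd (h.translate a)]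
  refine eLpNorm_congr_norm_ae (Eventually.of_forall fun ξ => ?_)
  rw [norm_mul, norm_mul, norm_mul, norm_modul, one_mul]

theorem IsLpFunction.translate {q : ℝ} {u : S0Dual d} {f : E d → ℂ} (h : IsLpFunction q u f)
    (a : E d) : IsLpFunction q (translate u a) fun x => f (x + a) :=
  ⟨h.1.translate a, h.2.comp_measurePreserving (measurePreserving_add_right volume a)⟩

namespace Elt

variable {α : ℝ}

/-- The translate `e(· + a)`. -/
noncomputable def translate (e : Elt d α) (a : E d) : Elt d α where
  u := NL4S.translate e.u a
  f := fun x => e.f (x + a)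
  g := fun ξ => modul a ξ * e.g ξ
  hf := e.hf.translate a
  hg := e.hg.translate a

theorem I_translate (e : Elt d α) (a : E d) (r : ℝ) : (e.translate a).I r = e.I r :=
  integral_add_right_eq_self (fun x => ‖e.f x‖ ^ r) a

theorem norm_h_translate (e : Elt d α) (a : E d) : ‖(e.translate a).h‖ = ‖e.h‖ := by
  have : eLpNorm (fun ξ => symb 2 ξ * (e.translate a).g ξ) 2 volume
      = eLpNorm (fun ξ => symb 2 ξ * e.g ξ) 2 volume := by
    refine eLpNorm_congr_norm_ae (Eventually.of_forall fun ξ => ?_)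
    simp only [translate]
    rw [norm_mul, norm_mul, norm_mul, norm_modul, one_mul]
  rw [eLpNorm_symb, eLpNorm_symb] at this
  exact (ENNReal.ofReal_eq_ofReal_iff (norm_nonneg _) (norm_nonneg _)).1 this

theorem D_translate (e : Elt d α) (a : E d) : (e.translate a).D = e.D := by
  rw [D, D, norm_h_translate]

theorem exists_of_lebNorm {u : S0Dual d} (h : lebNorm α u < ⊤) : ∃ e : Elt d α, e.u = u := by
  obtain ⟨h1, h2⟩ := ENNReal.add_lt_top.1 h
  obtain ⟨f, hf⟩ := exists_of_lpNorm_lt_top h1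
  obtain ⟨g, hg⟩ := exists_of_hdotNorm_lt_top h2
  exact ⟨⟨u, f, g, hf, hg⟩, rfl⟩

/-- This is the embedding Ḣ^{γ_c} ⊂ L^{α_c}: the two exponents satisfy (d/2 − γ_c)(α_c − 2) = 2γ_c,
the relation needed in `sobolev`. One function g serves as Fourier transform for both regularities.
-/
theorem exists_of_sobNorm (ha : Adm d α) {u : S0Dual d} (h : sobNorm α u < ⊤) :
    ∃ e : Elt d α, e.u = u ∧ IsHdotFourier (gammaC d α) u e.g ∧
      lpNorm (alphaC d α) u ≤ ENNReal.ofReal (sobConst d (gammaC d α) (alphaC d α))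
        * hdotNorm (gammaC d α) u := by
  obtain ⟨h1, h2⟩ := ENNReal.add_lt_top.1 h
  obtain ⟨g, hg⟩ := exists_of_hdotNorm_lt_top h2
  have hγ := hg.of_hdot ha.one_le h1
  have hrel : ((d : ℝ) / 2 - gammaC d α) * (alphaC d α - 2) = 2 * gammaC d α := by
    unfold gammaC alphaC
    have := ha.pos
    field_simp
    ring
  obtain ⟨f, hf, hle⟩ := sobolev ha.one_le ha.gammaC_pos ha.gammaC_lt ha.two_lt_alphaC hrel hγ
  refine ⟨⟨u, f, g, hf, hg⟩, rfl, hγ, ?_⟩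
  rw [lpNorm_eq ha.one_le ha.one_lt_alphaC hf, NL4S.hdotNorm_eq ha.one_le hγ]
  exact hle

end Elt

/-! ### Brezis–Lieb lemma and convergence from almost everywhere convergence -/

/-- A generalized dominated convergence theorem. -/
theorem tendsto_integral_zero_of_le {X Y : ℕ → E d → ℝ} {M : ℝ}
    (hX0 : ∀ n x, 0 ≤ X n x) (hXm : ∀ n, AEStronglyMeasurable (X n) volume)
    (hXlim : ∀ᵐ x, Tendsto (fun n => X n x) atTop (𝓝 0))
    (hY0 : ∀ n x, 0 ≤ Y n x) (hYi : ∀ n, Integrable (Y n)) (hYM : ∀ n, ∫ x, Y n x ≤ M)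
    (hle : ∀ ε : ℝ, 0 < ε → ∃ Z : E d → ℝ, Integrable Z ∧ ∀ n x, X n x ≤ ε * Y n x + Z x) :
    Tendsto (fun n => ∫ x, X n x) atTop (𝓝 0) := by
  have hM0 : 0 ≤ M := (integral_nonneg (hY0 0)).trans (hYM 0)
  have hXi : ∀ n, Integrable (X n) := by
    intro n
    obtain ⟨Z, hZ, hXZ⟩ := hle 1 one_pos
    refine ((hYi n).const_mul 1 |>.add hZ).mono' (hXm n) (Eventually.of_forall fun x => ?_)
    rw [Real.norm_of_nonneg (hX0 n x)]
    exact hXZ n x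
  rw [Metric.tendsto_atTop]
  intro η hη
  set ε : ℝ := η / (2 * (M + 1)) with hε
  have hε0 : 0 < ε := by positivity
  obtain ⟨Z, hZ, hXZ⟩ := hle ε hε0
  -- The excess of X over εY is dominated by |Z| and tends to 0 almost everywhere, so its integral
  -- vanishes in the limit. What remains is at most εM.
  set W : ℕ → E d → ℝ := fun n x => max (X n x - ε * Y n x) 0 with hW
  have hWi : ∀ n, Integrable (W n) := fun n => ((hXi n).sub ((hYi n).const_mul ε)).pos_part
  have hWlim : Tendsto (fun n => ∫ x, W n x) atTop (𝓝 (∫ _ : E d, (0 : ℝ))) := by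
    refine tendsto_integral_of_dominated_convergence (fun x => |Z x|) (fun n => (hWi n).1) hZ.abs
      (fun n => Eventually.of_forall fun x => ?_) ?_
    · rw [Real.norm_of_nonneg (le_max_right _ _)]
      refine max_le ?_ (abs_nonneg _)
      linarith [hXZ n x, le_abs_self (Z x)]
    · filter_upwards [hXlim] with x hx
      refine squeeze_zero (fun n => le_max_right _ _) (fun n => max_le ?_ (hX0 n x)) hx
      have := mul_nonneg hε0.le (hY0 n x)
      linarith
  rw [integral_zero, Metric.tendsto_atTop] at hWlim
  obtain ⟨N, hN⟩ := hWlim (η / 2) (by positivity)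
  refine ⟨N, fun n hn => ?_⟩
  have h1 := hN n hn
  have hW0 : 0 ≤ ∫ x, W n x := integral_nonneg fun x => le_max_right _ _
  rw [dist_zero_right, Real.norm_of_nonneg hW0] at h1
  rw [dist_zero_right, Real.norm_of_nonneg (integral_nonneg (hX0 n))]
  have h2 : ∫ x, X n x ≤ ∫ x, (ε * Y n x + W n x) := by
    refine integral_mono (hXi n) (((hYi n).const_mul ε).add (hWi n)) fun x => ?_
    have := le_max_left (X n x - ε * Y n x) 0
    simp only [hW]
    linarith
  rw [integral_add ((hYi n).const_mul ε) (hWi n), integral_const_mul] at h2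
  have h3 : ε * ∫ x, Y n x ≤ η / 2 := by
    calc ε * ∫ x, Y n x ≤ ε * (M + 1) := by
          have := hYM n
          gcongr
          linarith
      _ = η / 2 := by
          rw [hε]
          field_simp
  linarith

/-- Bernoulli's inequality for (1 + (y/x − 1))^p, multiplied by x^p. -/
theorem rpow_sub_rpow_le {p x y : ℝ} (hp : 1 ≤ p) (hy : 0 ≤ y) (hxy : y ≤ x) :
    x ^ p - y ^ p ≤ p * x ^ (p - 1) * (x - y) := by
  rcases (hy.trans hxy).eq_or_lt with h0 | hx
  · have : y = 0 := le_antisymm (h0 ▸ hxy) hy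
    rw [this, ← h0]
    simp
  · have h1 := one_add_mul_self_le_rpow_one_add (s := y / x - 1) (p := p) (by
      have : 0 ≤ y / x := by positivity
      linarith) hp
    have h2 : 1 + (y / x - 1) = y / x := by ring
    rw [h2, Real.div_rpow hy hx.le] at h1
    have hxp : 0 < x ^ p := by positivity
    have h3 : x ^ p * (1 + p * (y / x - 1)) ≤ y ^ p := by
      calc _ ≤ x ^ p * (y ^ p / x ^ p) := by gcongr
        _ = y ^ p := by field_simp
    have h4 : x ^ (p - 1) = x ^ p / x := Real.rpow_sub_one hx.ne' p
    rw [h4]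
    have h5 : x ^ p * (1 + p * (y / x - 1)) = x ^ p - p * (x ^ p / x) * (x - y) := by
      field_simp
      ring
    linarith

theorem abs_rpow_sub_rpow_le {p x y m : ℝ} (hp : 1 ≤ p) (hx : 0 ≤ x) (hy : 0 ≤ y) (hxm : x ≤ m)
    (hym : y ≤ m) : |x ^ p - y ^ p| ≤ p * m ^ (p - 1) * |x - y| := by
  rcases le_total y x with h | h
  · rw [abs_of_nonneg (sub_nonneg.2 h), abs_of_nonneg (sub_nonneg.2
      (Real.rpow_le_rpow hy h (by linarith)))]
    refine (rpow_sub_rpow_le hp hy h).trans ?_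
    have : 0 ≤ x - y := by linarith
    gcongr
  · rw [abs_sub_comm, abs_sub_comm x y, abs_of_nonneg (sub_nonneg.2 h), abs_of_nonneg (sub_nonneg.2
      (Real.rpow_le_rpow hx h (by linarith)))]
    refine (rpow_sub_rpow_le hp hx h).trans ?_
    have : 0 ≤ y - x := by linarith
    gcongr

/-- If |b| ≤ η|a|, the mean value bound p(|a| + |b|)^{p−1}|b| is at most p 2^{p−1} η |a|^p, and η is
chosen to make this at most ε|a|^p. Otherwise |a| ≤ η^{-1}|b| and every term is controlled by |b|^p.
-/
theorem brezis_lieb_pointwise {p : ℝ} (hp : 1 ≤ p) {ε : ℝ} (hε : 0 < ε) :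
    ∃ C : ℝ, 0 ≤ C ∧ ∀ a b : ℂ, |‖a + b‖ ^ p - ‖a‖ ^ p - ‖b‖ ^ p| ≤ ε * ‖a‖ ^ p + C * ‖b‖ ^ p := by
  set η : ℝ := min 1 (ε / (p * 2 ^ (p - 1))) with hη
  have hp0 : 0 < p := by linarith
  have hη0 : 0 < η := lt_min one_pos (by positivity)
  have hη1 : η ≤ 1 := min_le_left _ _
  have hηε : p * 2 ^ (p - 1) * η ≤ ε := by
    have : η ≤ ε / (p * 2 ^ (p - 1)) := min_le_right _ _
    rw [le_div_iff₀ (by positivity)] at this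
    linarith
  refine ⟨p * (η⁻¹ + 1) ^ (p - 1) + 1, by positivity, fun a b => ?_⟩
  have h1 : |‖a + b‖ ^ p - ‖a‖ ^ p| ≤ p * (‖a‖ + ‖b‖) ^ (p - 1) * ‖b‖ := by
    refine (abs_rpow_sub_rpow_le hp (norm_nonneg _) (norm_nonneg _) (norm_add_le a b)
      (le_add_of_nonneg_right (norm_nonneg b))).trans ?_
    gcongr
    calc |‖a + b‖ - ‖a‖| ≤ ‖a + b - a‖ := abs_norm_sub_norm_le _ _
      _ = ‖b‖ := by rw [add_sub_cancel_left]
  have hbp : 0 ≤ ‖b‖ ^ p := by positivity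
  have h2 : |‖a + b‖ ^ p - ‖a‖ ^ p - ‖b‖ ^ p| ≤ |‖a + b‖ ^ p - ‖a‖ ^ p| + ‖b‖ ^ p := by
    refine (abs_sub _ _).trans (le_of_eq ?_)
    rw [abs_of_nonneg hbp]
  have hsp : ∀ t : ℝ, 0 ≤ t → t ^ (p - 1) * t = t ^ p := by
    intro t ht
    rcases ht.eq_or_lt with h | h
    · rw [← h, Real.zero_rpow hp0.ne', mul_zero]
    · rw [← Real.rpow_add_one h.ne', sub_add_cancel]
  by_cases hab : ‖b‖ ≤ η * ‖a‖
  · have h3 : p * (‖a‖ + ‖b‖) ^ (p - 1) * ‖b‖ ≤ ε * ‖a‖ ^ p := by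
      calc p * (‖a‖ + ‖b‖) ^ (p - 1) * ‖b‖ ≤ p * (2 * ‖a‖) ^ (p - 1) * (η * ‖a‖) := by
            have : ‖b‖ ≤ ‖a‖ := by nlinarith [norm_nonneg a]
            gcongr
            linarith
        _ = (p * 2 ^ (p - 1) * η) * (‖a‖ ^ (p - 1) * ‖a‖) := by
            rw [Real.mul_rpow (by norm_num) (norm_nonneg a)]
            ring
        _ ≤ ε * ‖a‖ ^ p := by
            rw [hsp _ (norm_nonneg a)]
            gcongr
    have : 0 ≤ p * (η⁻¹ + 1) ^ (p - 1) * ‖b‖ ^ p := by positivity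
    linarith
  · have hab : ‖a‖ ≤ η⁻¹ * ‖b‖ := by
      rw [inv_mul_eq_div, le_div_iff₀ hη0]
      linarith
    have h3 : p * (‖a‖ + ‖b‖) ^ (p - 1) * ‖b‖ ≤ p * (η⁻¹ + 1) ^ (p - 1) * ‖b‖ ^ p := by
      calc p * (‖a‖ + ‖b‖) ^ (p - 1) * ‖b‖ ≤ p * ((η⁻¹ + 1) * ‖b‖) ^ (p - 1) * ‖b‖ := by
            gcongr
            linarith
        _ = p * (η⁻¹ + 1) ^ (p - 1) * (‖b‖ ^ (p - 1) * ‖b‖) := by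
            rw [Real.mul_rpow (by positivity) (norm_nonneg b)]
            ring
        _ = _ := by rw [hsp _ (norm_nonneg b)]
    have : 0 ≤ ε * ‖a‖ ^ p := by positivity
    linarith

theorem norm_sub_rpow_le {p : ℝ} (hp : 0 < p) (a b : ℂ) :
    ‖a - b‖ ^ p ≤ 2 ^ p * (‖a‖ ^ p + ‖b‖ ^ p) := by
  have ha : 0 ≤ ‖a‖ ^ p := by positivity
  have hb : 0 ≤ ‖b‖ ^ p := by positivity
  have h2 : (0 : ℝ) < 2 ^ p := by positivity
  rcases le_total ‖a‖ ‖b‖ with h | h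
  · calc ‖a - b‖ ^ p ≤ (2 * ‖b‖) ^ p := by
          gcongr
          linarith [norm_sub_le a b]
      _ = 2 ^ p * ‖b‖ ^ p := Real.mul_rpow (by norm_num) (norm_nonneg b)
      _ ≤ _ := by nlinarith
  · calc ‖a - b‖ ^ p ≤ (2 * ‖a‖) ^ p := by
          gcongr
          linarith [norm_sub_le a b]
      _ = 2 ^ p * ‖a‖ ^ p := Real.mul_rpow (by norm_num) (norm_nonneg a)
      _ ≤ _ := by nlinarith

theorem integral_norm_sub_rpow_le {p M : ℝ} (hp : 1 ≤ p) {F f : E d → ℂ}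
    (hF : MemLp F (ENNReal.ofReal p) volume) (hf : MemLp f (ENNReal.ofReal p) volume)
    (hM : ∫ x, ‖F x‖ ^ p ≤ M) :
    ∫ x, ‖F x - f x‖ ^ p ≤ 2 ^ p * (M + ∫ x, ‖f x‖ ^ p) := by
  have hp0 : 0 < p := by linarith
  have i1 := Elt.integrable_rpow hp0 hF
  have i2 := Elt.integrable_rpow hp0 hf
  calc ∫ x, ‖F x - f x‖ ^ p ≤ ∫ x, 2 ^ p * (‖F x‖ ^ p + ‖f x‖ ^ p) :=
        integral_mono (Elt.integrable_rpow hp0 (hF.sub hf)) ((i1.add i2).const_mul _)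
          fun x => norm_sub_rpow_le hp0 _ _
    _ = 2 ^ p * ((∫ x, ‖F x‖ ^ p) + ∫ x, ‖f x‖ ^ p) := by
        rw [integral_const_mul, integral_add i1 i2]
    _ ≤ _ := by gcongr

/-- The Brezis–Lieb lemma. -/
theorem brezis_lieb {p M : ℝ} (hp : 1 ≤ p) {F : ℕ → E d → ℂ} {f : E d → ℂ}
    (hF : ∀ n, MemLp (F n) (ENNReal.ofReal p) volume) (hf : MemLp f (ENNReal.ofReal p) volume)
    (hM : ∀ n, ∫ x, ‖F n x‖ ^ p ≤ M) (hlim : ∀ᵐ x, Tendsto (fun n => F n x) atTop (𝓝 (f x))) :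
    Tendsto (fun n => (∫ x, ‖F n x‖ ^ p) - ∫ x, ‖F n x - f x‖ ^ p) atTop
      (𝓝 (∫ x, ‖f x‖ ^ p)) := by
  have hp0 : 0 < p := by linarith
  have i1 := fun n => Elt.integrable_rpow hp0 (hF n)
  have i2 := Elt.integrable_rpow hp0 hf
  have i3 : ∀ n, Integrable fun x => ‖F n x - f x‖ ^ p :=
    fun n => Elt.integrable_rpow hp0 ((hF n).sub hf)
  have key := tendsto_integral_zero_of_le
    (X := fun n x => |‖F n x‖ ^ p - ‖F n x - f x‖ ^ p - ‖f x‖ ^ p|)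
    (Y := fun n x => ‖F n x - f x‖ ^ p) (M := 2 ^ p * (M + ∫ x, ‖f x‖ ^ p))
    (fun n x => abs_nonneg _) (fun n => (((i1 n).sub (i3 n)).sub i2).abs.1) ?_
    (fun n x => by positivity) i3 (fun n => integral_norm_sub_rpow_le hp (hF n) hf (hM n)) ?_
  · rw [tendsto_iff_norm_sub_tendsto_zero]
    refine squeeze_zero (fun n => norm_nonneg _) (fun n => ?_) key
    have i4 : Integrable fun x => ‖F n x‖ ^ p - ‖F n x - f x‖ ^ p := (i1 n).sub (i3 n)
    rw [← integral_sub (i1 n) (i3 n), ← integral_sub i4 i2]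
    exact norm_integral_le_integral_norm _
  · filter_upwards [hlim] with x hx
    have c1 : Tendsto (fun n => ‖F n x‖ ^ p) atTop (𝓝 (‖f x‖ ^ p)) :=
      hx.norm.rpow_const (Or.inr hp0.le)
    have c2 : Tendsto (fun n => ‖F n x - f x‖ ^ p) atTop (𝓝 (‖f x - f x‖ ^ p)) :=
      (hx.sub_const _).norm.rpow_const (Or.inr hp0.le)
    have := ((c1.sub c2).sub_const (‖f x‖ ^ p)).abs
    simpa [Real.zero_rpow hp0.ne'] using this
  · intro ε hε
    obtain ⟨C, hC, hb⟩ := brezis_lieb_pointwise hp hε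
    refine ⟨fun x => C * ‖f x‖ ^ p, i2.const_mul C, fun n x => ?_⟩
    have := hb (F n x - f x) (f x)
    rwa [sub_add_cancel] at this

/-- Either y ≤ ε x^{q−1} and the first term suffices, or x is bounded by a power of y and the second
does. It puts products with a test function into the form asked for by
`tendsto_integral_zero_of_le`. -/
theorem young_pointwise {q : ℝ} (hq : 1 < q) {ε : ℝ} (hε : 0 < ε) {x y : ℝ} (hx : 0 ≤ x)
    (hy : 0 ≤ y) : x * y ≤ ε * x ^ q + ε⁻¹ ^ (q - 1)⁻¹ * y ^ q.conjExponent := by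
  have hq1 : 0 < q - 1 := by linarith
  have h1 : 0 ≤ ε * x ^ q := by positivity
  have h2 : 0 ≤ ε⁻¹ ^ (q - 1)⁻¹ * y ^ q.conjExponent := by positivity
  by_cases h : y ≤ ε * x ^ (q - 1)
  · rcases hx.eq_or_lt with h0 | hx0
    · rw [← h0] at h1 ⊢
      linarith
    · have : x * y ≤ ε * x ^ q := by
        calc x * y ≤ x * (ε * x ^ (q - 1)) := by gcongr
          _ = ε * (x ^ (q - 1) * x) := by ring
          _ = ε * x ^ q := by rw [← Real.rpow_add_one hx0.ne', sub_add_cancel]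
      linarith
  · have h : ε * x ^ (q - 1) < y := not_le.1 h
    have hy0 : 0 < y := lt_of_le_of_lt (by positivity) h
    have h3 : x ≤ (ε⁻¹ * y) ^ (q - 1)⁻¹ := by
      rw [Real.le_rpow_inv_iff_of_pos hx (by positivity) hq1, inv_mul_eq_div, le_div_iff₀ hε]
      linarith
    have : x * y ≤ ε⁻¹ ^ (q - 1)⁻¹ * y ^ q.conjExponent := by
      calc x * y ≤ (ε⁻¹ * y) ^ (q - 1)⁻¹ * y := by gcongr
        _ = ε⁻¹ ^ (q - 1)⁻¹ * (y ^ (q - 1)⁻¹ * y) := by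
            rw [Real.mul_rpow (by positivity) hy0.le]
            ring
        _ = _ := by
            rw [← Real.rpow_add_one hy0.ne']
            congr 2
            unfold Real.conjExponent
            field_simp
            ring
    linarith

/-- Bounded sequences in `L^q` that converge almost everywhere converge weakly. -/
theorem tendsto_integral_mul_of_ae {q M : ℝ} (hq : 1 < q) {F : ℕ → E d → ℂ} {f : E d → ℂ}
    (hF : ∀ n, MemLp (F n) (ENNReal.ofReal q) volume) (hf : MemLp f (ENNReal.ofReal q) volume)
    (hM : ∀ n, ∫ x, ‖F n x‖ ^ q ≤ M) (hlim : ∀ᵐ x, Tendsto (fun n => F n x) atTop (𝓝 (f x)))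
    (φ : 𝓢(E d, ℂ)) :
    Tendsto (fun n => ∫ x, F n x * φ x) atTop (𝓝 (∫ x, f x * φ x)) := by
  have hq0 : 0 < q := by linarith
  have hqc := (Real.HolderConjugate.conjExponent hq).symm.pos
  have key := tendsto_integral_zero_of_le (X := fun n x => ‖F n x - f x‖ * ‖φ x‖)
    (Y := fun n x => ‖F n x - f x‖ ^ q) (M := 2 ^ q * (M + ∫ x, ‖f x‖ ^ q))
    (fun n x => by positivity)
    (fun n => (((hF n).1.sub hf.1).norm).mul φ.continuous.aestronglyMeasurable.norm) ?_
    (fun n x => by positivity) (fun n => Elt.integrable_rpow hq0 ((hF n).sub hf))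
    (fun n => integral_norm_sub_rpow_le hq.le (hF n) hf (hM n)) ?_
  · rw [tendsto_iff_norm_sub_tendsto_zero]
    refine squeeze_zero (fun n => norm_nonneg _) (fun n => ?_) key
    rw [← integral_sub (integrable_mul_schwartz hq (hF n) φ) (integrable_mul_schwartz hq hf φ)]
    refine (norm_integral_le_integral_norm _).trans (le_of_eq ?_)
    congr 1
    ext x
    rw [← norm_mul, sub_mul]
  · filter_upwards [hlim] with x hx
    have := ((hx.sub_const (f x)).norm).mul_const ‖φ x‖
    simpa using this
  · intro ε hε
    refine ⟨fun x => ε⁻¹ ^ (q - 1)⁻¹ * ‖φ x‖ ^ q.conjExponent, ?_, fun n x =>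
      young_pointwise hq hε (norm_nonneg _) (norm_nonneg _)⟩
    exact (Elt.integrable_rpow hqc (φ.memLp _ volume)).const_mul _

/-! ### Non-vanishing: a large `L^{α+2}` norm is seen at one point and one frequency -/

theorem interpolate_pointwise {q p r δ t : ℝ} (hq : 0 < q) (hqp : q < p) (hpr : p < r) (hδ : 0 < δ)
    (ht : 0 ≤ t) : t ^ p ≤ δ * t ^ q + (δ ^ (p - q)⁻¹) ^ (p - r) * t ^ r := by
  have h1 : 0 ≤ δ * t ^ q := by positivity
  have h2 : 0 ≤ (δ ^ (p - q)⁻¹) ^ (p - r) * t ^ r := by positivity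
  rcases ht.eq_or_lt with h0 | ht0
  · rw [← h0, Real.zero_rpow (by linarith)]
    rw [← h0] at h1 h2
    linarith
  -- The threshold is where t^p = δ t^q. Above it the negative power t^{p−r} is at most its value at
  -- the threshold, which is the constant in front of t^r.
  by_cases h : t ≤ δ ^ (p - q)⁻¹
  · have h3 : t ^ (p - q) ≤ δ := by
      have := Real.rpow_le_rpow ht h (by linarith : 0 ≤ p - q)
      rwa [← Real.rpow_mul hδ.le, inv_mul_cancel₀ (by linarith), Real.rpow_one] at this
    have : t ^ p ≤ δ * t ^ q := by
      calc t ^ p = t ^ (p - q) * t ^ q := by rw [← Real.rpow_add ht0, sub_add_cancel]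
        _ ≤ _ := by gcongr
    linarith
  · have h3 : t ^ (p - r) ≤ (δ ^ (p - q)⁻¹) ^ (p - r) :=
      Real.rpow_le_rpow_of_nonpos (by positivity) (not_le.1 h).le (by linarith)
    have : t ^ p ≤ (δ ^ (p - q)⁻¹) ^ (p - r) * t ^ r := by
      calc t ^ p = t ^ (p - r) * t ^ r := by rw [← Real.rpow_add ht0, sub_add_cancel]
        _ ≤ _ := by gcongr
    linarith

theorem memLp_one_add_norm {s : ℝ} (hs : (d : ℝ) / 2 < s) :
    MemLp (fun ξ : E d => (1 + ‖ξ‖) ^ (-s)) 2 volume := by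
  have hm : AEStronglyMeasurable (fun ξ : E d => (1 + ‖ξ‖) ^ (-s)) volume :=
    Measurable.aestronglyMeasurable (by fun_prop)
  rw [← integrable_norm_rpow_iff hm (by norm_num) (by norm_num)]
  have := integrable_one_add_norm (E := E d) (μ := volume) (r := 2 * s) (by
    rw [finrank_euclideanSpace_fin]
    linarith)
  refine this.congr (Eventually.of_forall fun ξ => ?_)
  have h0 : 0 < 1 + ‖ξ‖ := by positivity
  simp only [ENNReal.toReal_ofNat]
  rw [Real.norm_of_nonneg (by positivity), ← Real.rpow_mul h0.le]
  congr 1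
  ring

/-- Control of the frequencies between `1` and `A` by the `Ḣ²` norm. -/
theorem exists_norm_smooth_sub_le (hd : 1 ≤ d) {κ : ℝ} (hκ0 : 0 ≤ κ) (hκ : (d : ℝ) / 2 - 2 < κ) :
    ∃ C : ℝ, 0 ≤ C ∧ ∀ {α : ℝ}, Adm d α → ∀ (e : Elt d α) {A : ℝ} (hA : 1 ≤ A) (x : E d),
      ‖smooth (𝓕 (cutoff A (one_pos.trans_le hA))) e.f x - smooth (𝓕 (cutoff 1 one_pos)) e.f x‖
        ≤ C * A ^ κ * ‖e.h‖ := by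
  have hw := memLp_one_add_norm (d := d) (s := 2 + κ) (by linarith)
  set w := (eLpNorm (fun ξ : E d => (1 + ‖ξ‖) ^ (-(2 + κ))) 2 volume).toReal with hwdef
  have hw0 : 0 ≤ w := ENNReal.toReal_nonneg
  refine ⟨2 * 2 ^ κ * 2 ^ (2 + κ) * w, by positivity, fun {α} ha e {A} hA x => ?_⟩
  have hA0 := one_pos.trans_le hA
  -- A difference of two cutoffs vanishes near 0, so its transform lies in 𝒮₀. The difference of the
  -- smoothings is therefore a pairing with u, to be evaluated in frequency by Cauchy–Schwarz.
  set ψ : 𝓢(E d, ℂ) := cutoff A hA0 - cutoff 1 one_pos with hψ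
  have hψ0 : ∀ᶠ ξ in 𝓝 (0 : E d), ψ ξ = 0 := by
    filter_upwards [cutoff_eventually (d := d) hA0, cutoff_eventually (d := d) one_pos] with ξ h1 h2
    rw [hψ, sub_apply, h1, h2, sub_self]
  let φ : S0 d := ⟨(𝓕 ψ : 𝓢(E d, ℂ)).compSubConstCLM ℂ x,
    compSubConst_mem_S0 x (fourier_mem_S0 hψ0)⟩
  have hφ : ∀ ξ, (𝓕⁻ (φ : 𝓢(E d, ℂ)) : 𝓢(E d, ℂ)) ξ = modul x ξ * ψ ξ := by
    intro ξ
    change (𝓕⁻ ((𝓕 ψ : 𝓢(E d, ℂ)).compSubConstCLM ℂ x) : 𝓢(E d, ℂ)) ξ = _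
    rw [fourierInv_compSubConst, fourierInv_fourier_schwartz]
  have e1 : smooth (𝓕 (cutoff A hA0)) e.f x - smooth (𝓕 (cutoff 1 one_pos)) e.f x
      = ∫ y, e.f y * (φ : 𝓢(E d, ℂ)) y := by
    rw [smooth, smooth, ← integral_sub (integrable_smooth ha.one_lt_alphaC e.hf.2 _ _)
      (integrable_smooth ha.one_lt_alphaC e.hf.2 _ _)]
    congr 1
    ext y
    change _ = e.f y * (𝓕 ψ : 𝓢(E d, ℂ)) (y - x)
    rw [hψ, fourier_sub_schwartz, sub_apply]
    ring
  rw [e1, e.hfg, fourier_pairing_eq hd]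
  refine (norm_integral_mul_le e.hg.2 (memLp_symb_neg_two φ)).trans ?_
  rw [e.eLpNorm_symb, ENNReal.toReal_ofReal (norm_nonneg _), mul_comm]
  gcongr
  have hle : ∀ ξ, ‖symb (-2) ξ * (𝓕⁻ (φ : 𝓢(E d, ℂ)) : 𝓢(E d, ℂ)) ξ‖
      ≤ (2 * 2 ^ κ * 2 ^ (2 + κ) * A ^ κ) * ‖(1 + ‖ξ‖) ^ (-(2 + κ))‖ := by
    intro ξ
    have hR : 0 ≤ (2 * 2 ^ κ * 2 ^ (2 + κ) * A ^ κ) * ‖(1 + ‖ξ‖) ^ (-(2 + κ))‖ := by positivity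
    rw [norm_mul, hφ, norm_mul, norm_modul, one_mul, norm_symb]
    by_cases h1 : ‖ξ‖ ≤ 1
    · rw [hψ, sub_apply, cutoff_eq_one hA0 (h1.trans hA), cutoff_eq_one one_pos h1, sub_self,
        norm_zero, mul_zero]
      exact hR
    have h1 : 1 < ‖ξ‖ := not_le.1 h1
    by_cases h2 : 2 * A ≤ ‖ξ‖
    · rw [hψ, sub_apply, cutoff_eq_zero hA0 h2, cutoff_eq_zero one_pos (by linarith), sub_self,
        norm_zero, mul_zero]
      exact hR
    have h2 : ‖ξ‖ < 2 * A := not_le.1 h2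
    have h0 : 0 < ‖ξ‖ := by linarith
    have hψle : ‖ψ ξ‖ ≤ 2 := by
      rw [hψ, sub_apply]
      refine (norm_sub_le _ _).trans ?_
      linarith [norm_cutoff_le hA0 ξ, norm_cutoff_le (d := d) one_pos ξ]
    rw [Real.norm_of_nonneg (by positivity)]
    -- On 1 < ‖ξ‖ < 2A write ‖ξ‖^{-2} = ‖ξ‖^κ ‖ξ‖^{-(2+κ)}. The first factor is at most (2A)^κ and
    -- the second is comparable to a square integrable weight, because 2 + κ > d/2.
    calc (2 * Real.pi * ‖ξ‖) ^ (-2 : ℝ) * ‖ψ ξ‖ ≤ ‖ξ‖ ^ (-2 : ℝ) * 2 := by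
          refine mul_le_mul ?_ hψle (norm_nonneg _) (by positivity)
          exact Real.rpow_le_rpow_of_nonpos h0 (one_le_two_pi_mul h0.le) (by norm_num)
      _ = 2 * (‖ξ‖ ^ κ * ‖ξ‖ ^ (-(2 + κ))) := by
          rw [← Real.rpow_add h0, mul_comm]
          congr 2
          ring
      _ ≤ 2 * ((2 * A) ^ κ * (2⁻¹ * (1 + ‖ξ‖)) ^ (-(2 + κ))) := by
          gcongr 2 * (?_ * ?_)
          · exact Real.rpow_le_rpow h0.le h2.le hκ0
          · exact Real.rpow_le_rpow_of_nonpos (by positivity) (by linarith) (by linarith)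
      _ = _ := by
          rw [Real.mul_rpow (by norm_num) hA0.le, Real.mul_rpow (by norm_num) (by positivity),
            Real.rpow_neg (by norm_num : (0 : ℝ) ≤ 2⁻¹), Real.inv_rpow (by norm_num), inv_inv]
          ring
  have hfin := eLpNorm_le_mul_eLpNorm_of_ae_le_mul (Eventually.of_forall hle) 2 (μ := volume)
  have := ENNReal.toReal_mono (ENNReal.mul_ne_top ENNReal.ofReal_ne_top hw.2.ne) hfin
  rw [ENNReal.toReal_mul, ENNReal.toReal_ofReal (by positivity), ← hwdef] at this
  linarith

namespace Elt

variable {α : ℝ}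

/-- The cutoffs of dyadic frequencies. -/
noncomputable def low (e : Elt d α) (j : ℤ) (x : E d) : ℂ :=
  smooth (𝓕 (cutoff ((2 : ℝ) ^ j) (zpow_pos two_pos j))) e.f x

theorem norm_low_le (ha : Adm d α) (e : Elt d α) (j : ℤ) (x : E d) :
    ‖e.low j x‖ ≤ (e.I (alphaC d α)) ^ (alphaC d α)⁻¹
      * (((2 : ℝ) ^ j) ^ (4 / α) * kerNorm d (alphaC d α)) := by
  have h := norm_smooth_cutoff_le ha.one_lt_alphaC e.hf.2 (zpow_pos (two_pos (α := ℝ)) j) x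
  rw [eLpNorm_toReal_eq (by linarith [ha.two_lt_alphaC]) e.hf.2, ← I,
    ENNReal.toReal_ofReal (Real.rpow_nonneg (e.I_nonneg _) _), ha.div_alphaC] at h
  exact h

/-- Interpolates L^{α+2} between L^{α_c} and an L^r with r > α+2. The first share is as small as δ
permits; by the refined Sobolev inequality the second is small once B is. -/
theorem I_add_two_le_of_low (ha : Adm d α) (e : Elt d α) {B β r δ : ℝ} (hB : 0 < B) (hβ : 0 < β)
    (hr : α + 2 < r) (hβr : β * (r - 2) = 4) (hδ : 0 < δ)
    (H : ∀ (j : ℤ) (x : E d), ‖e.low j x‖ ≤ B * ((2 : ℝ) ^ j) ^ β) :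
    e.I (α + 2) ≤ δ * e.I (alphaC d α) + (δ ^ (α + 2 - alphaC d α)⁻¹) ^ (α + 2 - r)
      * (4 * r * 2 ^ (r - 2) * 2 ^ (2 * (2 : ℝ)) / (r - 2) * B ^ (r - 2) * e.D) := by
  have hap := ha.pos
  have hq : 0 < alphaC d α := by linarith [ha.two_lt_alphaC]
  have h1 := lintegral_rpow_le_of_low ha.one_le ha.one_lt_alphaC e.hf.2 e.hg.2 e.hfg hB hβ
    (by linarith) hβr H
  set c := 4 * r * 2 ^ (r - 2) * 2 ^ (2 * (2 : ℝ)) / (r - 2) * B ^ (r - 2) with hc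
  have hc0 : 0 ≤ c := by
    have : 0 < r - 2 := by linarith
    have : 0 < r := by linarith
    positivity
  rw [e.eLpNorm_symb, ← ENNReal.ofReal_pow (norm_nonneg _), ← ENNReal.ofReal_mul hc0] at h1
  have hmem : MemLp e.f (ENNReal.ofReal r) volume := by
    refine ⟨e.hf.2.1, ?_⟩
    have := h1.trans_lt ENNReal.ofReal_lt_top
    rw [lintegral_enorm_rpow_eq _ (by linarith)] at this
    exact (ENNReal.rpow_lt_top_iff_of_pos (by linarith)).1 this
  rw [lintegral_eq_integral (by linarith) hmem,
    ENNReal.ofReal_le_ofReal_iff (mul_nonneg hc0 (sq_nonneg _))] at h1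
  have i1 := integrable_rpow hq e.hf.2
  have i2 := integrable_rpow (by linarith) hmem
  set k := (δ ^ (α + 2 - alphaC d α)⁻¹) ^ (α + 2 - r) with hk
  have hk0 : 0 ≤ k := by positivity
  calc e.I (α + 2) ≤ ∫ x, (δ * ‖e.f x‖ ^ (alphaC d α) + k * ‖e.f x‖ ^ r) := by
        refine integral_mono (integrable_rpow (by linarith) (e.memLp_add_two ha))
          ((i1.const_mul _).add (i2.const_mul _)) fun x => ?_
        exact interpolate_pointwise hq ha.alphaC_lt hr hδ (norm_nonneg _)
    _ = δ * e.I (alphaC d α) + k * ∫ x, ‖e.f x‖ ^ r := by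
        rw [integral_add (i1.const_mul _) (i2.const_mul _), integral_const_mul, integral_const_mul]
        rfl
    _ ≤ _ := by
        gcongr
        exact h1

end Elt

theorem exists_zpow_le {A : ℝ} (hA : 0 < A) : ∃ j : ℤ, (2 : ℝ) ^ j ≤ A :=
  let ⟨j, hj, _⟩ := exists_mem_Ico_zpow hA one_lt_two
  ⟨j, hj⟩

theorem exists_le_zpow {A : ℝ} (hA : 0 < A) : ∃ j : ℤ, A ≤ (2 : ℝ) ^ j :=
  let ⟨j, _, hj⟩ := exists_mem_Ico_zpow hA one_lt_two
  ⟨j + 1, hj.le⟩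

/-- Bounded elements of large `L^{α+2}` norm are large at some point and some frequency in a
compact range. -/
theorem exists_low_ge {α : ℝ} (ha : Adm d α) {K ε : ℝ} (hK : 0 < K) (hε : 0 < ε) :
    ∃ (a b : ℤ) (c : ℝ), 0 < c ∧ ∀ e : Elt d α, e.I (alphaC d α) ≤ K → e.D ≤ K → ε ≤ e.I (α + 2) →
      ∃ j ∈ Set.Icc a b, ∃ x, c ≤ ‖e.low j x‖ := by
  have hap := ha.pos
  have hq : 0 < alphaC d α := by linarith [ha.two_lt_alphaC]
  -- Exponents β₀ < κ < β < 4/α are needed: κ above β₀ for the high-frequency bound, β above κ and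
  -- below 4/α so that B·2^{jβ} dominates both a priori bounds at the extremes. There is room
  -- because α(d − 4) < 8. Since β < 4/α, the exponent r = 2 + 4/β exceeds α + 2.
  set β₀ : ℝ := max 0 ((d : ℝ) / 2 - 2) with hβ₀
  have h00 : 0 ≤ β₀ := le_max_left _ _
  have hβ₀lt : β₀ < 4 / α := by
    refine max_lt (by positivity) ?_
    rw [lt_div_iff₀ hap]
    linarith [ha.lt_eight]
  set β : ℝ := (β₀ + 4 / α) / 2 with hβ
  have hβ1 : β₀ < β := by linarith
  have hβ2 : β < 4 / α := by linarith
  have hβ0 : 0 < β := by linarith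
  set κ : ℝ := (β₀ + β) / 2 with hκ
  have hκ1 : β₀ < κ := by linarith
  have hκ2 : κ < β := by linarith
  set r : ℝ := 2 + 4 / β with hr
  have hrp : α + 2 < r := by
    have : α < 4 / β := by
      rw [lt_div_iff₀ hβ0]
      rw [lt_div_iff₀ hap] at hβ2
      linarith
    linarith
  have hβr : β * (r - 2) = 4 := by
    rw [hr]
    field_simp
    ring
  have hr2 : 0 < r - 2 := by linarith
  have hr0 : 0 < r := by linarith
  obtain ⟨C, hC0, hC⟩ := exists_norm_smooth_sub_le ha.one_le (κ := κ) (by linarith)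
    ((le_max_right _ _).trans_lt hκ1)
  -- With δ, m and B chosen in this way each of the two terms of `I_add_two_le_of_low` is at most
  -- ε/4, which is incompatible with I ≥ ε.
  set δ : ℝ := ε / (4 * K) with hδ
  have hδ0 : 0 < δ := by positivity
  set m : ℝ := (δ ^ (α + 2 - alphaC d α)⁻¹) ^ (α + 2 - r)
    * (4 * r * 2 ^ (r - 2) * 2 ^ (2 * (2 : ℝ)) / (r - 2)) * K with hm
  have hm0 : 0 < m := by positivity
  set B : ℝ := (ε / (4 * m)) ^ (r - 2)⁻¹ with hB
  have hB0 : 0 < B := by positivity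
  have hBr : B ^ (r - 2) = ε / (4 * m) := by
    rw [hB, ← Real.rpow_mul (by positivity), inv_mul_cancel₀ hr2.ne', Real.rpow_one]
  set K₁ : ℝ := K ^ (alphaC d α)⁻¹ * kerNorm d (alphaC d α) + 1 with hK₁
  have hker := kerNorm_nonneg (d := d) (alphaC d α)
  have hK₁0 : 0 < K₁ := by positivity
  set s : ℝ := 4 / α - β with hs
  have hs0 : 0 < s := by linarith
  -- For j < a the L^{α_c} bound K₁ 2^{4j/α} is already at most B 2^{jβ}, so no point at such a
  -- frequency can be large.
  obtain ⟨a, haj⟩ := exists_zpow_le (A := (B / K₁) ^ s⁻¹) (by positivity)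
  set K₂ : ℝ := K₁ + C * K ^ (2 : ℝ)⁻¹ with hK₂
  have hK₂0 : 0 < K₂ := by positivity
  set t : ℝ := β - κ with ht
  have ht0 : 0 < t := by linarith
  -- For j above b the bound K₂ 2^{jκ} is at most B 2^{jβ}. It comes from comparison with the cutoff
  -- at frequency 1 and needs 2^j ≥ 1, hence the upper end `max b 0`.
  obtain ⟨b, hbj⟩ := exists_le_zpow (A := (K₂ / B) ^ t⁻¹) (by positivity)
  refine ⟨a, max b 0, B * ((2 : ℝ) ^ a) ^ β, by positivity, fun e hI hD hεI => ?_⟩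
  have hnot : ¬ ∀ (j : ℤ) (x : E d), ‖e.low j x‖ ≤ B * ((2 : ℝ) ^ j) ^ β := by
    intro H
    have h1 := e.I_add_two_le_of_low ha hB0 hβ0 hrp hβr hδ0 H
    rw [hBr] at h1
    have h2 : δ * e.I (alphaC d α) ≤ ε / 4 := by
      calc δ * e.I (alphaC d α) ≤ δ * K := by gcongr
        _ = ε / 4 := by
          rw [hδ]
          field_simp
    have h3 : (δ ^ (α + 2 - alphaC d α)⁻¹) ^ (α + 2 - r)
        * (4 * r * 2 ^ (r - 2) * 2 ^ (2 * (2 : ℝ)) / (r - 2) * (ε / (4 * m)) * e.D) ≤ ε / 4 := by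
      calc _ ≤ (δ ^ (α + 2 - alphaC d α)⁻¹) ^ (α + 2 - r)
        * (4 * r * 2 ^ (r - 2) * 2 ^ (2 * (2 : ℝ)) / (r - 2) * (ε / (4 * m)) * K) := by gcongr
        _ = m * (ε / (4 * m)) := by
          rw [hm]
          ring
        _ = ε / 4 := by field_simp
    linarith
  push Not at hnot
  obtain ⟨j, x, hjx⟩ := hnot
  have hA0 : (0 : ℝ) < 2 ^ j := zpow_pos two_pos j
  set A : ℝ := 2 ^ j with hA
  have hIq : (e.I (alphaC d α)) ^ (alphaC d α)⁻¹ * kerNorm d (alphaC d α) ≤ K₁ := by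
    have : (e.I (alphaC d α)) ^ (alphaC d α)⁻¹ ≤ K ^ (alphaC d α)⁻¹ :=
      Real.rpow_le_rpow (e.I_nonneg _) hI (by positivity)
    rw [hK₁]
    nlinarith
  have hja : a ≤ j := by
    by_contra hlt
    have hlt : j < a := not_le.1 hlt
    have hAa : A ≤ (B / K₁) ^ s⁻¹ := by
      refine le_trans ?_ haj
      exact zpow_le_zpow_right₀ one_le_two hlt.le
    have hAs : A ^ s ≤ B / K₁ := by
      have := Real.rpow_le_rpow hA0.le hAa hs0.le
      rwa [← Real.rpow_mul (by positivity), inv_mul_cancel₀ hs0.ne', Real.rpow_one] at this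
    have h1 := e.norm_low_le ha j x
    have h2 : A ^ (4 / α) = A ^ s * A ^ β := by
      rw [← Real.rpow_add hA0, hs, sub_add_cancel]
    have h3 : ‖e.low j x‖ ≤ B * A ^ β := by
      calc ‖e.low j x‖ ≤ _ := h1
        _ = ((e.I (alphaC d α)) ^ (alphaC d α)⁻¹ * kerNorm d (alphaC d α)) * (A ^ s * A ^ β) := by
            rw [← h2]
            ring
        _ ≤ K₁ * (B / K₁ * A ^ β) := by gcongr
        _ = B * A ^ β := by field_simp
    linarith
  have hjb : j ≤ max b 0 := by
    by_contra hlt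
    have hlt : max b 0 < j := not_le.1 hlt
    have hj0 : 0 ≤ j := ((le_max_right b 0).trans_lt hlt).le
    have hjb' : b ≤ j := ((le_max_left b 0).trans_lt hlt).le
    have hA1 : 1 ≤ A := one_le_zpow₀ one_le_two hj0
    have hAb : (K₂ / B) ^ t⁻¹ ≤ A := hbj.trans (zpow_le_zpow_right₀ one_le_two hjb')
    have hAt : K₂ / B ≤ A ^ t := by
      have := Real.rpow_le_rpow (by positivity) hAb ht0.le
      rwa [← Real.rpow_mul (by positivity), inv_mul_cancel₀ ht0.ne', Real.rpow_one] at this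
    have h1 := hC ha e hA1 x
    have h2 := norm_smooth_cutoff_le ha.one_lt_alphaC e.hf.2 (one_pos (α := ℝ)) x
    rw [Real.one_rpow, one_mul, Elt.eLpNorm_toReal_eq hq e.hf.2,
      ← Elt.I, ENNReal.toReal_ofReal (Real.rpow_nonneg (e.I_nonneg _) _)] at h2
    have h3 : ‖e.h‖ ≤ K ^ (2 : ℝ)⁻¹ := by
      rw [Real.le_rpow_inv_iff_of_pos (norm_nonneg _) hK.le two_pos, Real.rpow_two]
      exact hD
    have hAκ : 1 ≤ A ^ κ := Real.one_le_rpow hA1 (by linarith)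
    have h4 : ‖e.low j x‖ ≤ K₂ * A ^ κ := by
      have : ‖e.low j x‖ ≤ C * A ^ κ * ‖e.h‖ + K₁ := by
        refine (norm_le_norm_sub_add _ (smooth (𝓕 (cutoff 1 one_pos)) e.f x)).trans ?_
        exact add_le_add h1 (h2.trans hIq)
      calc ‖e.low j x‖ ≤ C * A ^ κ * ‖e.h‖ + K₁ := this
        _ ≤ C * A ^ κ * K ^ (2 : ℝ)⁻¹ + K₁ * A ^ κ := by
            gcongr
            exact le_mul_of_one_le_right hK₁0.le hAκ
        _ = _ := by
            rw [hK₂]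
            ring
    have h5 : K₂ * A ^ κ ≤ B * A ^ β := by
      have : A ^ β = A ^ t * A ^ κ := by rw [← Real.rpow_add hA0, ht, sub_add_cancel]
      rw [this, ← mul_assoc]
      gcongr
      rw [div_le_iff₀ hB0] at hAt
      linarith
    linarith
  refine ⟨j, ⟨hja, hjb⟩, x, le_trans ?_ hjx.le⟩
  gcongr
  exact zpow_le_zpow_right₀ one_le_two hja

/-! ### Weak compactness and almost everywhere convergence -/

instance : Fact ((2 : ℝ≥0∞) ≠ ⊤) := ⟨by norm_num⟩

/-- Bounded sequences in a separable Hilbert space have weakly convergent subsequences. -/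
theorem exists_weak_subseq {H : Type*} [NormedAddCommGroup H] [InnerProductSpace ℂ H]
    [CompleteSpace H] [TopologicalSpace.SeparableSpace H] {h : ℕ → H} {K : ℝ}
    (hK : ∀ n, ‖h n‖ ≤ K) :
    ∃ (k : ℕ → ℕ) (h' : H), StrictMono k ∧
      ∀ w, Tendsto (fun n => inner ℂ w (h (k n))) atTop (𝓝 (inner ℂ w h')) := by
  have hs := WeakDual.isSeqCompact_closedBall ℂ H 0 K
  obtain ⟨T, -, k, hk, hT⟩ := @hs
    (fun n => StrongDual.toWeakDual (InnerProductSpace.toDual ℂ H (h n))) fun n => by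
      rw [Set.mem_preimage, mem_closedBall_zero_iff]
      change ‖InnerProductSpace.toDual ℂ H (h n)‖ ≤ K
      rw [LinearIsometryEquiv.norm_map]
      exact hK n
  refine ⟨k, (InnerProductSpace.toDual ℂ H).symm (WeakDual.toStrongDual T), hk, fun w => ?_⟩
  have h1 := ((WeakDual.eval_continuous w).tendsto T).comp hT
  have h2 : Tendsto (fun n => inner ℂ (h (k n)) w) atTop
      (𝓝 (inner ℂ ((InnerProductSpace.toDual ℂ H).symm (WeakDual.toStrongDual T)) w)) := by
    rw [InnerProductSpace.toDual_symm_apply]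
    exact h1
  have h3 := (Complex.continuous_conj.tendsto _).comp h2
  simpa only [Function.comp_def, inner_conj_symm] using h3

/-- The `L²` function dual to a test function in the representation of `Ḣ²`. -/
noncomputable def testL2 (φ : S0 d) : Lp ℂ 2 (volume : Measure (E d)) :=
  (memLp_symb_neg_two φ).star.toLp

theorem ofL2_eq_inner (h : Lp ℂ 2 (volume : Measure (E d))) (φ : S0 d) :
    ofL2 h φ = inner ℂ (testL2 φ) h := by
  rw [ofL2_apply, L2.inner_def]
  refine integral_congr_ae ?_
  filter_upwards [(memLp_symb_neg_two φ).star.coeFn_toLp] with ξ hξ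
  rw [testL2, hξ, RCLike.inner_apply, Pi.star_apply, RCLike.star_def, starRingEnd_self_apply]

theorem Elt.u_eq_ofL2 {α : ℝ} (hd : 1 ≤ d) (e : Elt d α) : e.u = ofL2 e.h :=
  e.hg.eq_ofL2 hd

theorem eLpNorm_toReal_le {q K : ℝ} (hq : 0 < q) {f : E d → ℂ}
    (hf : MemLp f (ENNReal.ofReal q) volume) (hK : ∫ x, ‖f x‖ ^ q ≤ K) :
    (eLpNorm f (ENNReal.ofReal q) volume).toReal ≤ K ^ q⁻¹ := by
  have h0 : 0 ≤ ∫ x, ‖f x‖ ^ q := integral_nonneg fun x => by positivity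
  rw [Elt.eLpNorm_toReal_eq hq hf, ENNReal.toReal_ofReal (Real.rpow_nonneg h0 _)]
  exact Real.rpow_le_rpow h0 hK (by positivity)

/-- Convergence on `𝒮₀` improves to convergence on all Schwartz functions for sequences bounded
in `L^q`. -/
theorem cauchySeq_schwartz_of_S0 (hd : 1 ≤ d) {q K : ℝ} (hq : 1 < q) {F : ℕ → E d → ℂ}
    (hF : ∀ n, MemLp (F n) (ENNReal.ofReal q) volume) (hK : ∀ n, ∫ x, ‖F n x‖ ^ q ≤ K)
    (h : ∀ φ : S0 d, CauchySeq fun n => ∫ x, F n x * (φ : 𝓢(E d, ℂ)) x) (φ : 𝓢(E d, ℂ)) :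
    CauchySeq fun n => ∫ x, F n x * φ x := by
  have hq0 : 0 < q := by linarith
  have hd0 : (0 : ℝ) < d := by exact_mod_cast hd
  have hK0 : 0 ≤ K := (integral_nonneg fun x => by positivity).trans (hK 0)
  have hkn : 0 ≤ kerNorm d q := kerNorm_nonneg q
  set B : ℝ := K ^ q⁻¹ * kerNorm d q * ∫ x, ‖φ x‖ with hB
  have hφ0 : 0 ≤ ∫ x, ‖φ x‖ := integral_nonneg fun x => norm_nonneg _
  have hB0 : 0 ≤ B := by positivity
  -- By Bernstein the frequencies below t contribute at most B t^{d/q}, uniformly in n. The rest of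
  -- φ is a test function in 𝒮₀, for which the Cauchy property is given.
  have key : ∀ t (ht : 0 < t) n, ‖∫ x, F n x * conv (𝓕 (cutoff t ht)) φ x‖ ≤ B * t ^ (d / q : ℝ) := by
    intro t ht n
    rw [← integral_smooth_mul hq (hF n)]
    refine (norm_integral_le_integral_norm _).trans ?_
    calc ∫ x, ‖smooth (𝓕 (cutoff t ht)) (F n) x * φ x‖
        ≤ ∫ x, K ^ q⁻¹ * (t ^ (d / q : ℝ) * kerNorm d q) * ‖φ x‖ := by
          refine integral_mono_of_nonneg (Eventually.of_forall fun x => norm_nonneg _)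
            (φ.integrable.norm.const_mul _) (Eventually.of_forall fun x => ?_)
          simp only
          rw [norm_mul]
          gcongr
          refine (norm_smooth_cutoff_le hq (hF n) ht x).trans ?_
          gcongr
          exact eLpNorm_toReal_le hq0 (hF n) (hK n)
      _ = B * t ^ (d / q : ℝ) := by
          rw [integral_const_mul, hB]
          ring
  rw [Metric.cauchySeq_iff]
  intro ε hε
  have hlim : Tendsto (fun t : ℝ => B * t ^ (d / q : ℝ)) (𝓝[>] 0) (𝓝 0) := by
    have h1 : ContinuousAt (fun t : ℝ => B * t ^ (d / q : ℝ)) 0 :=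
      continuousAt_const.mul (Real.continuousAt_rpow_const _ _ (Or.inr (by positivity)))
    have h2 := h1.tendsto.mono_left (nhdsWithin_le_nhds (s := Set.Ioi 0))
    rwa [Real.zero_rpow (by positivity), mul_zero] at h2
  obtain ⟨t, htB, ht⟩ := ((hlim.eventually_lt_const (by positivity : 0 < ε / 3)).and
    self_mem_nhdsWithin).exists
  have ht : 0 < t := ht
  obtain ⟨N, hN⟩ := Metric.cauchySeq_iff.1
    (h ⟨φ - conv (𝓕 (cutoff t ht)) φ, sub_conv_mem_S0 (cutoff_eventually ht) φ⟩) (ε / 3)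
    (by positivity)
  refine ⟨N, fun m hm n hn => ?_⟩
  have hsplit : ∀ n, ∫ x, F n x * φ x = (∫ x, F n x * (φ - conv (𝓕 (cutoff t ht)) φ) x)
      + ∫ x, F n x * conv (𝓕 (cutoff t ht)) φ x := by
    intro n
    rw [← integral_add (integrable_mul_schwartz hq (hF n) _) (integrable_mul_schwartz hq (hF n) _)]
    congr 1
    ext x
    rw [sub_apply]
    ring
  rw [hsplit m, hsplit n, dist_eq_norm]
  have h1 := hN m hm n hn
  rw [dist_eq_norm] at h1
  have h2 := key t ht m
  have h3 := key t ht n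
  set a := ∫ x, F m x * (φ - conv (𝓕 (cutoff t ht)) φ) x
  set b := ∫ x, F n x * (φ - conv (𝓕 (cutoff t ht)) φ) x
  set a' := ∫ x, F m x * conv (𝓕 (cutoff t ht)) φ x
  set b' := ∫ x, F n x * conv (𝓕 (cutoff t ht)) φ x
  calc ‖a + a' - (b + b')‖ = ‖(a - b) + (a' - b')‖ := by congr 1; ring
    _ ≤ ‖a - b‖ + (‖a'‖ + ‖b'‖) := (norm_add_le _ _).trans (add_le_add le_rfl (norm_sub_le _ _))
    _ < ε := by
        have : ‖a - b‖ < ε / 3 := h1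
        linarith

/-- An integrable, square integrable and bounded weight. -/
noncomputable def weight (x : E d) : ℝ := (1 + ‖x‖) ^ (-((d : ℝ) + 1))

theorem weight_pos (x : E d) : 0 < weight x := by
  unfold weight
  positivity

theorem integrable_weight : Integrable (weight (d := d)) :=
  integrable_one_add_norm (by
    rw [finrank_euclideanSpace_fin]
    linarith)

theorem memLp_weight : MemLp (fun x : E d => (weight x : ℂ)) 2 volume := by
  have : MemLp (weight (d := d)) 2 volume := memLp_one_add_norm (by
    have : (0 : ℝ) ≤ d := Nat.cast_nonneg d
    linarith)
  exact this.ofReal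

theorem integrable_weight_mul_of_bound {f : E d → ℂ} (hf : AEStronglyMeasurable f volume) {B : ℝ}
    (hB : ∀ᵐ x, ‖f x‖ ≤ B) : Integrable fun x => (weight x : ℂ) * f x := by
  refine (integrable_weight.mul_const B).mono'
    (integrable_weight.ofReal (𝕜 := ℂ).1.mul hf) ?_
  filter_upwards [hB] with x hx
  rw [norm_mul, Complex.norm_real, Real.norm_of_nonneg (weight_pos x).le]
  exact mul_le_mul_of_nonneg_left hx (weight_pos x).le

/-- The centre may depend on ε. In `Elt.cauchySeq_weight` it is the limit of the low-frequency parts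
at a cutoff that depends on ε. -/
theorem cauchySeq_of_forall_exists {X : Type*} [PseudoMetricSpace X] {F : ℕ → X}
    (h : ∀ ε : ℝ, 0 < ε → ∃ c, ∀ᶠ n in atTop, dist (F n) c < ε) : CauchySeq F := by
  rw [Metric.cauchySeq_iff]
  intro ε hε
  obtain ⟨c, hc⟩ := h (ε / 2) (by positivity)
  obtain ⟨N, hN⟩ := eventually_atTop.1 hc
  refine ⟨N, fun m hm n hn => (dist_triangle_right _ _ c).trans_lt ?_⟩
  linarith [hN m hm, hN n hn]

namespace Elt

variable {α : ℝ}

theorem integrable_weight_high (hd : 1 ≤ d) (e : Elt d α) {A : ℝ} (hA : 0 < A) :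
    Integrable fun x => (weight x : ℂ) * high hd hA e.hg.2 x :=
  integrable_mul_memLp memLp_weight (Lp.memLp _)

theorem eLpNorm_weight_high_le (hd : 1 ≤ d) (e : Elt d α) {A : ℝ} (hA : 0 < A) :
    eLpNorm (fun x => (weight x : ℂ) * high hd hA e.hg.2 x) 1 volume
      ≤ eLpNorm (fun x : E d => (weight x : ℂ)) 2 volume
        * (ENNReal.ofReal (A⁻¹ ^ 2) * ENNReal.ofReal ‖e.h‖) := by
  have h1 := eLpNorm_smul_le_mul_eLpNorm (p := 2) (q := 2) (r := 1)
    (Lp.memLp (high hd hA e.hg.2)).1 (memLp_weight (d := d)).1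
  refine h1.trans ?_
  gcongr
  rw [← e.eLpNorm_symb]
  exact eLpNorm_high_le hd e.hg.2 hA

theorem ae_split (ha : Adm d α) (e : Elt d α) {A : ℝ} (hA : 0 < A) :
    ∀ᵐ x, e.f x = smooth (𝓕 (cutoff A hA)) e.f x + high ha.one_le hA e.hg.2 x :=
  ae_eq_smooth_add_high ha.one_le ha.one_lt_alphaC e.hf.2 e.hg.2 e.hfg hA

theorem integrable_weight_f (ha : Adm d α) (e : Elt d α) :
    Integrable fun x => (weight x : ℂ) * e.f x := by
  have h1 := integrable_weight_mul_of_bound (aestronglyMeasurable_smooth e.hf.2.1 (𝓕 (cutoff 1 one_pos)))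
    (Eventually.of_forall fun x => norm_smooth_cutoff_le ha.one_lt_alphaC e.hf.2 one_pos x)
  refine (h1.add (e.integrable_weight_high ha.one_le one_pos)).congr ?_
  filter_upwards [e.ae_split ha one_pos] with x hx
  simp only [Pi.add_apply]
  rw [← mul_add, ← hx]

/-- Local strong compactness: distributional convergence of a bounded sequence gives convergence
in a weighted `L¹` space. -/
theorem cauchySeq_weight (ha : Adm d α) {e : ℕ → Elt d α} {K : ℝ}
    (hI : ∀ n, (e n).I (alphaC d α) ≤ K) (hD : ∀ n, (e n).D ≤ K)
    (hu : ∀ φ, CauchySeq fun n => (e n).u φ) :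
    CauchySeq fun n => (memLp_one_iff_integrable.2 ((e n).integrable_weight_f ha)).toLp := by
  have hq := ha.one_lt_alphaC
  have hq0 : 0 < alphaC d α := by linarith
  have hK0 : 0 ≤ K := ((e 0).I_nonneg _).trans (hI 0)
  have hS := cauchySeq_schwartz_of_S0 ha.one_le hq (F := fun n => (e n).f) (fun n => (e n).hf.2) hI
    (fun φ => by simpa only [(e _).hf.1 φ] using hu φ)
  refine cauchySeq_of_forall_exists fun ε hε => ?_
  set w := (eLpNorm (fun x : E d => (weight x : ℂ)) 2 volume).toReal with hw
  have hw0 : 0 ≤ w := ENNReal.toReal_nonneg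
  -- Above frequency A the L² norm is at most A^{-2}‖h‖, so the high parts are uniformly small in
  -- weighted L¹ once A is large.
  obtain ⟨A, hA, hAε⟩ : ∃ A : ℝ, 0 < A ∧ w * (A⁻¹ ^ 2 * (K + 1)) < ε / 2 := by
    have h1 : Tendsto (fun A : ℝ => w * (A⁻¹ ^ 2 * (K + 1))) atTop (𝓝 (w * (0 ^ 2 * (K + 1)))) :=
      ((tendsto_inv_atTop_zero.pow 2).mul_const _).const_mul _
    have h2 := h1.eventually_lt_const (u := ε / 2) (by simpa using hε)
    obtain ⟨A, h3, h4⟩ := (h2.and (eventually_gt_atTop 0)).exists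
    exact ⟨A, h4, h3⟩
  set κ : 𝓢(E d, ℂ) := 𝓕 (cutoff A hA) with hκ
  -- At a fixed cutoff the smoothing at x is a pairing with a translate of one Schwartz kernel, so
  -- the low parts converge at every point. They are uniformly bounded, and dominated convergence
  -- with the integrable weight applies.
  choose l hl using fun x => cauchySeq_tendsto_of_complete (hS (κ.compSubConstCLM ℂ x))
  have hl : ∀ x, Tendsto (fun n => smooth κ (e n).f x) atTop (𝓝 (l x)) := hl
  set B := K ^ (alphaC d α)⁻¹ * (A ^ (d / alphaC d α : ℝ) * kerNorm d (alphaC d α))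
  have hbound : ∀ n x, ‖smooth κ (e n).f x‖ ≤ B := by
    intro n x
    refine (norm_smooth_cutoff_le hq (e n).hf.2 hA x).trans ?_
    have := kerNorm_nonneg (d := d) (alphaC d α)
    refine mul_le_mul_of_nonneg_right (eLpNorm_toReal_le hq0 (e n).hf.2 (hI n)) (by positivity)
  have hsm : ∀ n, AEStronglyMeasurable (smooth κ (e n).f) volume :=
    fun n => aestronglyMeasurable_smooth (e n).hf.2.1 κ
  have hlm : AEStronglyMeasurable l volume :=
    aestronglyMeasurable_of_tendsto_ae atTop hsm (Eventually.of_forall hl)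
  have hlB : ∀ x, ‖l x‖ ≤ B := fun x =>
    le_of_tendsto (hl x).norm (Eventually.of_forall fun n => hbound n x)
  have hli := integrable_weight_mul_of_bound hlm (Eventually.of_forall hlB)
  refine ⟨(memLp_one_iff_integrable.2 hli).toLp, ?_⟩
  have hlow : Tendsto (fun n => ∫ x, ‖(weight x : ℂ) * (smooth κ (e n).f x - l x)‖) atTop (𝓝 0) := by
    have h0 : (0 : ℝ) = ∫ x : E d, (0 : ℝ) := by simp
    rw [h0]
    refine tendsto_integral_of_dominated_convergence (fun x => weight x * (B + B))
      (fun n => ((integrable_weight.ofReal (𝕜 := ℂ)).1.mul ((hsm n).sub hlm)).norm)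
      (integrable_weight.mul_const _) (fun n => Eventually.of_forall fun x => ?_)
      (Eventually.of_forall fun x => ?_)
    · rw [norm_norm, norm_mul, Complex.norm_real, Real.norm_of_nonneg (weight_pos x).le]
      refine mul_le_mul_of_nonneg_left ?_ (weight_pos x).le
      exact (norm_sub_le _ _).trans (add_le_add (hbound n x) (hlB x))
    · have := (((hl x).sub_const (l x)).const_mul (weight x : ℂ)).norm
      simpa using this
  filter_upwards [hlow.eventually_lt_const (by positivity : 0 < ε / 2)] with n hn
  rw [Lp.dist_edist, Lp.edist_toLp_toLp]
  have hint : Integrable fun x => (weight x : ℂ) * (smooth κ (e n).f x - l x) :=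
    integrable_weight_mul_of_bound ((hsm n).sub hlm)
      (Eventually.of_forall fun x => (norm_sub_le _ _).trans (add_le_add (hbound n x) (hlB x)))
  have hfin : (fun x => (weight x : ℂ) * (e n).f x) - (fun x => (weight x : ℂ) * l x)
      =ᵐ[volume] (fun x => (weight x : ℂ) * (smooth κ (e n).f x - l x))
        + fun x => (weight x : ℂ) * high ha.one_le hA (e n).hg.2 x := by
    filter_upwards [(e n).ae_split ha hA] with x hx
    simp only [Pi.sub_apply, Pi.add_apply]
    nth_rewrite 1 [hx]
    ring
  rw [eLpNorm_congr_ae hfin]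
  have h1 := eLpNorm_add_le (p := 1) hint.1 ((e n).integrable_weight_high ha.one_le hA).1 le_rfl
  have h2 := (e n).eLpNorm_weight_high_le ha.one_le hA
  have h3 : eLpNorm (fun x => (weight x : ℂ) * (smooth κ (e n).f x - l x)) 1 volume
      < ENNReal.ofReal (ε / 2) := by
    rw [eLpNorm_one_eq_lintegral_enorm, ← ofReal_integral_norm_eq_lintegral_enorm hint]
    exact (ENNReal.ofReal_lt_ofReal_iff (by positivity)).2 hn
  have hh : ‖(e n).h‖ ≤ K + 1 := by
    have := hD n
    rw [D] at this
    nlinarith [norm_nonneg (e n).h, sq_nonneg (‖(e n).h‖ - 1)]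
  have h4 : eLpNorm (fun x : E d => (weight x : ℂ)) 2 volume
        * (ENNReal.ofReal (A⁻¹ ^ 2) * ENNReal.ofReal ‖(e n).h‖) ≤ ENNReal.ofReal (ε / 2) := by
    rw [← ENNReal.ofReal_toReal (memLp_weight (d := d)).2.ne, ← hw,
      ← ENNReal.ofReal_mul (by positivity), ← ENNReal.ofReal_mul hw0]
    refine ENNReal.ofReal_le_ofReal (le_trans ?_ hAε.le)
    gcongr
  have h5 : eLpNorm ((fun x => (weight x : ℂ) * (smooth κ (e n).f x - l x))
        + fun x => (weight x : ℂ) * high ha.one_le hA (e n).hg.2 x) 1 volume < ENNReal.ofReal ε := by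
    rw [← add_halves ε, ENNReal.ofReal_add (by positivity) (by positivity)]
    exact h1.trans_lt (ENNReal.add_lt_add_of_lt_of_le
      ((h2.trans h4).trans_lt ENNReal.ofReal_lt_top).ne h3 (h2.trans h4))
  have := ENNReal.toReal_lt_of_lt_ofReal h5
  exact this

/-- Bounded sequences in `L^{α_c} ∩ Ḣ²` have subsequences converging weakly and almost
everywhere. -/
theorem exists_subseq (ha : Adm d α) {e : ℕ → Elt d α} {K : ℝ}
    (hI : ∀ n, (e n).I (alphaC d α) ≤ K) (hD : ∀ n, (e n).D ≤ K) :
    ∃ (k : ℕ → ℕ) (V : Elt d α), StrictMono k ∧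
      (∀ φ, Tendsto (fun n => (e (k n)).u φ) atTop (𝓝 (V.u φ))) ∧
      (∀ w, Tendsto (fun n => inner ℂ w (e (k n)).h) atTop (𝓝 (inner ℂ w V.h))) ∧
      ∀ᵐ x, Tendsto (fun n => (e (k n)).f x) atTop (𝓝 (V.f x)) := by
  have hq := ha.one_lt_alphaC
  have hq0 : 0 < alphaC d α := by linarith
  have hh : ∀ n, ‖(e n).h‖ ≤ K + 1 := by
    intro n
    have := hD n
    rw [D] at this
    nlinarith [norm_nonneg (e n).h, sq_nonneg (‖(e n).h‖ - 1)]
  obtain ⟨k, H, hk, hH⟩ := exists_weak_subseq hh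
  have hu : ∀ φ, Tendsto (fun n => (e (k n)).u φ) atTop (𝓝 (ofL2 H φ)) := by
    intro φ
    simp only [u_eq_ofL2 ha.one_le, ofL2_eq_inner]
    exact hH _
  have hC := cauchySeq_weight ha (e := fun n => e (k n)) (fun n => hI _) (fun n => hD _)
    fun φ => (hu φ).cauchySeq
  obtain ⟨F, hF⟩ := cauchySeq_tendsto_of_complete hC
  obtain ⟨j, hj, hlim⟩ := (tendstoInMeasure_of_tendsto_Lp hF).exists_seq_tendsto_ae
  set f : E d → ℂ := fun x => (weight x : ℂ)⁻¹ * F x with hf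
  have hlim' : ∀ᵐ x, Tendsto (fun n => (e (k (j n))).f x) atTop (𝓝 (f x)) := by
    have hall := ae_all_iff.2 fun n =>
      (memLp_one_iff_integrable.2 ((e (k n)).integrable_weight_f ha)).coeFn_toLp
    filter_upwards [hlim, hall] with x h1 h2
    have h3 := h1.const_mul (weight x : ℂ)⁻¹
    refine h3.congr fun n => ?_
    rw [h2, inv_mul_cancel_left₀ (by exact_mod_cast (weight_pos x).ne')]
  have hfm : MemLp f (ENNReal.ofReal (alphaC d α)) volume := by
    refine ⟨aestronglyMeasurable_of_tendsto_ae atTop (fun n => (e (k (j n))).hf.2.1) hlim', ?_⟩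
    refine (Lp.eLpNorm_lim_le_liminf_eLpNorm (fun n => (e (k (j n))).hf.2.1) f hlim').trans_lt ?_
    refine lt_of_le_of_lt (liminf_le_of_le (by isBoundedDefault) fun b hb => ?_)
      (ENNReal.ofReal_lt_top (r := K ^ (alphaC d α)⁻¹))
    obtain ⟨n, hn⟩ := hb.exists
    refine hn.trans ?_
    rw [← ENNReal.ofReal_toReal (e (k (j n))).hf.2.2.ne]
    exact ENNReal.ofReal_le_ofReal (eLpNorm_toReal_le hq0 (e (k (j n))).hf.2 (hI _))
  -- The weak limit `H` in frequency and the almost everywhere limit f in space belong to the same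
  -- distribution: on each test function both are the limit of the same numbers.
  have hfun : IsFunction (ofL2 H) f := by
    intro φ
    have h1 := tendsto_integral_mul_of_ae hq (fun n => (e (k (j n))).hf.2) hfm (fun n => hI _) hlim' φ
    simp only [← (e (k (j _))).hf.1 φ] at h1
    exact tendsto_nhds_unique ((hu φ).comp hj.tendsto_atTop) h1
  set V : Elt d α := ⟨ofL2 H, f, fun ξ => symb (-2) ξ * H ξ, ⟨hfun, hfm⟩,
    ofL2_isHdotFourier ha.one_le H⟩ with hV
  have hVh : V.h = H := by
    refine Lp.ext ?_
    filter_upwards [V.h_ae, ae_ne_zero ha.one_le] with ξ h1 h2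
    rw [h1, hV, ← mul_assoc, symb_mul_neg _ h2, one_mul]
  refine ⟨k ∘ j, V, hk.comp hj, fun φ => (hu φ).comp hj.tendsto_atTop, fun w => ?_, hlim'⟩
  rw [hVh]
  exact (hH w).comp hj.tendsto_atTop

end Elt

/-! ### Profiles and their extraction -/

theorem translate_translate (u : S0Dual d) (a b : E d) :
    translate (translate u a) b = translate u (a + b) := by
  ext φ
  simp only [translate_apply]
  congr 1
  ext x
  simp only [shiftS0_coe, SchwartzMap.compSubConstCLM_apply]
  congr 1
  abel

theorem translate_sub (u v : S0Dual d) (a : E d) :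
    translate (u - v) a = translate u a - translate v a := rfl

theorem tendsto_eLpNorm_two_zero {F : ℕ → E d → ℂ} {G : E d → ℂ}
    (hF : ∀ n, AEStronglyMeasurable (F n) volume) (hG : MemLp G 2 volume)
    (hle : ∀ n, ∀ᵐ x, ‖F n x‖ ≤ ‖G x‖) (hlim : ∀ᵐ x, Tendsto (fun n => F n x) atTop (𝓝 0)) :
    Tendsto (fun n => eLpNorm (F n) 2 volume) atTop (𝓝 0) := by
  have h1 : Tendsto (fun n => ∫⁻ x, ‖F n x‖ₑ ^ 2) atTop (𝓝 (∫⁻ _ : E d, 0)) := by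
    refine tendsto_lintegral_of_dominated_convergence' (fun x => ‖G x‖ₑ ^ 2)
      (fun n => (hF n).enorm.pow_const 2) (fun n => ?_) ?_ ?_
    · filter_upwards [hle n] with x hx
      gcongr
      exact enorm_le_iff_norm_le.2 hx
    · rw [lintegral_enorm_sq_eq]
      exact ENNReal.pow_ne_top hG.2.ne
    · filter_upwards [hlim] with x hx
      have := (ENNReal.continuous_pow 2).tendsto _ |>.comp hx.enorm
      simpa [Function.comp_def] using this
  simp only [lintegral_zero, lintegral_enorm_sq_eq] at h1
  have h2 := (ENNReal.continuous_rpow_const (y := (2 : ℝ)⁻¹)).tendsto _ |>.comp h1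
  simp only [Function.comp_def, ← ENNReal.rpow_two, ← ENNReal.rpow_mul] at h2
  simpa using h2

/-- Translates of test functions depend continuously on the translation. -/
theorem tendsto_testL2_shift {z : ℕ → E d} {z₀ : E d} (hz : Tendsto z atTop (𝓝 z₀)) (φ : S0 d) :
    Tendsto (fun n => testL2 (shiftS0 (z n) φ)) atTop (𝓝 (testL2 (shiftS0 z₀ φ))) := by
  have hψ := memLp_symb_neg_two φ
  have hsh : ∀ a : E d, testL2 (shiftS0 a φ) =ᵐ[volume] fun ξ => star (modul a ξ
      * (symb (-2) ξ * (𝓕⁻ (φ : 𝓢(E d, ℂ)) : 𝓢(E d, ℂ)) ξ)) := by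
    intro a
    filter_upwards [(memLp_symb_neg_two (shiftS0 a φ)).star.coeFn_toLp] with ξ hξ
    rw [testL2, hξ, Pi.star_apply, shiftS0_coe, fourierInv_compSubConst, mul_left_comm]
  rw [Lp.tendsto_Lp_iff_tendsto_eLpNorm']
  refine tendsto_eLpNorm_two_zero (G := fun ξ => 2 * (symb (-2) ξ
    * (𝓕⁻ (φ : 𝓢(E d, ℂ)) : 𝓢(E d, ℂ)) ξ)) (fun n => (Lp.memLp _).1.sub (Lp.memLp _).1)
    (hψ.const_mul 2) (fun n => ?_) ?_
  · filter_upwards [hsh (z n), hsh z₀] with ξ h1 h2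
    rw [Pi.sub_apply, h1, h2, ← star_sub, norm_star, ← sub_mul, norm_mul, norm_mul (2 : ℂ)]
    gcongr
    refine (norm_sub_le _ _).trans ?_
    rw [norm_modul, norm_modul]
    norm_num
  · have hall := ae_all_iff.2 fun n => hsh (z n)
    filter_upwards [hall, hsh z₀] with ξ h1 h2
    have hm : Tendsto (fun n => modul (z n) ξ) atTop (𝓝 (modul z₀ ξ)) := by
      have : Continuous fun a : E d => modul a ξ := by
        unfold modul
        fun_prop
      exact (this.tendsto _).comp hz
    have h3 := ((hm.mul_const (symb (-2) ξ * (𝓕⁻ (φ : 𝓢(E d, ℂ)) : 𝓢(E d, ℂ)) ξ)).star).sub_const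
      (star (modul z₀ ξ * (symb (-2) ξ * (𝓕⁻ (φ : 𝓢(E d, ℂ)) : 𝓢(E d, ℂ)) ξ)))
    rw [sub_self] at h3
    refine h3.congr fun n => ?_
    rw [Pi.sub_apply, h1, h2]

namespace Elt

variable {α : ℝ}

/-- Translates of a fixed element going to infinity converge to zero. -/
theorem tendsto_translate_cocompact (V : Elt d α) {z : ℕ → E d}
    (hz : Tendsto z atTop (cocompact (E d))) (φ : S0 d) :
    Tendsto (fun n => (V.translate (z n)).u φ) atTop (𝓝 0) := by
  -- A translation is a modulation in frequency, so this is the Riemann–Lebesgue lemma.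
  have h1 := tendsto_integral_exp_inner_smul_cocompact (V := E d)
    fun ξ => V.g ξ * (𝓕⁻ (φ : 𝓢(E d, ℂ)) : 𝓢(E d, ℂ)) ξ
  have h2 : Tendsto (fun n => -z n) atTop (cocompact (E d)) :=
    (Homeomorph.neg (E d)).isClosedEmbedding.tendsto_cocompact.comp hz
  refine (h1.comp h2).congr fun n => ?_
  rw [(V.translate (z n)).hg.1 φ]
  refine integral_congr_ae (Eventually.of_forall fun ξ => ?_)
  simp only [translate, inner_neg_right, neg_neg, Circle.smul_def, smul_eq_mul, modul,
    Real.fourierChar_apply]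
  rw [real_inner_comm ξ (z n), mul_assoc, mul_assoc]

/-- Convergence as functionals on `𝒮₀`. -/
def Conv (w : ℕ → Elt d α) (V : Elt d α) : Prop :=
  ∀ φ, Tendsto (fun n => (w n).u φ) atTop (𝓝 (V.u φ))

theorem Conv.u_eq {w : ℕ → Elt d α} {V W : Elt d α} (h : Conv w V) (h' : Conv w W) : V.u = W.u :=
  ContinuousLinearMap.ext fun φ => tendsto_nhds_unique (h φ) (h' φ)

theorem Conv.comp {w : ℕ → Elt d α} {V : Elt d α} (h : Conv w V) {k : ℕ → ℕ}
    (hk : StrictMono k) : Conv (fun n => w (k n)) V :=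
  fun φ => (h φ).comp hk.tendsto_atTop

/-- The translation is moved onto the test function, whose dual L² representative converges in norm;
the sequence is bounded in Ḣ², so replacing z n by its limit costs nothing. -/
theorem Conv.translate (hd : 1 ≤ d) {w : ℕ → Elt d α} {V : Elt d α} (h : Conv w V) {K : ℝ}
    (hK : ∀ n, ‖(w n).h‖ ≤ K) {z : ℕ → E d} {z₀ : E d} (hz : Tendsto z atTop (𝓝 z₀)) :
    Conv (fun n => (w n).translate (z n)) (V.translate z₀) := by
  intro φ
  have h1 : Tendsto (fun n => (w n).u (shiftS0 z₀ φ)) atTop (𝓝 (V.u (shiftS0 z₀ φ))) := h _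
  have h2 : Tendsto (fun n => (w n).u (shiftS0 (z n) φ) - (w n).u (shiftS0 z₀ φ)) atTop (𝓝 0) := by
    have h3 := (tendsto_iff_norm_sub_tendsto_zero.1 (tendsto_testL2_shift hz φ)).mul_const K
    rw [zero_mul] at h3
    refine squeeze_zero_norm (fun n => ?_) h3
    rw [u_eq_ofL2 hd, ofL2_eq_inner, ofL2_eq_inner, ← inner_sub_left]
    exact (norm_inner_le_norm _ _).trans (mul_le_mul_of_nonneg_left (hK n) (norm_nonneg _))
  have h4 := h2.add h1
  simp only [sub_add_cancel, zero_add] at h4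
  exact h4

/-- `V` is a limit of translates of a subsequence of `e`. -/
def IsProfile (e : ℕ → Elt d α) (V : Elt d α) : Prop :=
  ∃ (k : ℕ → ℕ) (x : ℕ → E d), StrictMono k ∧ Conv (fun n => (e (k n)).translate (x n)) V

theorem IsProfile.of_translate {e : ℕ → Elt d α} {k : ℕ → ℕ} (hk : StrictMono k) {x : ℕ → E d}
    {V : Elt d α} (h : IsProfile (fun n => (e (k n)).translate (x n)) V) : IsProfile e V := by
  obtain ⟨j, y, hj, hV⟩ := h
  refine ⟨k ∘ j, fun n => x (j n) + y n, hk.comp hj, fun φ => ?_⟩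
  refine (hV φ).congr fun n => ?_
  simp only [Elt.translate, translate_translate, Function.comp]

theorem IsProfile.of_subseq {e : ℕ → Elt d α} {k : ℕ → ℕ} (hk : StrictMono k)
    {V : Elt d α} (h : IsProfile (fun n => e (k n)) V) : IsProfile e V := by
  obtain ⟨j, y, hj, hV⟩ := h
  exact ⟨k ∘ j, y, hk.comp hj, hV⟩

/-- Removing a limit creates no new nonzero profiles. -/
theorem IsProfile.of_sub (ha : Adm d α) {w : ℕ → Elt d α} {V : Elt d α} (h : Conv w V) {K : ℝ}
    (hK : ∀ n, ‖(w n).h‖ ≤ K) {W : Elt d α} (hW : IsProfile (fun n => (w n).sub ha V) W) :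
    W.u = 0 ∨ IsProfile w W := by
  obtain ⟨j, z, hj, hW⟩ := hW
  -- If the shifts escape to infinity, the shifted V tends weakly to 0 and W is a profile of w
  -- itself. Otherwise a subsequence of the shifts converges to some z₀, and both w and V, so
  -- shifted, tend to V(· + z₀), which forces W = 0.
  by_cases hz : Tendsto z atTop (cocompact (E d))
  · right
    refine ⟨j, z, hj, fun φ => ?_⟩
    have h1 := (hW φ).add (V.tendsto_translate_cocompact hz φ)
    rw [add_zero] at h1
    refine h1.congr fun n => ?_
    change (NL4S.translate ((w (j n)).u - V.u) (z n)) φ + NL4S.translate V.u (z n) φ = _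
    rw [translate_sub, sub_apply, sub_add_cancel]
    rfl
  · left
    rw [hasBasis_cocompact.tendsto_right_iff] at hz
    push Not at hz
    obtain ⟨s, hs, hfreq⟩ := hz
    obtain ⟨z₀, -, i, hi, hlim⟩ := hs.tendsto_subseq' (x := z) (by
      simpa only [Set.mem_compl_iff, not_not] using hfreq)
    have h1 := ((h.comp hj).comp hi).translate ha.one_le (fun n => hK _) hlim
    have h2 : Conv (fun _ : ℕ => V) V := fun φ => tendsto_const_nhds
    have h3 := h2.translate ha.one_le (fun n => le_refl ‖V.h‖) hlim
    ext φ
    refine tendsto_nhds_unique ((hW.comp hi) φ) ?_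
    have h4 := (h1 φ).sub (h3 φ)
    rw [sub_self] at h4
    exact h4

theorem I_eq_zero_of_u (ha : Adm d α) {e : Elt d α} (h : e.u = 0) {r : ℝ} (hr : 0 < r) :
    e.I r = 0 := by
  rw [I, integral_eq_zero_of_ae]
  filter_upwards [f_ae_zero_of_u ha h] with x hx
  rw [hx, Pi.zero_apply, norm_zero, Real.zero_rpow hr.ne']
  rfl

theorem norm_h_le {e : Elt d α} {K : ℝ} (h : e.D ≤ K) : ‖e.h‖ ≤ K + 1 := by
  rw [D] at h
  nlinarith [norm_nonneg e.h, sq_nonneg (‖e.h‖ - 1)]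

/-- The asymptotic splitting of the norms along a convergent sequence. -/
theorem tendsto_sub (ha : Adm d α) {w : ℕ → Elt d α} {V : Elt d α} {K : ℝ}
    (hI : ∀ n, (w n).I (alphaC d α) ≤ K) (hD : ∀ n, (w n).D ≤ K)
    (hh : ∀ v, Tendsto (fun n => inner ℂ v (w n).h) atTop (𝓝 (inner ℂ v V.h)))
    (hf : ∀ᵐ x, Tendsto (fun n => (w n).f x) atTop (𝓝 (V.f x))) :
    Tendsto (fun n => (w n).I (alphaC d α) - ((w n).sub ha V).I (alphaC d α)) atTop
        (𝓝 (V.I (alphaC d α))) ∧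
      Tendsto (fun n => (w n).I (α + 2) - ((w n).sub ha V).I (α + 2)) atTop (𝓝 (V.I (α + 2))) ∧
      Tendsto (fun n => (w n).D - ((w n).sub ha V).D) atTop (𝓝 V.D) := by
  have hK0 : 0 ≤ K := ((w 0).I_nonneg _).trans (hI 0)
  have hq := ha.two_lt_alphaC
  have hap := ha.pos
  refine ⟨brezis_lieb ha.one_lt_alphaC.le (fun n => (w n).hf.2) V.hf.2 hI hf,
    brezis_lieb ha.one_lt.le (fun n => (w n).memLp_add_two ha) (V.memLp_add_two ha)
      (M := gnConst d α * K ^ (α / alphaC d α) * K) (fun n => ((w n).gn ha).trans ?_) hf, ?_⟩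
  · have := gnConst_nonneg (d := d) ha.pos
    have h1 := (w n).I_nonneg (alphaC d α)
    have h2 := (w n).D_nonneg
    gcongr
    · exact hI n
    · exact hD n
  · have h1 := (Complex.continuous_re.tendsto _).comp (hh V.h)
    have h2 := (h1.const_mul 2).sub_const V.D
    have h3 : 2 * (inner ℂ V.h V.h : ℂ).re - V.D = V.D := by
      have := inner_self_eq_norm_sq (𝕜 := ℂ) V.h
      have h4 : (inner ℂ V.h V.h : ℂ).re = ‖V.h‖ ^ 2 := this
      rw [h4, D]
      ring
    rw [h3] at h2
    refine h2.congr fun n => ?_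
    have h5 := @norm_sub_sq ℂ _ _ _ _ (w n).h V.h
    have h6 := inner_re_symm (𝕜 := ℂ) (w n).h V.h
    simp only [Function.comp]
    rw [D, D, D, h_sub, h5, h6]
    change _ = ‖(w n).h‖ ^ 2 - (‖(w n).h‖ ^ 2 - 2 * (inner ℂ V.h (w n).h : ℂ).re + ‖V.h‖ ^ 2)
    ring

/-- Lower semicontinuity read off from Brezis–Lieb: the I of the limit is the limit of I of the
translates minus a nonnegative quantity. -/
theorem IsProfile.I_le (ha : Adm d α) {e : ℕ → Elt d α} {V : Elt d α} (h : IsProfile e V)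
    {K M : ℝ} (hI : ∀ n, (e n).I (alphaC d α) ≤ K) (hD : ∀ n, (e n).D ≤ M) :
    V.I (alphaC d α) ≤ K := by
  obtain ⟨k, x, hk, hV⟩ := h
  obtain ⟨j, V', hj, hV', hh, hf⟩ := exists_subseq ha (e := fun n => (e (k n)).translate (x n))
    (K := max K M) (fun n => by simpa only [I_translate] using (hI _).trans (le_max_left _ _))
    (fun n => by simpa only [D_translate] using (hD _).trans (le_max_right _ _))
  have hu : V'.u = V.u := Conv.u_eq hV' (hV.comp hj)
  rw [← I_congr ha hu]
  have h1 := (tendsto_sub ha (K := max K M)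
    (fun n => by simpa only [I_translate] using (hI _).trans (le_max_left _ _))
    (fun n => by simpa only [D_translate] using (hD _).trans (le_max_right _ _)) hh hf).1
  refine le_of_tendsto h1 (Eventually.of_forall fun n => ?_)
  have h2 := (((e (k (j n))).translate (x (j n))).sub ha V').I_nonneg (alphaC d α)
  have h3 := hI (k (j n))
  rw [I_translate]
  linarith

/-- Extraction of one profile from a sequence that does not vanish in `L^{α+2}`. -/
theorem exists_profile (ha : Adm d α) {K ε : ℝ} (hK : 0 < K) (hε : 0 < ε) :
    ∃ δ : ℝ, 0 < δ ∧ ∀ (e : ℕ → Elt d α) (I₀ D₀ N₀ : ℝ),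
      Tendsto (fun n => (e n).I (alphaC d α)) atTop (𝓝 I₀) →
      Tendsto (fun n => (e n).D) atTop (𝓝 D₀) →
      Tendsto (fun n => (e n).I (α + 2)) atTop (𝓝 N₀) → I₀ < K → D₀ < K → ε < N₀ →
      ∃ (V : Elt d α) (e' : ℕ → Elt d α), IsProfile e V ∧ δ ≤ V.I (alphaC d α) ∧
        Tendsto (fun n => (e' n).I (alphaC d α)) atTop (𝓝 (I₀ - V.I (alphaC d α))) ∧
        Tendsto (fun n => (e' n).D) atTop (𝓝 (D₀ - V.D)) ∧
        Tendsto (fun n => (e' n).I (α + 2)) atTop (𝓝 (N₀ - V.I (α + 2))) ∧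
        ∀ W, IsProfile e' W → W.u = 0 ∨ IsProfile e W := by
  have hap := ha.pos
  have hq0 : 0 < alphaC d α := by linarith [ha.two_lt_alphaC]
  obtain ⟨a, b, c, hc, H⟩ := exists_low_ge ha hK hε
  have hker := kerNorm_nonneg (d := d) (alphaC d α)
  set B := ((2 : ℝ) ^ b) ^ (4 / α) * (kerNorm d (alphaC d α) + 1) with hB
  have hB0 : 0 < B := by positivity
  -- By Bernstein, B times the L^{α_c} norm bounds every low part of frequency at most 2^b; δ is the
  -- mass at which this bound reaches c. It depends on K and ε only.
  refine ⟨(c / B) ^ alphaC d α, by positivity, fun e I₀ D₀ N₀ hI hD hN hIK hDK hNε => ?_⟩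
  obtain ⟨n₀, hn₀⟩ := eventually_atTop.1 ((hI.eventually_le_const hIK).and
    ((hD.eventually_le_const hDK).and (hN.eventually_const_le hNε)))
  have hk₀ : StrictMono fun n => n + n₀ := fun m n h => by simpa using h
  choose j hj x hx using fun n => H (e (n + n₀)) (hn₀ _ (Nat.le_add_left _ _)).1
    (hn₀ _ (Nat.le_add_left _ _)).2.1 (hn₀ _ (Nat.le_add_left _ _)).2.2
  obtain ⟨k, V, hk, hV, hh, hf⟩ := exists_subseq ha
    (e := fun n => (e (n + n₀)).translate (x n)) (K := K)
    (fun n => by simpa only [I_translate] using (hn₀ _ (Nat.le_add_left _ _)).1)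
    (fun n => by simpa only [D_translate] using (hn₀ _ (Nat.le_add_left _ _)).2.1)
  set w : ℕ → Elt d α := fun n => (e (k n + n₀)).translate (x (k n)) with hw
  have hwI : ∀ n, (w n).I (alphaC d α) ≤ K :=
    fun n => by simpa only [hw, I_translate] using (hn₀ _ (Nat.le_add_left _ _)).1
  have hwD : ∀ n, (w n).D ≤ K :=
    fun n => by simpa only [hw, D_translate] using (hn₀ _ (Nat.le_add_left _ _)).2.1
  obtain ⟨t1, t2, t3⟩ := tendsto_sub ha hwI hwD hh hf
  have hkt : Tendsto (fun n => k n + n₀) atTop atTop := (hk₀.comp hk).tendsto_atTop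
  have s1 : Tendsto (fun n => (w n).I (alphaC d α)) atTop (𝓝 I₀) := by
    simpa only [hw, I_translate, Function.comp_def] using hI.comp hkt
  have s2 : Tendsto (fun n => (w n).I (α + 2)) atTop (𝓝 N₀) := by
    simpa only [hw, I_translate, Function.comp_def] using hN.comp hkt
  have s3 : Tendsto (fun n => (w n).D) atTop (𝓝 D₀) := by
    simpa only [hw, D_translate, Function.comp_def] using hD.comp hkt
  refine ⟨V, fun n => (w n).sub ha V, ⟨fun n => k n + n₀, fun n => x (k n), hk₀.comp hk, hV⟩,
    ?_, ?_, ?_, ?_, fun W hW => ?_⟩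
  -- If V had mass below δ, its parts at the finitely many frequencies in [a, b] would be below c at
  -- 0. Convergence against the Schwartz kernels passes this to w n for large n, whereas w n is
  -- centred where one of these parts is at least c.
  · by_contra hlt
    push Not at hlt
    have hVlow : ∀ i ∈ Finset.Icc a b, ‖V.low i 0‖ < c := by
      intro i hi
      refine (V.norm_low_le ha i 0).trans_lt ?_
      have h1 : V.I (alphaC d α) ^ (alphaC d α)⁻¹ < c / B := by
        have := Real.rpow_lt_rpow (V.I_nonneg _) hlt (inv_pos.2 hq0)
        rwa [← Real.rpow_mul (by positivity), mul_inv_cancel₀ hq0.ne', Real.rpow_one] at this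
      have h2 : ((2 : ℝ) ^ i) ^ (4 / α) * kerNorm d (alphaC d α) ≤ B := by
        rw [hB]
        have : (2 : ℝ) ^ i ≤ 2 ^ b := zpow_le_zpow_right₀ one_le_two (Finset.mem_Icc.1 hi).2
        gcongr
        linarith
      have h0 : 0 ≤ V.I (alphaC d α) ^ (alphaC d α)⁻¹ := Real.rpow_nonneg (V.I_nonneg _) _
      calc _ ≤ V.I (alphaC d α) ^ (alphaC d α)⁻¹ * B := by gcongr
        _ < c / B * B := by gcongr
        _ = c := by field_simp
    have hlim : ∀ i ∈ Finset.Icc a b, ∀ᶠ n in atTop, ‖(w n).low i 0‖ < c := by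
      intro i hi
      have h1 := tendsto_integral_mul_of_ae ha.one_lt_alphaC (fun n => (w n).hf.2) V.hf.2 hwI hf
        (((𝓕 (cutoff ((2 : ℝ) ^ i) (zpow_pos two_pos i)) : 𝓢(E d, ℂ))).compSubConstCLM ℂ 0)
      exact (Tendsto.norm h1).eventually_lt_const (hVlow i hi)
    obtain ⟨n, hn⟩ := ((Finset.eventually_all _).2 hlim).exists
    refine absurd (hn (j (k n)) (Finset.mem_Icc.2 (hj (k n)))) (not_lt.2 ((hx (k n)).trans ?_))
    refine le_of_eq (congrArg norm ?_)
    simp only [low, smooth, hw, translate, sub_zero]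
    rw [← integral_add_right_eq_self _ (x (k n))]
    simp only [add_sub_cancel_right]
  · simpa using s1.sub t1
  · simpa using s3.sub t3
  · simpa using s2.sub t2
  · rcases IsProfile.of_sub ha hV (fun n => norm_h_le (hwD n)) hW with h | h
    · exact Or.inl h
    · exact Or.inr (IsProfile.of_translate (hk₀.comp hk) h)

/-- If every profile satisfies a linear inequality between the norms, so does the limit. -/
theorem le_of_profiles (ha : Adm d α) {B : ℝ} (e : ℕ → Elt d α) {I₀ D₀ N₀ : ℝ}
    (hI : Tendsto (fun n => (e n).I (alphaC d α)) atTop (𝓝 I₀))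
    (hD : Tendsto (fun n => (e n).D) atTop (𝓝 D₀))
    (hN : Tendsto (fun n => (e n).I (α + 2)) atTop (𝓝 N₀)) (hB0 : 0 ≤ B)
    (hB : ∀ W, IsProfile e W → W.I (α + 2) ≤ B * W.D) : N₀ ≤ B * D₀ := by
  by_contra hlt
  push Not at hlt
  set ε := (N₀ - B * D₀) / 2 with hε
  have hε0 : 0 < ε := by rw [hε]; linarith
  set K := max I₀ D₀ + 1 with hK
  have hI₀ : 0 ≤ I₀ := ge_of_tendsto' hI fun n => (e n).I_nonneg _
  have hK0 : 0 < K := by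
    have := le_max_left I₀ D₀
    linarith
  obtain ⟨δ, hδ, H⟩ := exists_profile ha hK0 hε0
  -- Induction on the number m of possible extractions. Each one lowers I₀ by at least δ and does
  -- not decrease N₀ − B D₀, because the removed profile satisfies the inequality. The gap therefore
  -- keeps N₀ above ε, and the same δ works throughout.
  have key : ∀ (m : ℕ) (e : ℕ → Elt d α) (I₀ D₀ N₀ : ℝ),
      Tendsto (fun n => (e n).I (alphaC d α)) atTop (𝓝 I₀) →
      Tendsto (fun n => (e n).D) atTop (𝓝 D₀) →
      Tendsto (fun n => (e n).I (α + 2)) atTop (𝓝 N₀) → I₀ < K → D₀ < K →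
      (∀ W, IsProfile e W → W.I (α + 2) ≤ B * W.D) → 2 * ε ≤ N₀ - B * D₀ → I₀ < m * δ → False := by
    intro m
    induction m with
    | zero =>
      intro e I₀ D₀ N₀ hI hD hN _ _ _ _ hlt
      have : 0 ≤ I₀ := ge_of_tendsto' hI fun n => (e n).I_nonneg _
      simp only [Nat.cast_zero, zero_mul] at hlt
      linarith
    | succ m ih =>
      intro e I₀ D₀ N₀ hI hD hN hIK hDK hB hεN hlt
      have hD₀ : 0 ≤ D₀ := ge_of_tendsto' hD fun n => (e n).D_nonneg
      have hBD : 0 ≤ B * D₀ := mul_nonneg hB0 hD₀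
      obtain ⟨V, e', hV, hδV, h1, h2, h3, h4⟩ := H e I₀ D₀ N₀ hI hD hN hIK hDK (by linarith)
      have hVB := hB V hV
      refine ih e' _ _ _ h1 h2 h3 (by linarith) (by linarith [V.D_nonneg]) (fun W hW => ?_) ?_ ?_
      · rcases h4 W hW with h | h
        · rw [I_eq_zero_of_u ha h (by linarith [ha.pos])]
          exact mul_nonneg hB0 W.D_nonneg
        · exact hB W h
      · rw [mul_sub]
        linarith
      · push_cast at hlt
        linarith
  obtain ⟨m, hm⟩ := exists_nat_gt (I₀ / δ)
  rw [div_lt_iff₀ hδ] at hm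
  refine key m e I₀ D₀ N₀ hI hD hN ?_ ?_ hB (by rw [hε]; linarith) hm
  · linarith [le_max_left I₀ D₀]
  · linarith [le_max_right I₀ D₀]

/-- A nonvanishing sequence has a nonzero profile whose removal keeps the inequality satisfied by
all profiles. -/
theorem exists_profile_ge (ha : Adm d α) {B K : ℝ} (e : ℕ → Elt d α) {D₀ N₀ : ℝ}
    (hI : ∀ n, (e n).I (alphaC d α) ≤ K)
    (hD : Tendsto (fun n => (e n).D) atTop (𝓝 D₀))
    (hN : Tendsto (fun n => (e n).I (α + 2)) atTop (𝓝 N₀)) (hN0 : 0 < N₀) (hB0 : 0 ≤ B)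
    (hB : ∀ W, IsProfile e W → W.I (α + 2) ≤ B * W.D) :
    ∃ V, IsProfile e V ∧ V.u ≠ 0 ∧ N₀ - V.I (α + 2) ≤ B * (D₀ - V.D) := by
  obtain ⟨I₀, -, k, hk, hlim⟩ := isCompact_Icc.tendsto_subseq (s := Set.Icc 0 K)
    (x := fun n => (e n).I (alphaC d α)) fun n => ⟨(e n).I_nonneg _, hI n⟩
  have hI₀ : 0 ≤ I₀ := ge_of_tendsto' hlim fun n => (e (k n)).I_nonneg _
  obtain ⟨δ, hδ, H⟩ := exists_profile ha (K := max I₀ D₀ + 1) (ε := N₀ / 2) (by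
    have := le_max_left I₀ D₀
    linarith) (by linarith)
  obtain ⟨V, e', hV, hδV, h1, h2, h3, h4⟩ := H (fun n => e (k n)) I₀ D₀ N₀ hlim
    (hD.comp hk.tendsto_atTop) (hN.comp hk.tendsto_atTop) (by linarith [le_max_left I₀ D₀])
    (by linarith [le_max_right I₀ D₀]) (by linarith)
  refine ⟨V, hV.of_subseq hk, fun h => ?_, ?_⟩
  · have := I_eq_zero_of_u ha h (r := alphaC d α) (by linarith [ha.two_lt_alphaC])
    linarith
  · refine le_of_profiles ha e' h1 h2 h3 hB0 fun W hW => ?_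
    rcases h4 W hW with h | h
    · rw [I_eq_zero_of_u ha h (by linarith [ha.pos])]
      exact mul_nonneg hB0 W.D_nonneg
    · exact hB W (h.of_subseq hk)

end Elt

/-! ### Weak convergence in `Ḣ^{γ_c} ∩ Ḣ²` -/

theorem norm_le_of_weak {H : Type*} [NormedAddCommGroup H] [InnerProductSpace ℂ H] {x : ℕ → H}
    {y : H} {S : ℝ} (hx : ∀ n, ‖x n‖ ≤ S)
    (h : Tendsto (fun n => inner ℂ y (x n)) atTop (𝓝 (inner ℂ y y))) : ‖y‖ ≤ S := by
  have h1 : ‖y‖ * ‖y‖ ≤ ‖y‖ * S := by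
    have h2 : ‖(inner ℂ y y : ℂ)‖ = ‖y‖ * ‖y‖ := by
      rw [inner_self_eq_norm_sq_to_K, norm_pow, RCLike.norm_ofReal, abs_norm, sq]
    rw [← h2]
    refine le_of_tendsto h.norm (Eventually.of_forall fun n => ?_)
    exact (norm_inner_le_norm _ _).trans (mul_le_mul_of_nonneg_left (hx n) (norm_nonneg _))
  rcases (norm_nonneg y).eq_or_lt with h0 | h0
  · rw [← h0]
    exact (norm_nonneg _).trans (hx 0)
  · exact le_of_mul_le_mul_left h1 h0

theorem memLp_mul_of_abs_le_one {a : E d → ℝ} (ha : Measurable a) (hb : ∀ ξ, |a ξ| ≤ 1)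
    {h : E d → ℂ} (hh : MemLp h 2 volume) : MemLp (fun ξ => (a ξ : ℂ) * h ξ) 2 volume := by
  refine hh.mono ((Complex.measurable_ofReal.comp ha).aestronglyMeasurable.mul hh.1)
    (Eventually.of_forall fun ξ => ?_)
  rw [norm_mul, Complex.norm_real, Real.norm_eq_abs]
  exact mul_le_of_le_one_left (norm_nonneg _) (hb ξ)

/-- Multiplication by a real measurable function bounded by `1`, on `L²`. -/
noncomputable def mulL2 {a : E d → ℝ} (ha : Measurable a) (hb : ∀ ξ, |a ξ| ≤ 1) :
    Lp ℂ 2 (volume : Measure (E d)) →ₗ[ℂ] Lp ℂ 2 (volume : Measure (E d)) where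
  toFun h := (memLp_mul_of_abs_le_one ha hb (Lp.memLp h)).toLp
  map_add' h k := by
    refine Lp.ext ?_
    filter_upwards [(memLp_mul_of_abs_le_one ha hb (Lp.memLp (h + k))).coeFn_toLp,
      (memLp_mul_of_abs_le_one ha hb (Lp.memLp h)).coeFn_toLp,
      (memLp_mul_of_abs_le_one ha hb (Lp.memLp k)).coeFn_toLp, Lp.coeFn_add h k,
      Lp.coeFn_add (memLp_mul_of_abs_le_one ha hb (Lp.memLp h)).toLp
        (memLp_mul_of_abs_le_one ha hb (Lp.memLp k)).toLp] with ξ h1 h2 h3 h4 h5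
    rw [h1, h5, Pi.add_apply, h2, h3, h4, Pi.add_apply, mul_add]
  map_smul' c h := by
    refine Lp.ext ?_
    filter_upwards [(memLp_mul_of_abs_le_one ha hb (Lp.memLp (c • h))).coeFn_toLp,
      (memLp_mul_of_abs_le_one ha hb (Lp.memLp h)).coeFn_toLp, Lp.coeFn_smul c h,
      Lp.coeFn_smul c (memLp_mul_of_abs_le_one ha hb (Lp.memLp h)).toLp] with ξ h1 h2 h3 h4
    rw [h1, RingHom.id_apply, h4, Pi.smul_apply, h2, h3, Pi.smul_apply, smul_eq_mul, smul_eq_mul]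
    ring

theorem mulL2_ae {a : E d → ℝ} (ha : Measurable a) (hb : ∀ ξ, |a ξ| ≤ 1)
    (h : Lp ℂ 2 (volume : Measure (E d))) :
    mulL2 ha hb h =ᵐ[volume] fun ξ => (a ξ : ℂ) * h ξ :=
  (memLp_mul_of_abs_le_one ha hb (Lp.memLp h)).coeFn_toLp

theorem norm_mulL2_le {a : E d → ℝ} (ha : Measurable a) (hb : ∀ ξ, |a ξ| ≤ 1)
    (h : Lp ℂ 2 (volume : Measure (E d))) : ‖mulL2 ha hb h‖ ≤ ‖h‖ := by
  refine Lp.norm_le_norm_of_ae_le ?_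
  filter_upwards [mulL2_ae ha hb h] with ξ hξ
  rw [hξ, norm_mul, Complex.norm_real, Real.norm_eq_abs]
  exact mul_le_of_le_one_left (norm_nonneg _) (hb ξ)

theorem inner_mulL2 {a : E d → ℝ} (ha : Measurable a) (hb : ∀ ξ, |a ξ| ≤ 1)
    (w h : Lp ℂ 2 (volume : Measure (E d))) :
    (inner ℂ w (mulL2 ha hb h) : ℂ) = inner ℂ (mulL2 ha hb w) h := by
  rw [L2.inner_def, L2.inner_def]
  refine integral_congr_ae ?_
  filter_upwards [mulL2_ae ha hb h, mulL2_ae ha hb w] with ξ h1 h2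
  rw [h1, h2, RCLike.inner_apply, RCLike.inner_apply, map_mul, Complex.conj_ofReal]
  ring

/-- The weight of `Ḣ²` relative to `Ḣ^γ ∩ Ḣ²`, as a Fourier multiplier. -/
noncomputable def ratTwo (γ : ℝ) (ξ : E d) : ℝ :=
  (2 * Real.pi * ‖ξ‖) ^ (2 : ℝ) / ((2 * Real.pi * ‖ξ‖) ^ γ + (2 * Real.pi * ‖ξ‖) ^ (2 : ℝ))

/-- The weight of `Ḣ^γ` relative to `Ḣ^γ ∩ Ḣ²`, as a Fourier multiplier. -/
noncomputable def ratLow (γ : ℝ) (ξ : E d) : ℝ :=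
  (2 * Real.pi * ‖ξ‖) ^ γ / ((2 * Real.pi * ‖ξ‖) ^ γ + (2 * Real.pi * ‖ξ‖) ^ (2 : ℝ))

theorem measurable_ratTwo (γ : ℝ) : Measurable (ratTwo (d := d) γ) := by
  unfold ratTwo
  fun_prop

theorem measurable_ratLow (γ : ℝ) : Measurable (ratLow (d := d) γ) := by
  unfold ratLow
  fun_prop

theorem abs_ratTwo_le (γ : ℝ) (ξ : E d) : |ratTwo γ ξ| ≤ 1 := by
  unfold ratTwo
  have h1 : 0 ≤ (2 * Real.pi * ‖ξ‖) ^ γ := by positivity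
  have h2 : 0 ≤ (2 * Real.pi * ‖ξ‖) ^ (2 : ℝ) := by positivity
  rw [abs_of_nonneg (by positivity)]
  exact div_le_one_of_le₀ (by linarith) (by positivity)

theorem abs_ratLow_le (γ : ℝ) (ξ : E d) : |ratLow γ ξ| ≤ 1 := by
  unfold ratLow
  have h1 : 0 ≤ (2 * Real.pi * ‖ξ‖) ^ γ := by positivity
  have h2 : 0 ≤ (2 * Real.pi * ‖ξ‖) ^ (2 : ℝ) := by positivity
  rw [abs_of_nonneg (by positivity)]
  exact div_le_one_of_le₀ (by linarith) (by positivity)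

theorem symb_add_mul_ratTwo (γ : ℝ) {ξ : E d} (hξ : ξ ≠ 0) :
    (ratTwo γ ξ : ℂ) * (symb γ ξ + symb 2 ξ) = symb 2 ξ := by
  have h0 : (0 : ℝ) < 2 * Real.pi * ‖ξ‖ := by positivity
  have h : (2 * Real.pi * ‖ξ‖) ^ γ + (2 * Real.pi * ‖ξ‖) ^ (2 : ℝ) ≠ 0 := by positivity
  unfold ratTwo symb
  rw [← Complex.ofReal_add, ← Complex.ofReal_mul, div_mul_cancel₀ _ h]

theorem symb_mul_ratTwo (γ : ℝ) (ξ : E d) :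
    symb γ ξ * (ratTwo γ ξ : ℂ) = symb 2 ξ * (ratLow γ ξ : ℂ) := by
  unfold ratTwo ratLow symb
  push_cast
  ring

/-- The parametrization of `𝒮₀'` elements by `L²` through the inverse weight of `Ḣ^γ ∩ Ḣ²`. -/
noncomputable def ofSob (γ : ℝ) (h : Lp ℂ 2 (volume : Measure (E d))) : S0Dual d :=
  ofL2 (mulL2 (measurable_ratTwo γ) (abs_ratTwo_le γ) h)

theorem ofSob_apply (γ : ℝ) (h : Lp ℂ 2 (volume : Measure (E d))) (φ : S0 d) :
    ofSob γ h φ = inner ℂ (mulL2 (measurable_ratTwo γ) (abs_ratTwo_le γ) (testL2 φ)) h := by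
  rw [ofSob, ofL2_eq_inner, inner_mulL2]

theorem ofSob_hdotNorm_two (hd : 1 ≤ d) (γ : ℝ) (h : Lp ℂ 2 (volume : Measure (E d))) :
    hdotNorm 2 (ofSob γ h)
      = ENNReal.ofReal ‖mulL2 (measurable_ratTwo γ) (abs_ratTwo_le γ) h‖ := by
  set k := mulL2 (measurable_ratTwo γ) (abs_ratTwo_le γ) h with hk
  rw [ofSob, hdotNorm_eq hd (ofL2_isHdotFourier hd k), ofReal_norm, Lp.enorm_def]
  refine eLpNorm_congr_ae ?_
  filter_upwards [ae_ne_zero hd] with ξ hξ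
  rw [← mul_assoc, symb_mul_neg _ hξ, one_mul]

theorem ofSob_symb_ae (hd : 1 ≤ d) (γ : ℝ) (h : Lp ℂ 2 (volume : Measure (E d))) :
    (fun ξ => symb γ ξ * (symb (-2) ξ * mulL2 (measurable_ratTwo γ) (abs_ratTwo_le γ) h ξ))
      =ᵐ[volume] mulL2 (measurable_ratLow γ) (abs_ratLow_le γ) h := by
  filter_upwards [ae_ne_zero hd, mulL2_ae (measurable_ratTwo γ) (abs_ratTwo_le γ) h,
    mulL2_ae (measurable_ratLow γ) (abs_ratLow_le γ) h] with ξ hξ h1 h2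
  rw [h1, h2]
  calc _ = symb (-2) ξ * (symb γ ξ * (ratTwo γ ξ : ℂ)) * h ξ := by ring
    _ = (symb 2 ξ * symb (-2) ξ) * ((ratLow γ ξ : ℂ) * h ξ) := by rw [symb_mul_ratTwo]; ring
    _ = _ := by rw [symb_mul_neg _ hξ, one_mul]

theorem ofSob_isHdotFourier (hd : 1 ≤ d) (γ : ℝ) (h : Lp ℂ 2 (volume : Measure (E d))) :
    IsHdotFourier γ (ofSob γ h)
      fun ξ => symb (-2) ξ * mulL2 (measurable_ratTwo γ) (abs_ratTwo_le γ) h ξ :=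
  ⟨(ofL2_isHdotFourier hd _).1, (Lp.memLp _).ae_eq (ofSob_symb_ae hd γ h).symm⟩

theorem ofSob_hdotNorm_low (hd : 1 ≤ d) (γ : ℝ) (h : Lp ℂ 2 (volume : Measure (E d))) :
    hdotNorm γ (ofSob γ h)
      = ENNReal.ofReal ‖mulL2 (measurable_ratLow γ) (abs_ratLow_le γ) h‖ := by
  rw [hdotNorm_eq hd (ofSob_isHdotFourier hd γ h), ofReal_norm, Lp.enorm_def]
  exact eLpNorm_congr_ae (ofSob_symb_ae hd γ h)

theorem sobNorm_ofSob_le (hd : 1 ≤ d) (α : ℝ) (h : Lp ℂ 2 (volume : Measure (E d))) :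
    sobNorm α (ofSob (gammaC d α) h) ≤ 2 * ENNReal.ofReal ‖h‖ := by
  rw [sobNorm, ofSob_hdotNorm_two hd, ofSob_hdotNorm_low hd, two_mul]
  gcongr
  · exact norm_mulL2_le _ _ _
  · exact norm_mulL2_le _ _ _

/-- With k = (|2πξ|^{γ_c} + |2πξ|²) û, the norm of the intersection is equivalent to the L² norm of
k, the converse bound being `sobNorm_ofSob_le`. So the intersection inherits weak compactness and
Riesz representation from L². -/
theorem exists_ofSob (hd : 1 ≤ d) {α : ℝ} {u : S0Dual d} {C : ℝ≥0} (h : sobNorm α u ≤ C) :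
    ∃ k : Lp ℂ 2 (volume : Measure (E d)), u = ofSob (gammaC d α) k ∧ ‖k‖ ≤ C := by
  obtain ⟨h1, h2⟩ := ENNReal.add_lt_top.1 (h.trans_lt ENNReal.coe_lt_top)
  obtain ⟨g, hg⟩ := exists_of_hdotNorm_lt_top h2
  have hγ := hg.of_hdot hd h1
  have hk := hγ.2.add hg.2
  refine ⟨hk.toLp, ?_, ?_⟩
  · rw [ofSob, hg.eq_ofL2 hd]
    congr 1
    refine Lp.ext ?_
    filter_upwards [hg.2.coeFn_toLp, hk.coeFn_toLp, ae_ne_zero hd,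
      mulL2_ae (measurable_ratTwo (gammaC d α)) (abs_ratTwo_le (gammaC d α)) hk.toLp]
      with ξ h3 h4 h5 h6
    rw [h3, h6, h4, Pi.add_apply, ← add_mul, ← mul_assoc, symb_add_mul_ratTwo _ h5]
  · rw [Lp.norm_toLp]
    refine ENNReal.toReal_le_coe_of_le_coe ((eLpNorm_add_le hγ.2.1 hg.2.1 one_le_two).trans ?_)
    rwa [← hdotNorm_eq hd hγ, ← hdotNorm_eq hd hg]

/-- `ofSob` as a linear map. -/
noncomputable def ofSobLinear (γ : ℝ) : Lp ℂ 2 (volume : Measure (E d)) →ₗ[ℂ] S0Dual d where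
  toFun := ofSob γ
  map_add' h k := by
    ext φ
    rw [add_apply, ofSob_apply, ofSob_apply, ofSob_apply, inner_add_right]
  map_smul' c h := by
    ext φ
    rw [RingHom.id_apply, smul_apply, ofSob_apply, ofSob_apply, inner_smul_right, smul_eq_mul]

/-- Convergence on `𝒮₀` of a sequence bounded in `Ḣ^{γ_c} ∩ Ḣ²` implies weak convergence of a
subsequence, and the `Ḣ^{γ_c}` norm is lower semicontinuous. -/
theorem exists_weakConv_sob (hd : 1 ≤ d) {α : ℝ} {v : ℕ → S0Dual d} {V : S0Dual d} {C S : ℝ≥0}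
    (hC : ∀ n, sobNorm α (v n) ≤ C) (hS : ∀ n, hdotNorm (gammaC d α) (v n) ≤ S)
    (hlim : ∀ φ, Tendsto (fun n => v n φ) atTop (𝓝 (V φ))) :
    hdotNorm (gammaC d α) V ≤ S ∧
      ∃ k : ℕ → ℕ, StrictMono k ∧ WeakConv (sobNorm α) (fun n => v (k n)) V := by
  choose h hv hh using fun n => exists_ofSob hd (hC n)
  obtain ⟨k, h₀, hk, hw⟩ := exists_weak_subseq hh
  have hV : V = ofSob (gammaC d α) h₀ := by
    ext φ
    refine tendsto_nhds_unique ((hlim φ).comp hk.tendsto_atTop) ?_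
    rw [ofSob_apply]
    refine (hw _).congr fun n => ?_
    rw [Function.comp, hv, ofSob_apply]
  refine ⟨?_, k, hk, fun n => (hC _).trans_lt ENNReal.coe_lt_top, ?_, fun ℓ hℓ => ?_⟩
  -- The Ḣ^{γ_c} norm is the L² norm after a self-adjoint bounded multiplier, which preserves weak
  -- convergence.
  · rw [hV, ofSob_hdotNorm_low hd, ← ENNReal.ofReal_coe_nnreal]
    refine ENNReal.ofReal_le_ofReal (norm_le_of_weak (x := fun n =>
      mulL2 (measurable_ratLow (gammaC d α)) (abs_ratLow_le (gammaC d α)) (h (k n))) (fun n => ?_) ?_)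
    · have := hS (k n)
      rw [hv, ofSob_hdotNorm_low hd, ← ENNReal.ofReal_coe_nnreal] at this
      exact (ENNReal.ofReal_le_ofReal_iff S.2).1 this
    · simp only [inner_mulL2]
      exact hw _
  · rw [hV]
    exact (sobNorm_ofSob_le hd α h₀).trans_lt (ENNReal.mul_lt_top (by simp) ENNReal.ofReal_lt_top)
  · obtain ⟨B, hB⟩ := hℓ
    -- A functional bounded on the intersection pulls back to a bounded functional on L², where the
    -- Riesz theorem reduces it to the inner products known to converge.
    set L : Lp ℂ 2 (volume : Measure (E d)) →L[ℂ] ℂ :=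
      (ℓ.comp (ofSobLinear (gammaC d α))).mkContinuous (B * 2) fun x => by
        have h1 := sobNorm_ofSob_le hd α x
        have h2 := (hB (ofSob (gammaC d α) x) (h1.trans_lt
          (ENNReal.mul_lt_top (by simp) ENNReal.ofReal_lt_top))).trans
            (mul_le_mul_of_nonneg_left h1 zero_le)
        have h3 : (B : ℝ≥0∞) * (2 * ENNReal.ofReal ‖x‖) = ENNReal.ofReal (B * 2 * ‖x‖) := by
          rw [ENNReal.ofReal_mul (by positivity), ENNReal.ofReal_mul (by positivity),
            ENNReal.ofReal_coe_nnreal, mul_assoc]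
          simp
        rw [h3, ← ofReal_norm] at h2
        exact (ENNReal.ofReal_le_ofReal_iff (by positivity)).1 h2 with hL
    have hLa : ∀ x, L x = ℓ (ofSob (gammaC d α) x) := fun x => rfl
    have h4 := hw ((InnerProductSpace.toDual ℂ _).symm L)
    simp only [InnerProductSpace.toDual_symm_apply, hLa, ← hv, ← hV] at h4
    exact h4

theorem lebNorm_le_sobNorm {α : ℝ} (ha : Adm d α) {u : S0Dual d} (h : sobNorm α u < ⊤) :
    lebNorm α u ≤ ENNReal.ofReal (sobConst d (gammaC d α) (alphaC d α) ⊔ 1) * sobNorm α u := by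
  obtain ⟨e, rfl, -, hle⟩ := Elt.exists_of_sobNorm ha h
  rw [lebNorm, sobNorm, mul_add]
  refine add_le_add (hle.trans ?_) ?_
  · gcongr
    exact le_max_left _ _
  · refine le_mul_of_one_le_left zero_le ?_
    rw [ENNReal.one_le_ofReal]
    exact le_max_right _ _

/-- By the Sobolev embedding a functional bounded for the norm of L^{α_c} ∩ Ḣ² is bounded for that
of Ḣ^{γ_c} ∩ Ḣ², so the former space has fewer functionals to test. -/
theorem WeakConv.leb_of_sob {α : ℝ} (ha : Adm d α) {w : ℕ → S0Dual d} {V : S0Dual d}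
    (h : WeakConv (sobNorm α) w V) : WeakConv (lebNorm α) w V := by
  obtain ⟨h1, h2, h3⟩ := h
  have key : ∀ u : S0Dual d, sobNorm α u < ⊤ → lebNorm α u < ⊤ := fun u hu =>
    (lebNorm_le_sobNorm ha hu).trans_lt (ENNReal.mul_lt_top ENNReal.ofReal_lt_top hu)
  refine ⟨fun n => key _ (h1 n), key _ h2, fun ℓ ⟨C, hC⟩ => h3 ℓ
    ⟨C * Real.toNNReal (sobConst d (gammaC d α) (alphaC d α) ⊔ 1), fun u hu => ?_⟩⟩
  refine (hC u (key u hu)).trans ?_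
  rw [ENNReal.coe_mul, mul_assoc]
  gcongr
  exact lebNorm_le_sobNorm ha hu

namespace Elt

variable {α : ℝ}

theorem sobNorm_translate (hd : 1 ≤ d) {e : Elt d α} (h : sobNorm α e.u < ⊤) (a : E d) :
    sobNorm α (e.translate a).u = sobNorm α e.u ∧
      hdotNorm (gammaC d α) (e.translate a).u = hdotNorm (gammaC d α) e.u := by
  have hγ := e.hg.of_hdot hd (ENNReal.add_lt_top.1 h).1
  have h1 := hdotNorm_translate hd hγ a
  have h2 := hdotNorm_translate hd e.hg a
  refine ⟨?_, h1⟩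
  rw [sobNorm, sobNorm]
  exact congrArg₂ _ h1 h2

/-- A profile of a sequence bounded in `Ḣ^{γ_c} ∩ Ḣ²` is a weak limit. -/
theorem IsProfile.exists_weakConv (hd : 1 ≤ d) {e : ℕ → Elt d α} {V : Elt d α} (h : IsProfile e V)
    {C S : ℝ≥0} (hC : ∀ n, sobNorm α (e n).u ≤ C)
    (hS : ∀ n, hdotNorm (gammaC d α) (e n).u ≤ S) :
    hdotNorm (gammaC d α) V.u ≤ S ∧ ∃ (x : ℕ → E d) (k : ℕ → ℕ), StrictMono k ∧
      WeakConv (sobNorm α) (fun n => NL4S.translate (e (k n)).u (x (k n))) V.u := by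
  obtain ⟨k, x, hk, hV⟩ := h
  have hfin : ∀ n, sobNorm α (e n).u < ⊤ := fun n => (hC n).trans_lt ENNReal.coe_lt_top
  obtain ⟨h1, j, hj, hw⟩ := exists_weakConv_sob hd
    (v := fun n => ((e (k n)).translate (x n)).u) (V := V.u)
    (fun n => by rw [(sobNorm_translate hd (hfin _) _).1]; exact hC _)
    (fun n => by rw [(sobNorm_translate hd (hfin _) _).2]; exact hS _) hV
  -- The centres are re-indexed by the original sequence, so that the n-th term uses the centre at
  -- `k n`; the value 0 off the range of k plays no role.
  refine ⟨h1, Function.extend k x 0, k ∘ j, hk.comp hj, ?_⟩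
  simp only [Function.comp, hk.injective.extend_apply]
  exact hw

end Elt

/-! ### Multiples, critical rescaling and Schwartz elements -/

theorem IsHdotFourier.smul {s : ℝ} {u : S0Dual d} {g : E d → ℂ} (h : IsHdotFourier s u g) (c : ℂ) :
    IsHdotFourier s (c • u) fun ξ => c * g ξ := by
  refine ⟨fun φ => ?_, ?_⟩
  · rw [smul_apply, h.1 φ, smul_eq_mul, ← integral_const_mul]
    simp only [mul_assoc]
  · simp only [mul_left_comm _ c]
    exact h.2.const_mul c

theorem IsLpFunction.smul {q : ℝ} {u : S0Dual d} {f : E d → ℂ} (h : IsLpFunction q u f) (c : ℂ) :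
    IsLpFunction q (c • u) fun x => c * f x := by
  refine ⟨fun φ => ?_, h.2.const_mul c⟩
  rw [smul_apply, h.1 φ, smul_eq_mul, ← integral_const_mul]
  simp only [mul_assoc]

theorem hdotNorm_smul (hd : 1 ≤ d) {s : ℝ} {u : S0Dual d} (h : hdotNorm s u < ⊤) (c : ℂ) :
    hdotNorm s (c • u) = ‖c‖ₑ * hdotNorm s u := by
  obtain ⟨g, hg⟩ := exists_of_hdotNorm_lt_top h
  rw [hdotNorm_eq hd hg, hdotNorm_eq hd (hg.smul c), ← eLpNorm_const_smul]
  congr 1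
  ext ξ
  simp only [Pi.smul_apply, smul_eq_mul]
  ring

/-- Dilation on `𝒮₀`. -/
noncomputable def dilS0 (a : ℝ) (ha : 0 < a) : S0 d →L[ℂ] S0 d :=
  ((dil a ha).comp (S0 d).subtypeL).codRestrict (S0 d) fun φ => dil_mem_S0 ha φ.2

theorem dilS0_coe (a : ℝ) (ha : 0 < a) (φ : S0 d) :
    ((dilS0 a ha φ : S0 d) : 𝓢(E d, ℂ)) = dil a ha (φ : 𝓢(E d, ℂ)) := rfl

/-- The critical rescaling `u ↦ l^{4/α} u(l ·)`. -/
noncomputable def scale (α : ℝ) (l : ℝ) (hl : 0 < l) (u : S0Dual d) : S0Dual d :=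
  ((l ^ (4 / α - d) : ℝ) : ℂ) • u.comp (dilS0 l⁻¹ (inv_pos.2 hl))

theorem scale_apply (α : ℝ) {l : ℝ} (hl : 0 < l) (u : S0Dual d) (φ : S0 d) :
    scale α l hl u φ = ((l ^ (4 / α - d) : ℝ) : ℂ) * u (dilS0 l⁻¹ (inv_pos.2 hl) φ) := rfl

theorem IsFunction.scale (α : ℝ) {l : ℝ} (hl : 0 < l) {u : S0Dual d} {f : E d → ℂ}
    (h : IsFunction u f) :
    IsFunction (scale α l hl u) fun x => ((l ^ (4 / α) : ℝ) : ℂ) * f (l • x) := by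
  intro φ
  have h1 := integral_comp_dil hl fun y => f y * (φ : 𝓢(E d, ℂ)) (l⁻¹ • y)
  simp only [smul_smul, inv_mul_cancel₀ hl.ne', one_smul] at h1
  rw [scale_apply, h]
  simp only [dilS0_coe, dil_apply, mul_assoc]
  rw [integral_const_mul, h1, Complex.real_smul, ← mul_assoc, ← Complex.ofReal_mul,
    Real.rpow_sub hl, Real.rpow_natCast, div_eq_mul_inv]

theorem IsLpFunction.scale (α : ℝ) {l : ℝ} (hl : 0 < l) {q : ℝ} (hq : 0 < q) {u : S0Dual d}
    {f : E d → ℂ} (h : IsLpFunction q u f) :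
    IsLpFunction q (scale α l hl u) fun x => ((l ^ (4 / α) : ℝ) : ℂ) * f (l • x) := by
  refine ⟨h.1.scale α hl, MemLp.const_mul ⟨?_, ?_⟩ _⟩
  · exact h.2.1.comp_quasiMeasurePreserving
      (Measure.quasiMeasurePreserving_smul volume hl.ne')
  · rw [eLpNorm_comp_dil hl hq]
    exact ENNReal.mul_lt_top ENNReal.ofReal_lt_top h.2.2

theorem symb_smul (s : ℝ) {l : ℝ} (hl : 0 < l) (ξ : E d) :
    symb s (l • ξ) = ((l ^ s : ℝ) : ℂ) * symb s ξ := by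
  unfold symb
  rw [norm_smul, Real.norm_of_nonneg hl.le, ← Complex.ofReal_mul,
    ← Real.mul_rpow hl.le (by positivity)]
  congr 2
  ring

theorem symb_scale_eq (α s : ℝ) {l : ℝ} (hl : 0 < l) (g : E d → ℂ) :
    (fun ξ => symb s ξ * (((l ^ (4 / α - d) : ℝ) : ℂ) * g (l⁻¹ • ξ)))
      = ((l ^ (4 / α - d + s) : ℝ) : ℂ) • fun ξ => (fun η => symb s η * g η) (l⁻¹ • ξ) := by
  ext ξ
  have h1 : symb s ξ = ((l ^ s : ℝ) : ℂ) * symb s (l⁻¹ • ξ) := by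
    rw [← symb_smul s hl, smul_smul, mul_inv_cancel₀ hl.ne', one_smul]
  rw [Pi.smul_apply, smul_eq_mul, h1, Real.rpow_add hl, Complex.ofReal_mul]
  ring

theorem IsHdotFourier.scale (α : ℝ) {l : ℝ} (hl : 0 < l) {s : ℝ} {u : S0Dual d} {g : E d → ℂ}
    (h : IsHdotFourier s u g) :
    IsHdotFourier s (scale α l hl u) fun ξ => ((l ^ (4 / α - d) : ℝ) : ℂ) * g (l⁻¹ • ξ) := by
  have hl' := inv_pos.2 hl
  refine ⟨fun φ => ?_, ?_⟩
  · have h1 := integral_comp_dil hl' fun η => g η * (𝓕⁻ (φ : 𝓢(E d, ℂ)) : 𝓢(E d, ℂ)) (l • η)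
    simp only [smul_smul, mul_inv_cancel₀ hl.ne', one_smul] at h1
    rw [scale_apply, h.1]
    simp only [dilS0_coe, fourierInv_dil, mul_assoc, inv_inv]
    rw [integral_const_mul, h1, Complex.real_smul]
    congr 1
    rw [← integral_const_mul]
    congr 1
    ext ξ
    ring
  · rw [symb_scale_eq α s hl]
    refine MemLp.const_smul ⟨h.2.1.comp_quasiMeasurePreserving
      (Measure.quasiMeasurePreserving_smul volume hl'.ne'), ?_⟩ _
    have := eLpNorm_comp_dil hl' two_pos fun η => symb s η * g η
    simp only [ENNReal.ofReal_ofNat] at this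
    refine this.trans_lt ?_
    exact ENNReal.mul_lt_top ENNReal.ofReal_lt_top h.2.2

/-- For s = γ_c the factor is 1, and for s = 2 the exponent 2 − γ_c is positive for admissible α:
dilations keep the critical norm and move the Ḣ² norm to any prescribed positive value. -/
theorem hdotNorm_scale (hd : 1 ≤ d) (α : ℝ) {l : ℝ} (hl : 0 < l) {s : ℝ} {u : S0Dual d}
    (h : hdotNorm s u < ⊤) :
    hdotNorm s (scale α l hl u) = ENNReal.ofReal (l ^ (s - gammaC d α)) * hdotNorm s u := by
  have hl' := inv_pos.2 hl
  obtain ⟨g, hg⟩ := exists_of_hdotNorm_lt_top h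
  rw [hdotNorm_eq hd hg, hdotNorm_eq hd (hg.scale α hl), symb_scale_eq α s hl,
    eLpNorm_const_smul]
  have := eLpNorm_comp_dil hl' two_pos fun η => symb s η * g η
  simp only [ENNReal.ofReal_ofNat] at this
  rw [this, ← mul_assoc, ← ofReal_norm, Complex.norm_real,
    Real.norm_of_nonneg (by positivity), ← ENNReal.ofReal_mul (by positivity), Real.inv_rpow hl.le,
    Real.rpow_neg hl.le, inv_inv, ← Real.rpow_add hl]
  congr 3
  unfold gammaC
  ring

theorem memLp_symb_mul_schwartz {s : ℝ} (hs : 0 ≤ s) (ψ : 𝓢(E d, ℂ)) :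
    MemLp (fun ξ => symb s ξ * ψ ξ) 2 volume := by
  obtain ⟨n, hn⟩ := exists_nat_ge s
  obtain ⟨C, hC⟩ : ∃ C : ℝ, ∀ ξ, (1 + ‖ξ‖) ^ (n + d + 1) * ‖ψ ξ‖ ≤ C := by
    refine ⟨2 ^ (n + d + 1) * (Finset.Iic (n + d + 1, 0)).sup
      (fun m : ℕ × ℕ => SchwartzMap.seminorm ℝ m.1 m.2) ψ, fun ξ => ?_⟩
    simpa using SchwartzMap.one_add_le_sup_seminorm_apply (𝕜 := ℝ) (m := (n + d + 1, 0)) le_rfl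
      le_rfl ψ ξ
  have hm : AEStronglyMeasurable (fun ξ => symb s ξ * ψ ξ) volume :=
    (measurable_symb s).aestronglyMeasurable.mul ψ.continuous.aestronglyMeasurable
  refine (memLp_weight.const_mul (((2 * Real.pi) ^ s * C : ℝ) : ℂ)).mono hm
    (Eventually.of_forall fun ξ => ?_)
  have hx : 0 < 1 + ‖ξ‖ := by positivity
  have hC0 : 0 ≤ C := le_trans (by positivity) (hC 0)
  have h1 : ‖ξ‖ ^ s ≤ (1 + ‖ξ‖) ^ n := by
    rw [← Real.rpow_natCast]
    calc ‖ξ‖ ^ s ≤ (1 + ‖ξ‖) ^ s := by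
          gcongr
          linarith
      _ ≤ (1 + ‖ξ‖) ^ (n : ℝ) := Real.rpow_le_rpow_of_exponent_le (by linarith [norm_nonneg ξ]) hn
  have h2 : (1 + ‖ξ‖) ^ n * ‖ψ ξ‖ ≤ C * weight ξ := by
    have h3 := hC ξ
    have h4 : weight ξ = ((1 + ‖ξ‖) ^ (d + 1))⁻¹ := by
      rw [weight, Real.rpow_neg hx.le]
      congr 1
      exact_mod_cast Real.rpow_natCast _ (d + 1)
    rw [h4, ← div_eq_mul_inv, le_div_iff₀ (by positivity)]
    calc _ = (1 + ‖ξ‖) ^ (n + d + 1) * ‖ψ ξ‖ := by ring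
      _ ≤ C := h3
  rw [norm_mul, norm_symb, norm_mul, Complex.norm_real, Complex.norm_real,
    Real.norm_of_nonneg (by positivity), Real.norm_of_nonneg (weight_pos ξ).le,
    Real.mul_rpow (by positivity) (norm_nonneg _), mul_assoc, mul_assoc]
  refine mul_le_mul_of_nonneg_left ?_ (by positivity)
  calc ‖ξ‖ ^ s * ‖ψ ξ‖ ≤ (1 + ‖ξ‖) ^ n * ‖ψ ξ‖ := by gcongr
    _ ≤ C * weight ξ := h2

/-- Complex conjugation on Schwartz functions. -/
noncomputable def conjS (φ : 𝓢(E d, ℂ)) : 𝓢(E d, ℂ) :=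
  SchwartzMap.postcompCLM (𝕜 := ℝ) (Complex.conjCLE : ℂ →L[ℝ] ℂ) φ

theorem conjS_apply (φ : 𝓢(E d, ℂ)) (x : E d) : conjS φ x = star (φ x) := rfl

theorem fourier_conjS (φ : 𝓢(E d, ℂ)) (ξ : E d) :
    (𝓕 (conjS φ) : 𝓢(E d, ℂ)) ξ = star ((𝓕⁻ φ : 𝓢(E d, ℂ)) ξ) := by
  rw [SchwartzMap.fourier_coe, SchwartzMap.fourierInv_coe, Real.fourier_eq', Real.fourierInv_eq',
    RCLike.star_def, ← integral_conj]
  refine integral_congr_ae (Eventually.of_forall fun x => ?_)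
  simp only [smul_eq_mul, map_mul, conjS_apply, RCLike.star_def]
  rw [← Complex.exp_conj]
  congr 2
  rw [map_mul, Complex.conj_I, Complex.conj_ofReal]
  push_cast
  ring

namespace Elt

variable {α : ℝ}

/-- The multiple `c e`. -/
noncomputable def smul (c : ℂ) (e : Elt d α) : Elt d α where
  u := c • e.u
  f := fun x => c * e.f x
  g := fun ξ => c * e.g ξ
  hf := e.hf.smul c
  hg := e.hg.smul c

theorem I_smul (c : ℂ) (e : Elt d α) (r : ℝ) : (e.smul c).I r = ‖c‖ ^ r * e.I r := by
  rw [I, I, ← integral_const_mul]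
  congr 1
  ext x
  rw [smul, norm_mul, Real.mul_rpow (norm_nonneg _) (norm_nonneg _)]

theorem h_smul (c : ℂ) (e : Elt d α) : (e.smul c).h = c • e.h := by
  refine Lp.ext ?_
  filter_upwards [e.h_ae, (e.smul c).h_ae, Lp.coeFn_smul c e.h] with ξ h1 h2 h3
  rw [h2, h3, Pi.smul_apply, h1, smul, smul_eq_mul]
  ring

theorem D_smul (c : ℂ) (e : Elt d α) : (e.smul c).D = ‖c‖ ^ 2 * e.D := by
  rw [D, D, h_smul, norm_smul, mul_pow]

/-- The sum of two elements. -/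
noncomputable def add (ha : Adm d α) (e e' : Elt d α) : Elt d α where
  u := e.u + e'.u
  f := fun x => e.f x + e'.f x
  g := fun ξ => e.g ξ + e'.g ξ
  hf := by
    refine ⟨fun φ => ?_, e.hf.2.add e'.hf.2⟩
    simp only [add_mul]
    rw [integral_add (integrable_mul_schwartz ha.one_lt_alphaC e.hf.2 _)
      (integrable_mul_schwartz ha.one_lt_alphaC e'.hf.2 _), ← e.hf.1 φ, ← e'.hf.1 φ]
    rfl
  hg := by
    refine ⟨fun φ => ?_, ?_⟩
    · simp only [add_mul]
      rw [integral_add (integrable_fourier_pairing ha.one_le e.hg.2 _)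
        (integrable_fourier_pairing ha.one_le e'.hg.2 _), ← e.hg.1 φ, ← e'.hg.1 φ]
      rfl
    · simp only [mul_add]
      exact e.hg.2.add e'.hg.2

theorem h_add (ha : Adm d α) (e e' : Elt d α) : (e.add ha e').h = e.h + e'.h := by
  refine Lp.ext ?_
  filter_upwards [e.h_ae, e'.h_ae, (e.add ha e').h_ae, Lp.coeFn_add e.h e'.h] with ξ h1 h2 h3 h4
  rw [h3, h4, Pi.add_apply, h1, h2, add]
  ring

/-- The critical rescaling of an element. -/
noncomputable def scale (ha : Adm d α) {l : ℝ} (hl : 0 < l) (e : Elt d α) : Elt d α where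
  u := NL4S.scale α l hl e.u
  f := fun x => ((l ^ (4 / α) : ℝ) : ℂ) * e.f (l • x)
  g := fun ξ => ((l ^ (4 / α - d) : ℝ) : ℂ) * e.g (l⁻¹ • ξ)
  hf := e.hf.scale α hl (by linarith [ha.two_lt_alphaC])
  hg := e.hg.scale α hl

theorem I_scale (ha : Adm d α) {l : ℝ} (hl : 0 < l) (e : Elt d α) (r : ℝ) :
    (e.scale ha hl).I r = l ^ (4 / α * r - d) * e.I r := by
  have h1 := integral_comp_dil hl fun x => ‖e.f x‖ ^ r
  rw [I, I]
  have h2 : ∀ x, ‖(e.scale ha hl).f x‖ ^ r = l ^ (4 / α * r) * ‖e.f (l • x)‖ ^ r := by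
    intro x
    rw [scale, norm_mul, Complex.norm_real, Real.norm_of_nonneg (by positivity),
      Real.mul_rpow (by positivity) (norm_nonneg _), ← Real.rpow_mul hl.le]
  simp only [h2]
  rw [integral_const_mul, h1, smul_eq_mul, ← mul_assoc, Real.rpow_sub hl, Real.rpow_natCast,
    div_eq_mul_inv (l ^ (4 / α * r))]

theorem hdotNorm_two_lt_top (e : Elt d α) : hdotNorm 2 e.u < ⊤ :=
  (iInf₂_le _ e.hg).trans_lt e.hg.2.2

theorem D_scale (ha : Adm d α) {l : ℝ} (hl : 0 < l) (e : Elt d α) :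
    (e.scale ha hl).D = l ^ (2 * (2 - gammaC d α)) * e.D := by
  have h1 := hdotNorm_scale ha.one_le α hl e.hdotNorm_two_lt_top
  have h2 := (e.scale ha hl).hdotNorm_eq ha.one_le
  rw [e.hdotNorm_eq ha.one_le, ← ENNReal.ofReal_mul (by positivity)] at h1
  have h3 := h2.symm.trans h1
  rw [ENNReal.ofReal_eq_ofReal_iff (norm_nonneg _) (by positivity)] at h3
  rw [D, D, h3, mul_pow, mul_comm 2, Real.rpow_mul hl.le, Real.rpow_two]

theorem u_scale_ne_zero (ha : Adm d α) {l : ℝ} (hl : 0 < l) {e : Elt d α} (h : e.u ≠ 0) :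
    (e.scale ha hl).u ≠ 0 := by
  intro h0
  have h1 := I_eq_zero_of_u ha h0 (r := alphaC d α) (by linarith [ha.two_lt_alphaC])
  rw [I_scale] at h1
  have h2 := I_pos_of_ne_zero ha h
  have : 0 < l ^ (4 / α * alphaC d α - d) := by positivity
  exact absurd h1 (by positivity)

/-- The element given by a Schwartz function. -/
noncomputable def ofSchwartz (ha : Adm d α) (ψ : 𝓢(E d, ℂ)) : Elt d α where
  u := ofL2 (memLp_symb_mul_schwartz zero_le_two (𝓕 ψ)).toLp
  f := ψ
  g := (𝓕 ψ : 𝓢(E d, ℂ))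
  hf := by
    refine ⟨fun φ => ?_, ψ.memLp _ volume⟩
    have h1 := SchwartzMap.integral_fourier_mul_eq ψ (𝓕⁻ (φ : 𝓢(E d, ℂ)))
    rw [fourier_fourierInv_schwartz] at h1
    rw [← h1, fourier_pairing_eq ha.one_le, ofL2_apply]
    refine integral_congr_ae ?_
    filter_upwards [(memLp_symb_mul_schwartz zero_le_two (𝓕 ψ)).coeFn_toLp] with ξ hξ
    rw [hξ]
  hg := by
    refine ⟨fun φ => ?_, memLp_symb_mul_schwartz zero_le_two (𝓕 ψ)⟩
    rw [fourier_pairing_eq ha.one_le, ofL2_apply]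
    refine integral_congr_ae ?_
    filter_upwards [(memLp_symb_mul_schwartz zero_le_two (𝓕 ψ)).coeFn_toLp] with ξ hξ
    rw [hξ]

theorem ofSchwartz_isHdotFourier (ha : Adm d α) (ψ : 𝓢(E d, ℂ)) {s : ℝ} (hs : 0 ≤ s) :
    IsHdotFourier s (ofSchwartz ha ψ).u (ofSchwartz ha ψ).g :=
  ⟨(ofSchwartz ha ψ).hg.1, memLp_symb_mul_schwartz hs (𝓕 ψ)⟩

theorem exists_ofSchwartz_ne_zero (ha : Adm d α) : ∃ ψ : 𝓢(E d, ℂ), (ofSchwartz ha ψ).u ≠ 0 := by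
  refine ⟨chi d, fun h => ?_⟩
  have h1 := f_ae_zero_of_u ha h
  have h2 : chi d = 0 := by
    ext x
    have := (chi d).continuous.ae_eq_iff_eq volume (continuous_const (y := (0 : ℂ))) |>.1 h1
    exact congrFun this x
  have h3 : chi d 0 = 1 := by
    rw [chi_apply, (bump d).one_of_mem_closedBall (Metric.mem_closedBall_self zero_le_one)]
    simp
  rw [h2] at h3
  exact zero_ne_one h3

end Elt

/-! ### Existence of maximizers for an abstract critical norm -/

/-- The properties common to the `Ḣ^{γ_c}` and the `L^{α_c}` norm. -/
structure CritNorm (α : ℝ) (N : S0Dual d → ℝ≥0∞) : Prop where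
  exists_elt : ∃ S : ℝ≥0, ∀ u, N u + hdotNorm 2 u < ⊤ →
    ∃ e : Elt d α, e.u = u ∧ lpNorm (alphaC d α) u ≤ S * N u
  smul : ∀ (c : ℂ) (u : S0Dual d), N u < ⊤ → N (c • u) = ‖c‖ₑ * N u
  scale : ∀ {l : ℝ} (hl : 0 < l) (u : S0Dual d), N u < ⊤ → N (scale α l hl u) = N u
  lsc : ∀ (e : ℕ → Elt d α) (V : Elt d α), (∀ n, N (e n).u ≤ 1) → (∀ n, hdotNorm 2 (e n).u ≤ 1) →
    Elt.IsProfile e V → N V.u ≤ 1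
  exists_ne_zero : ∃ e : Elt d α, e.u ≠ 0 ∧ N e.u < ⊤

namespace CritNorm

variable {α : ℝ} {N : S0Dual d → ℝ≥0∞}

/-- The real value of the quotient to be maximized. -/
noncomputable def ratio (N : S0Dual d → ℝ≥0∞) (e : Elt d α) : ℝ :=
  e.I (α + 2) / ((N e.u).toReal ^ α * e.D)

/-- Maximizers of the quotient, in terms of elements. -/
def IsMax (N : S0Dual d → ℝ≥0∞) (e : Elt d α) : Prop :=
  N e.u < ⊤ ∧ e.u ≠ 0 ∧ ∀ w : Elt d α, N w.u < ⊤ → w.u ≠ 0 → ratio N w ≤ ratio N e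

theorem exists_bound (hN : CritNorm α N) (ha : Adm d α) : ∃ S : ℝ, 0 ≤ S ∧ ∀ e : Elt d α,
    N e.u < ⊤ → e.I (alphaC d α) ^ (alphaC d α)⁻¹ ≤ S * (N e.u).toReal := by
  obtain ⟨S, hS⟩ := hN.exists_elt
  refine ⟨S, S.2, fun e he => ?_⟩
  obtain ⟨-, -, h⟩ := hS e.u (ENNReal.add_lt_top.2 ⟨he, e.hdotNorm_two_lt_top⟩)
  rw [e.lpNorm_alphaC ha, ← ENNReal.ofReal_toReal he.ne, ← ENNReal.ofReal_coe_nnreal,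
    ← ENNReal.ofReal_mul (NNReal.coe_nonneg S)] at h
  exact (ENNReal.ofReal_le_ofReal_iff (by positivity)).1 h

theorem toReal_pos (hN : CritNorm α N) (ha : Adm d α) {e : Elt d α} (he : N e.u < ⊤)
    (h0 : e.u ≠ 0) : 0 < (N e.u).toReal := by
  obtain ⟨S, hS, h⟩ := hN.exists_bound ha
  have h1 : 0 < e.I (alphaC d α) ^ (alphaC d α)⁻¹ :=
    Real.rpow_pos_of_pos (Elt.I_pos_of_ne_zero ha h0) _
  refine lt_of_le_of_ne ENNReal.toReal_nonneg fun h2 => ?_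
  have := h e he
  rw [← h2, mul_zero] at this
  linarith

theorem ratio_bdd (hN : CritNorm α N) (ha : Adm d α) : ∃ B : ℝ, ∀ e : Elt d α,
    N e.u < ⊤ → e.u ≠ 0 → ratio N e ≤ B := by
  obtain ⟨S, hS, h⟩ := hN.exists_bound ha
  have hap := ha.pos
  refine ⟨gnConst d α * S ^ α, fun e he h0 => ?_⟩
  have hn := hN.toReal_pos ha he h0
  have hD := Elt.D_pos_of_ne_zero ha h0
  have hgn := gnConst_nonneg (d := d) ha.pos
  rw [ratio, div_le_iff₀ (by positivity)]
  refine (e.gn ha).trans ?_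
  have h1 : e.I (alphaC d α) ^ (α / alphaC d α) ≤ (S * (N e.u).toReal) ^ α := by
    rw [div_eq_inv_mul, Real.rpow_mul (e.I_nonneg _)]
    exact Real.rpow_le_rpow (Real.rpow_nonneg (e.I_nonneg _) _) (h e he) hap.le
  rw [Real.mul_rpow hS hn.le] at h1
  calc gnConst d α * e.I (alphaC d α) ^ (α / alphaC d α) * e.D
      ≤ gnConst d α * (S ^ α * (N e.u).toReal ^ α) * e.D := by gcongr
    _ = _ := by ring

theorem ratio_pos (hN : CritNorm α N) (ha : Adm d α) {e : Elt d α} (he : N e.u < ⊤)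
    (h0 : e.u ≠ 0) : 0 < ratio N e := by
  have hn := hN.toReal_pos ha he h0
  have hD := Elt.D_pos_of_ne_zero ha h0
  have hI := Elt.I_add_two_pos_of_ne_zero ha h0
  unfold ratio
  positivity

theorem I_eq (hN : CritNorm α N) (ha : Adm d α) {e : Elt d α} (he : N e.u < ⊤) (h0 : e.u ≠ 0) :
    e.I (α + 2) = ratio N e * ((N e.u).toReal ^ α * e.D) := by
  have hn := hN.toReal_pos ha he h0
  have hD := Elt.D_pos_of_ne_zero ha h0
  rw [ratio, div_mul_cancel₀ _ (by positivity)]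

/-- Multiplication and rescaling act on the norms by independent factors. -/
theorem exists_rescale (hN : CritNorm α N) (ha : Adm d α) {e : Elt d α} (he : N e.u < ⊤)
    (h0 : e.u ≠ 0) {c μ : ℝ} (hc : 0 < c) (hμ : 0 < μ) :
    ∃ e' : Elt d α, N e'.u < ⊤ ∧ e'.u ≠ 0 ∧ (N e'.u).toReal = c * (N e.u).toReal ∧
      e'.D = c ^ 2 * μ * e.D ∧ e'.I (α + 2) = c ^ (α + 2) * μ * e.I (α + 2) ∧
      ratio N e' = ratio N e := by
  have hap := ha.pos
  have hγ : 0 < 2 * (2 - gammaC d α) := by linarith [ha.gammaC_lt_two]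
  -- D scales with exponent 2(2 − γ_c) and I with 4(α+2)/α − d, which is the same number. Hence a
  -- single dilation multiplies both by μ, leaves N alone and preserves the quotient.
  set l := μ ^ (2 * (2 - gammaC d α))⁻¹ with hl
  have hl0 : 0 < l := by positivity
  have hlμ : l ^ (2 * (2 - gammaC d α)) = μ := by
    rw [hl, ← Real.rpow_mul hμ.le, inv_mul_cancel₀ hγ.ne', Real.rpow_one]
  have hs := hN.scale hl0 e.u he
  have hs' : N (NL4S.scale α l hl0 e.u) < ⊤ := hs ▸ he
  have hu : (e.scale ha hl0).u = NL4S.scale α l hl0 e.u := rfl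
  set e' := (e.scale ha hl0).smul (c : ℂ) with he'
  have hNe : N e'.u = ENNReal.ofReal c * N e.u := by
    change N ((c : ℂ) • NL4S.scale α l hl0 e.u) = _
    rw [hN.smul _ _ hs', hs, ← ofReal_norm, Complex.norm_real, Real.norm_of_nonneg hc.le]
  have hnc : ‖(c : ℂ)‖ = c := by rw [Complex.norm_real, Real.norm_of_nonneg hc.le]
  have h1 : (N e'.u).toReal = c * (N e.u).toReal := by
    rw [hNe, ENNReal.toReal_mul, ENNReal.toReal_ofReal hc.le]
  have h2 : e'.D = c ^ 2 * μ * e.D := by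
    rw [he', Elt.D_smul, Elt.D_scale, hlμ, hnc, mul_assoc]
  have h3 : e'.I (α + 2) = c ^ (α + 2) * μ * e.I (α + 2) := by
    have hexp : 4 / α * (α + 2) - d = 2 * (2 - gammaC d α) := by
      unfold gammaC
      field_simp
      ring
    rw [he', Elt.I_smul, Elt.I_scale, hexp, hlμ, hnc, mul_assoc]
  refine ⟨e', ?_, ?_, h1, h2, h3, ?_⟩
  · rw [hNe]
    exact ENNReal.mul_lt_top ENNReal.ofReal_lt_top he
  · have h4 := Elt.u_scale_ne_zero ha hl0 h0
    exact smul_ne_zero (by exact_mod_cast hc.ne') h4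
  · have hn := hN.toReal_pos ha he h0
    have hD := Elt.D_pos_of_ne_zero ha h0
    rw [ratio, ratio, h1, h2, h3, Real.mul_rpow hc.le hn.le, Real.rpow_add hc, Real.rpow_two]
    field_simp

theorem exists_normalized (hN : CritNorm α N) (ha : Adm d α) {e : Elt d α} (he : N e.u < ⊤)
    (h0 : e.u ≠ 0) : ∃ e' : Elt d α, N e'.u = 1 ∧ e'.D = 1 ∧ e'.I (α + 2) = ratio N e := by
  have hn := hN.toReal_pos ha he h0
  have hD := Elt.D_pos_of_ne_zero ha h0
  obtain ⟨e', h1, h2, h3, h4, h5, h6⟩ := hN.exists_rescale ha he h0 (inv_pos.2 hn)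
    (μ := (N e.u).toReal ^ 2 / e.D) (by positivity)
  rw [inv_mul_cancel₀ hn.ne'] at h3
  have h7 : e'.D = 1 := by
    rw [h4]
    field_simp
  refine ⟨e', ?_, h7, ?_⟩
  · rw [← ENNReal.ofReal_toReal h1.ne, h3, ENNReal.ofReal_one]
  · rw [← h6, ratio, h3, h7, Real.one_rpow, one_mul, div_one]

/-- Take a maximizing sequence with N = D = 1. Its profiles have N ≤ 1 by lower semicontinuity,
hence satisfy I ≤ C D. Removing a nonzero profile V gives C − I(V) ≤ C(1 − D(V)), so I(V) ≥ C D(V) ≥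
C N(V)^α D(V) and V is a maximizer. It need not carry all of the norm of the sequence. -/
theorem exists_isMax (hN : CritNorm α N) (ha : Adm d α) : ∃ e : Elt d α, IsMax N e := by
  have hap := ha.pos
  set s : Set ℝ := {r | ∃ e : Elt d α, N e.u < ⊤ ∧ e.u ≠ 0 ∧ r = ratio N e} with hs
  have hbdd : BddAbove s := by
    obtain ⟨B, hB⟩ := hN.ratio_bdd ha
    refine ⟨B, ?_⟩
    rintro r ⟨e, h1, h2, rfl⟩
    exact hB e h1 h2
  obtain ⟨e₀, he₀, hfin⟩ := hN.exists_ne_zero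
  have hne : s.Nonempty := ⟨_, e₀, hfin, he₀, rfl⟩
  set C := sSup s with hC
  have hCle : ∀ e : Elt d α, N e.u < ⊤ → e.u ≠ 0 → ratio N e ≤ C :=
    fun e h1 h2 => le_csSup hbdd ⟨e, h1, h2, rfl⟩
  have hC0 : 0 < C := (hN.ratio_pos ha hfin he₀).trans_le (hCle e₀ hfin he₀)
  obtain ⟨r, -, hr, hrs⟩ := exists_seq_tendsto_sSup hne hbdd
  choose w hw1 hw2 hw3 using hrs
  choose e he1 heD heI using fun n => hN.exists_normalized ha (hw1 n) (hw2 n)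
  obtain ⟨S, hS0, hS⟩ := hN.exists_bound ha
  have hq : 0 < alphaC d α := by linarith [ha.two_lt_alphaC]
  have hIq : ∀ n, (e n).I (alphaC d α) ≤ S ^ alphaC d α := by
    intro n
    have h1 := hS (e n) (by rw [he1]; exact ENNReal.one_lt_top)
    rw [he1, ENNReal.toReal_one, mul_one] at h1
    have h2 := Real.rpow_le_rpow (Real.rpow_nonneg ((e n).I_nonneg _) _) h1 hq.le
    rwa [← Real.rpow_mul ((e n).I_nonneg _), inv_mul_cancel₀ hq.ne', Real.rpow_one] at h2
  have hD : Tendsto (fun n => (e n).D) atTop (𝓝 1) := by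
    simp only [heD]
    exact tendsto_const_nhds
  have hI : Tendsto (fun n => (e n).I (α + 2)) atTop (𝓝 C) := by
    simp only [heI, ← hw3]
    exact hr
  have hprof : ∀ W, Elt.IsProfile e W → N W.u ≤ 1 := by
    intro W hW
    refine hN.lsc e W (fun n => (he1 n).le) (fun n => ?_) hW
    have h1 : ‖(e n).h‖ ^ 2 = 1 := heD n
    rw [(e n).hdotNorm_eq ha.one_le, ENNReal.ofReal_le_one]
    nlinarith [norm_nonneg (e n).h]
  have hle : ∀ W, Elt.IsProfile e W → W.u ≠ 0 → W.I (α + 2) ≤ C * ((N W.u).toReal ^ α * W.D) := by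
    intro W hW h0
    have hfinW := (hprof W hW).trans_lt ENNReal.one_lt_top
    have hn := hN.toReal_pos ha hfinW h0
    have hDW := Elt.D_pos_of_ne_zero ha h0
    rw [hN.I_eq ha hfinW h0]
    exact mul_le_mul_of_nonneg_right (hCle W hfinW h0) (by positivity)
  have hn1 : ∀ W, Elt.IsProfile e W → (N W.u).toReal ^ α ≤ 1 := by
    intro W hW
    refine Real.rpow_le_one ENNReal.toReal_nonneg ?_ hap.le
    exact ENNReal.toReal_le_of_le_ofReal zero_le_one (by simpa using hprof W hW)
  obtain ⟨V, hV, hV0, hVle⟩ := Elt.exists_profile_ge ha e hIq hD hI hC0 hC0.le (fun W hW => by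
    by_cases h0 : W.u = 0
    · rw [Elt.I_eq_zero_of_u ha h0 (by linarith)]
      exact mul_nonneg hC0.le W.D_nonneg
    · refine (hle W hW h0).trans (mul_le_mul_of_nonneg_left ?_ hC0.le)
      exact mul_le_of_le_one_left W.D_nonneg (hn1 W hW))
  have hfinV := (hprof V hV).trans_lt ENNReal.one_lt_top
  have hnV := hN.toReal_pos ha hfinV hV0
  have hDV := Elt.D_pos_of_ne_zero ha hV0
  refine ⟨V, hfinV, hV0, fun w h1 h2 => (hCle w h1 h2).trans ?_⟩
  rw [ratio, le_div_iff₀ (by positivity)]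
  calc C * ((N V.u).toReal ^ α * V.D) ≤ C * V.D :=
        mul_le_mul_of_nonneg_left (mul_le_of_le_one_left V.D_nonneg (hn1 V hV)) hC0.le
    _ ≤ V.I (α + 2) := by linarith

/-- A maximizer with the normalization of the Euler–Lagrange equation. -/
theorem exists_isMax_normalized (hN : CritNorm α N) (ha : Adm d α) (θ : ℝ) :
    ∃ e : Elt d α, IsMax N e ∧ 2 * e.I (α + 2) = (α + 2) * e.D ∧
      α * e.I (α + 2) = (α + 2) * (N e.u).toReal ^ θ := by
  have hap := ha.pos
  obtain ⟨e, he, h0, hmax⟩ := hN.exists_isMax ha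
  have hn := hN.toReal_pos ha he h0
  have hD := Elt.D_pos_of_ne_zero ha h0
  have hI := Elt.I_add_two_pos_of_ne_zero ha h0
  -- The amplitude c alone decides the first identity, since the dilation multiplies I and D by the
  -- same μ. Then μ is solved from the second identity, whose right side does not involve μ.
  set c := ((α + 2) * e.D / (2 * e.I (α + 2))) ^ α⁻¹ with hc
  have hc0 : 0 < c := by positivity
  have hcα : c ^ α = (α + 2) * e.D / (2 * e.I (α + 2)) := by
    rw [hc, ← Real.rpow_mul (by positivity), inv_mul_cancel₀ hap.ne', Real.rpow_one]
  set μ := (α + 2) * (c * (N e.u).toReal) ^ θ / (α * (c ^ (α + 2) * e.I (α + 2))) with hμ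
  obtain ⟨e', h1, h2, h3, h4, h5, h6⟩ := hN.exists_rescale ha he h0 hc0 (μ := μ) (by positivity)
  refine ⟨e', ⟨h1, h2, fun w hw hw0 => h6 ▸ hmax w hw hw0⟩, ?_, ?_⟩
  · rw [h4, h5, Real.rpow_add hc0, Real.rpow_two, hcα]
    field_simp
  · rw [h5, h3, hμ]
    field_simp

theorem quotient_eq (hN : CritNorm α N) (ha : Adm d α) {e : Elt d α} (he : N e.u < ⊤)
    (h0 : e.u ≠ 0) :
    lpNorm (α + 2) e.u ^ (α + 2) / (N e.u ^ α * hdotNorm 2 e.u ^ 2)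
      = ENNReal.ofReal (ratio N e) := by
  have hap := ha.pos
  have hn := hN.toReal_pos ha he h0
  have hD := Elt.D_pos_of_ne_zero ha h0
  have hI := e.I_nonneg (α + 2)
  have hD' : e.D = ‖e.h‖ ^ 2 := rfl
  rw [e.lpNorm_add_two ha, e.hdotNorm_eq ha.one_le, ENNReal.ofReal_rpow_of_nonneg (by positivity)
    (by linarith), ← Real.rpow_mul hI, inv_mul_cancel₀ (by linarith), Real.rpow_one,
    ← ENNReal.ofReal_pow (norm_nonneg _), ← hD', ← ENNReal.ofReal_toReal he.ne,
    ENNReal.ofReal_rpow_of_pos hn, ← ENNReal.ofReal_mul (by positivity),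
    ← ENNReal.ofReal_div_of_pos (by positivity)]
  rfl

theorem isMaximizer_iff (hN : CritNorm α N) (ha : Adm d α) (e : Elt d α) :
    IsMaximizer (fun u => N u + hdotNorm 2 u)
      (fun u => lpNorm (α + 2) u ^ (α + 2) / (N u ^ α * hdotNorm 2 u ^ 2)) e.u ↔ IsMax N e := by
  constructor
  · rintro ⟨h1, h2, h3⟩
    have h1' := (ENNReal.add_lt_top.1 h1).1
    refine ⟨h1', h2, fun w hw hw0 => ?_⟩
    have h4 := h3 w.u (ENNReal.add_lt_top.2 ⟨hw, w.hdotNorm_two_lt_top⟩) hw0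
    beta_reduce at h4
    rw [hN.quotient_eq ha hw hw0, hN.quotient_eq ha h1' h2] at h4
    exact (ENNReal.ofReal_le_ofReal_iff (hN.ratio_pos ha h1' h2).le).1 h4
  · rintro ⟨h1, h2, h3⟩
    refine ⟨ENNReal.add_lt_top.2 ⟨h1, e.hdotNorm_two_lt_top⟩, h2, fun w hw hw0 => ?_⟩
    obtain ⟨S, hS⟩ := hN.exists_elt
    obtain ⟨w, rfl, -⟩ := hS w hw
    have hw' := (ENNReal.add_lt_top.1 hw).1
    beta_reduce
    rw [hN.quotient_eq ha hw' hw0, hN.quotient_eq ha h1 h2]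
    exact ENNReal.ofReal_le_ofReal (h3 w hw' hw0)

end CritNorm

/-! ### First variation and the Euler–Lagrange equations -/

theorem hasDerivAt_norm_add_rpow {r : ℝ} (hr : 1 < r) (a b : ℂ) (t : ℝ) :
    HasDerivAt (fun t : ℝ => ‖a + t * b‖ ^ r)
      (r * ‖a + t * b‖ ^ (r - 2) * inner ℝ (a + t * b) b) t := by
  have h1 : HasDerivAt (fun t : ℝ => a + t * b) b t := by
    have := ((Complex.ofRealCLM.hasDerivAt (x := t)).mul_const b).const_add a
    simpa using this
  have h2 := (hasFDerivAt_norm_rpow (a + t * b) hr).comp_hasDerivAt t h1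
  simp only [FunLike.coe_smul, Pi.smul_apply, innerSL_apply_apply, smul_eq_mul] at h2
  exact h2

/-- Provides the dominating function for differentiating ∫|f + tψ|^r under the integral. For r < 2
the power |v|^{r−2} is singular at v = 0, but there the inner product vanishes; elsewhere
Cauchy–Schwarz leaves |v|^{r−1}|b|. -/
theorem abs_deriv_norm_rpow_le {r : ℝ} (hr : 1 < r) (v b : ℂ) {m : ℝ} (hv : ‖v‖ ≤ m)
    (hb : ‖b‖ ≤ m) : ‖r * ‖v‖ ^ (r - 2) * inner ℝ v b‖ ≤ r * m ^ r := by
  have hm : 0 ≤ m := (norm_nonneg v).trans hv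
  rw [norm_mul, norm_mul, Real.norm_of_nonneg (by linarith), Real.norm_of_nonneg (by positivity),
    mul_assoc]
  refine mul_le_mul_of_nonneg_left ?_ (by linarith)
  rcases (norm_nonneg v).eq_or_lt with h0 | h0
  · rw [norm_eq_zero.1 h0.symm, inner_zero_left, norm_zero, norm_zero, mul_zero]
    positivity
  · have hm0 : 0 < m := h0.trans_le hv
    calc ‖v‖ ^ (r - 2) * ‖inner ℝ v b‖ ≤ ‖v‖ ^ (r - 2) * (‖v‖ * ‖b‖) := by
          gcongr
          exact norm_inner_le_norm v b
      _ = ‖v‖ ^ (r - 1) * ‖b‖ := by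
          rw [← mul_assoc, ← Real.rpow_add_one h0.ne']
          congr 2
          ring
      _ ≤ m ^ (r - 1) * m := by gcongr
      _ = m ^ r := by rw [← Real.rpow_add_one hm0.ne', sub_add_cancel]

/-- The derivative of the `r`-th power of the `L^r` norm along a line. -/
theorem hasDerivAt_integral_norm_add_rpow {r : ℝ} (hr : 1 < r) {f ψ : E d → ℂ}
    (hf : MemLp f (ENNReal.ofReal r) volume) (hψ : MemLp ψ (ENNReal.ofReal r) volume) :
    HasDerivAt (fun t : ℝ => ∫ x, ‖f x + t * ψ x‖ ^ r)
      (r * ∫ x, ‖f x‖ ^ (r - 2) * inner ℝ (f x) (ψ x)) 0 := by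
  have hr0 : 0 < r := by linarith
  have hmeas : ∀ t : ℝ, AEStronglyMeasurable (fun x => f x + t * ψ x) volume :=
    fun t => hf.1.add (hψ.1.const_mul _)
  have hG : MemLp (fun x => ((‖f x‖ + ‖ψ x‖ : ℝ) : ℂ)) (ENNReal.ofReal r) volume :=
    (hf.norm.add hψ.norm).ofReal
  have hGi : Integrable fun x => r * (‖f x‖ + ‖ψ x‖) ^ r := by
    refine ((Elt.integrable_rpow hr0 hG).const_mul r).congr (Eventually.of_forall fun x => ?_)
    simp only
    rw [Complex.norm_real, Real.norm_of_nonneg (by positivity)]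
  have hm : ∀ t : ℝ, AEStronglyMeasurable (fun x => ‖f x + t * ψ x‖ ^ r) volume := by
    intro t
    exact ((hmeas t).norm.aemeasurable.pow_const r).aestronglyMeasurable
  have key := hasDerivAt_integral_of_dominated_loc_of_deriv_le (μ := volume)
    (F := fun (t : ℝ) x => ‖f x + t * ψ x‖ ^ r)
    (F' := fun (t : ℝ) x => r * ‖f x + t * ψ x‖ ^ (r - 2) * inner ℝ (f x + t * ψ x) (ψ x))
    (x₀ := 0) (bound := fun x => r * (‖f x‖ + ‖ψ x‖) ^ r) (Metric.ball_mem_nhds 0 one_pos)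
    (Eventually.of_forall hm) ?_ ?_ ?_ hGi ?_
  · have h2 := key.2
    simp only [Complex.ofReal_zero, zero_mul, add_zero, mul_assoc] at h2
    rwa [integral_const_mul] at h2
  · simpa using Elt.integrable_rpow hr0 hf
  · have h1 := (hmeas 0)
    exact (((h1.norm.aemeasurable.pow_const (r - 2)).aestronglyMeasurable.const_mul r)).mul
      (h1.inner hψ.1)
  · refine Eventually.of_forall fun x t ht => abs_deriv_norm_rpow_le hr _ _ ?_ ?_
    · refine (norm_add_le _ _).trans (add_le_add le_rfl ?_)
      rw [norm_mul, Complex.norm_real]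
      refine mul_le_of_le_one_left (norm_nonneg _) ?_
      simpa using (mem_ball_zero_iff.1 ht).le
    · linarith [norm_nonneg (f x)]
  · exact Eventually.of_forall fun x t ht => hasDerivAt_norm_add_rpow hr _ _ t

theorem hasDerivAt_norm_add_sq {H : Type*} [NormedAddCommGroup H] [InnerProductSpace ℂ H]
    (h k : H) : HasDerivAt (fun t : ℝ => ‖h + (t : ℂ) • k‖ ^ 2) (2 * (inner ℂ h k : ℂ).re) 0 := by
  have h1 : ∀ t : ℝ, ‖h + (t : ℂ) • k‖ ^ 2
      = ‖h‖ ^ 2 + t * (2 * (inner ℂ h k : ℂ).re) + t ^ 2 * ‖k‖ ^ 2 := by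
    intro t
    have h2 := @norm_add_sq ℂ _ _ _ _ h ((t : ℂ) • k)
    rw [inner_smul_right, norm_smul, Complex.norm_real, mul_pow, Real.norm_eq_abs, sq_abs] at h2
    rw [h2]
    simp only [RCLike.re_to_complex, Complex.re_ofReal_mul]
    ring
  simp only [h1]
  have h3 := (((hasDerivAt_id (0 : ℝ)).mul_const (2 * (inner ℂ h k : ℂ).re)).const_add (‖h‖ ^ 2)).add
    (((hasDerivAt_id (0 : ℝ)).pow 2).mul_const (‖k‖ ^ 2))
  simp only [id, one_mul, mul_zero, Nat.cast_ofNat,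
    Nat.add_one_sub_one, pow_one, zero_mul, add_zero] at h3
  exact h3

theorem Elt.add_smul_zero_u {α : ℝ} (ha : Adm d α) (e ψ : Elt d α) :
    (e.add ha (ψ.smul ((0 : ℝ) : ℂ))).u = e.u := by
  ext φ
  change e.u φ + ((0 : ℝ) : ℂ) * ψ.u φ = e.u φ
  rw [Complex.ofReal_zero, zero_mul, add_zero]

namespace CritNorm

variable {α : ℝ} {N : S0Dual d → ℝ≥0∞}

/-- The first variation of the quotient at a maximizer vanishes. -/
theorem IsMax.first_variation (hN : CritNorm α N) (ha : Adm d α) {e : Elt d α} (he : IsMax N e)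
    (ψ : Elt d α) (hfin : ∀ t : ℝ, N (e.add ha (ψ.smul (t : ℂ))).u < ⊤) {a' : ℝ}
    (hA : HasDerivAt (fun t : ℝ => (N (e.add ha (ψ.smul (t : ℂ))).u).toReal ^ α) a' 0) :
    ratio N e * (a' * e.D + (N e.u).toReal ^ α * (2 * (inner ℂ e.h ψ.h : ℂ).re))
      = (α + 2) * ∫ x, ‖e.f x‖ ^ α * inner ℝ (e.f x) (ψ.f x) := by
  have hap := ha.pos
  have hD : HasDerivAt (fun t : ℝ => (e.add ha (ψ.smul (t : ℂ))).D)
      (2 * (inner ℂ e.h ψ.h : ℂ).re) 0 := by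
    have := hasDerivAt_norm_add_sq e.h ψ.h
    simp only [Elt.D, Elt.h_add, Elt.h_smul]
    exact this
  have hI : HasDerivAt (fun t : ℝ => (e.add ha (ψ.smul (t : ℂ))).I (α + 2))
      ((α + 2) * ∫ x, ‖e.f x‖ ^ α * inner ℝ (e.f x) (ψ.f x)) 0 := by
    have := hasDerivAt_integral_norm_add_rpow ha.one_lt (e.memLp_add_two ha) (ψ.memLp_add_two ha)
    rw [add_sub_cancel_right] at this
    exact this
  have hu0 := e.add_smul_zero_u ha ψ
  have hG := ((hA.mul hD).const_mul (ratio N e)).sub hI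
  -- Instead of differentiating the quotient: with C the maximal ratio, C N^α D − I is nonnegative
  -- along the line and zero at t = 0.
  have hmin : IsLocalMin (fun t : ℝ => ratio N e * ((N (e.add ha (ψ.smul (t : ℂ))).u).toReal ^ α
      * (e.add ha (ψ.smul (t : ℂ))).D) - (e.add ha (ψ.smul (t : ℂ))).I (α + 2)) 0 := by
    refine Eventually.of_forall fun t => ?_
    simp only
    rw [hu0, Elt.D_congr ha hu0, Elt.I_congr ha hu0, ← hN.I_eq ha he.1 he.2.1, sub_self, sub_nonneg]
    by_cases h0 : (e.add ha (ψ.smul (t : ℂ))).u = 0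
    · rw [Elt.I_eq_zero_of_u ha h0 (by linarith)]
      have := (hN.ratio_pos ha he.1 he.2.1).le
      have := (e.add ha (ψ.smul (t : ℂ))).D_nonneg
      positivity
    · rw [hN.I_eq ha (hfin t) h0]
      have := (e.add ha (ψ.smul (t : ℂ))).D_nonneg
      exact mul_le_mul_of_nonneg_right (he.2.2 _ (hfin t) h0) (by positivity)
  have h0 := hmin.hasDerivAt_eq_zero hG
  rw [hu0, Elt.D_congr ha hu0] at h0
  linarith

/-- The first variation, with the derivative of a power of the norm. -/
theorem IsMax.euler_lagrange (hN : CritNorm α N) (ha : Adm d α) {e : Elt d α} (he : IsMax N e)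
    (ψ : Elt d α) (hfin : ∀ t : ℝ, N (e.add ha (ψ.smul (t : ℂ))).u < ⊤) {θ ρ : ℝ} (hθ : 0 < θ)
    (hA : HasDerivAt (fun t : ℝ => (N (e.add ha (ψ.smul (t : ℂ))).u).toReal ^ θ) (θ * ρ) 0) :
    α * e.I (α + 2) / (N e.u).toReal ^ θ * ρ
        + 2 * e.I (α + 2) / e.D * (inner ℂ e.h ψ.h : ℂ).re
      = (α + 2) * ∫ x, ‖e.f x‖ ^ α * inner ℝ (e.f x) (ψ.f x) := by
  have hap := ha.pos
  have hn := hN.toReal_pos ha he.1 he.2.1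
  have hD := Elt.D_pos_of_ne_zero ha he.2.1
  have hu0 := e.add_smul_zero_u ha ψ
  set n := (N e.u).toReal with hndef
  -- N^α is written as (N^θ)^{α/θ}, so only the power of the norm that is convenient to
  -- differentiate is needed: θ = 2 for the Hilbert norm and θ = α_c for the Lebesgue norm.
  have hA' : HasDerivAt (fun t : ℝ => (N (e.add ha (ψ.smul (t : ℂ))).u).toReal ^ α)
      (θ * ρ * (α / θ) * (n ^ θ) ^ (α / θ - 1)) 0 := by
    have h1 := hA.rpow_const (p := α / θ) (Or.inl (by rw [hu0]; positivity))
    rw [hu0] at h1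
    refine h1.congr_of_eventuallyEq (Eventually.of_forall fun t => ?_)
    beta_reduce
    rw [← Real.rpow_mul ENNReal.toReal_nonneg, mul_div_cancel₀ _ hθ.ne']
  have h2 := he.first_variation hN ha ψ hfin hA'
  rw [← h2, hN.I_eq ha he.1 he.2.1, ← hndef, Real.rpow_sub (by positivity), Real.rpow_one,
    ← Real.rpow_mul hn.le, mul_div_cancel₀ _ hθ.ne']
  field_simp

end CritNorm

section EulerLagrange

variable {α : ℝ}

theorem lpNorm_smul (hd : 1 ≤ d) {q : ℝ} (hq : 1 < q) {u : S0Dual d} (h : lpNorm q u < ⊤) (c : ℂ) :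
    lpNorm q (c • u) = ‖c‖ₑ * lpNorm q u := by
  obtain ⟨f, hf⟩ := exists_of_lpNorm_lt_top h
  rw [lpNorm_eq hd hq hf, lpNorm_eq hd hq (hf.smul c), ← eLpNorm_const_smul]
  rfl

theorem lpNorm_alphaC_scale (ha : Adm d α) {l : ℝ} (hl : 0 < l) {u : S0Dual d}
    (h : lpNorm (alphaC d α) u < ⊤) :
    lpNorm (alphaC d α) (scale α l hl u) = lpNorm (alphaC d α) u := by
  have hq := ha.one_lt_alphaC
  have hq0 : 0 < alphaC d α := by linarith
  obtain ⟨f, hf⟩ := exists_of_lpNorm_lt_top h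
  rw [lpNorm_eq ha.one_le hq hf, lpNorm_eq ha.one_le hq (hf.scale α hl hq0)]
  have h1 := eLpNorm_const_smul ((l ^ (4 / α) : ℝ) : ℂ) (fun x : E d => f (l • x))
    (ENNReal.ofReal (alphaC d α)) volume
  refine h1.trans ?_
  rw [eLpNorm_comp_dil hl hq0, ← ofReal_norm, Complex.norm_real,
    Real.norm_of_nonneg (by positivity), ← mul_assoc, ← ENNReal.ofReal_mul (by positivity),
    ← Real.rpow_add hl, ha.div_alphaC, add_neg_cancel, Real.rpow_zero, ENNReal.ofReal_one, one_mul]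

theorem Elt.lpNorm_lt_top (e : Elt d α) : lpNorm (alphaC d α) e.u < ⊤ :=
  (iInf₂_le _ e.hf).trans_lt e.hf.2.2

theorem Elt.lpNorm_le_one_iff (ha : Adm d α) (e : Elt d α) :
    lpNorm (alphaC d α) e.u ≤ 1 ↔ e.I (alphaC d α) ≤ 1 := by
  have hq : 0 < alphaC d α := by linarith [ha.two_lt_alphaC]
  rw [e.lpNorm_alphaC ha, ENNReal.ofReal_le_one]
  constructor
  · intro h
    have h1 := Real.rpow_le_one (Real.rpow_nonneg (e.I_nonneg _) _) h hq.le
    rwa [← Real.rpow_mul (e.I_nonneg _), inv_mul_cancel₀ hq.ne', Real.rpow_one] at h1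
  · intro h
    exact Real.rpow_le_one (e.I_nonneg _) h (by positivity)

/-- Lower semicontinuity along profiles is the consequence `Elt.IsProfile.I_le` of Brezis–Lieb;
scale invariance is d/α_c = 4/α. -/
theorem critNorm_lp (ha : Adm d α) : CritNorm α (lpNorm (d := d) (alphaC d α)) where
  exists_elt := ⟨1, fun u hu => by
    obtain ⟨e, he⟩ := Elt.exists_of_lebNorm (u := u) hu
    exact ⟨e, he, by simp⟩⟩
  smul c u h := lpNorm_smul ha.one_le ha.one_lt_alphaC h c
  scale hl u h := lpNorm_alphaC_scale ha hl h
  lsc e V h1 h2 hV := by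
    rw [V.lpNorm_le_one_iff ha]
    refine hV.I_le ha (M := 1) (fun n => ((e n).lpNorm_le_one_iff ha).1 (h1 n)) fun n => ?_
    have := h2 n
    rw [(e n).hdotNorm_eq ha.one_le, ENNReal.ofReal_le_one] at this
    rw [Elt.D]
    nlinarith [norm_nonneg (e n).h]
  exists_ne_zero := by
    obtain ⟨ψ, hψ⟩ := Elt.exists_ofSchwartz_ne_zero ha
    exact ⟨_, hψ, Elt.lpNorm_lt_top _⟩

/-- Here lower semicontinuity is that of a Hilbert norm under weak convergence, and the passage to
elements of L^{α_c} ∩ Ḣ² is the Sobolev embedding. -/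
theorem critNorm_hdot (ha : Adm d α) : CritNorm α (hdotNorm (d := d) (gammaC d α)) where
  exists_elt := ⟨Real.toNNReal (sobConst d (gammaC d α) (alphaC d α)), fun u hu => by
    obtain ⟨e, he, -, h⟩ := Elt.exists_of_sobNorm ha (u := u) hu
    exact ⟨e, he, h⟩⟩
  smul c u h := hdotNorm_smul ha.one_le h c
  scale hl u h := by rw [hdotNorm_scale ha.one_le α hl h, sub_self, Real.rpow_zero,
    ENNReal.ofReal_one, one_mul]
  lsc e V h1 h2 hV := by
    refine (hV.exists_weakConv ha.one_le (C := 2) (S := 1) (fun n => ?_) (by simpa using h1)).1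
    refine (add_le_add (h1 n) (h2 n)).trans (le_of_eq ?_)
    norm_num
  exists_ne_zero := by
    obtain ⟨ψ, hψ⟩ := Elt.exists_ofSchwartz_ne_zero ha
    refine ⟨_, hψ, ?_⟩
    have := Elt.ofSchwartz_isHdotFourier ha ψ ha.gammaC_pos.le
    exact (iInf₂_le _ this).trans_lt this.2.2

theorem memLp_rpow_mul {r : ℝ} (hr : 2 ≤ r) {f : E d → ℂ}
    (hf : MemLp f (ENNReal.ofReal r) volume) :
    MemLp (fun x => ((‖f x‖ ^ (r - 2) : ℝ) : ℂ) * f x) (dualExp r) volume := by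
  have h1 := hf.norm_rpow_div (ENNReal.ofReal (r - 1))
  rw [ENNReal.toReal_ofReal (by linarith), ← ENNReal.ofReal_div_of_pos (by linarith)] at h1
  refine (memLp_congr_norm h1.1 ?_ (Eventually.of_forall fun x => ?_)).1 h1
  · exact (Complex.measurable_ofReal.comp_aemeasurable
      (hf.1.norm.aemeasurable.pow_const (r - 2))).aestronglyMeasurable.mul hf.1
  · rw [norm_mul, Complex.norm_real, Real.norm_of_nonneg (by positivity),
      Real.norm_of_nonneg (by positivity)]
    rcases (norm_nonneg (f x)).eq_or_lt with h0 | h0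
    · rw [← h0, Real.zero_rpow (by linarith), mul_zero]
    · rw [← Real.rpow_add_one h0.ne']
      congr 1
      ring

theorem integrable_rpow_mul_schwartz {r : ℝ} (hr : 2 ≤ r) {f : E d → ℂ}
    (hf : MemLp f (ENNReal.ofReal r) volume) (φ : 𝓢(E d, ℂ)) :
    Integrable fun x => ((‖f x‖ ^ (r - 2) : ℝ) : ℂ) * f x * φ x := by
  have := (holderConjugate_dualExp (q := r) (by linarith)).symm
  exact integrable_mul_memLp (memLp_rpow_mul hr hf) (φ.memLp (ENNReal.ofReal r) volume)

/-- Varying in the direction of the conjugate of φ turns the real inner product in the first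
variation into the real part of the bilinear pairing with φ used in the weak form of the equation.
-/
theorem integral_inner_conjS {r : ℝ} (hr : 2 ≤ r) {f : E d → ℂ}
    (hf : MemLp f (ENNReal.ofReal r) volume) (φ : 𝓢(E d, ℂ)) :
    ∫ x, ‖f x‖ ^ (r - 2) * inner ℝ (f x) (conjS φ x)
      = (∫ x, ((‖f x‖ ^ (r - 2) : ℝ) : ℂ) * f x * φ x).re := by
  have h1 := integral_re (integrable_rpow_mul_schwartz hr hf φ)
  simp only [RCLike.re_to_complex] at h1
  rw [← h1]
  congr 1
  ext x
  rw [mul_assoc, Complex.re_ofReal_mul, conjS_apply, Complex.inner]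
  congr 1
  rw [RCLike.star_def, ← map_mul, Complex.conj_re, mul_comm]

theorem inner_symb_conjS (hd : 1 ≤ d) {s : ℝ} (hs : 0 ≤ s) {g : E d → ℂ}
    (hg : MemLp (fun ξ => symb s ξ * g ξ) 2 volume) (φ : 𝓢(E d, ℂ)) :
    (inner ℂ hg.toLp (memLp_symb_mul_schwartz hs (𝓕 (conjS φ))).toLp : ℂ).re
      = (∫ ξ, symb (2 * s) ξ * g ξ * (𝓕⁻ φ : 𝓢(E d, ℂ)) ξ).re := by
  have h1 := inner_re_symm (𝕜 := ℂ) hg.toLp (memLp_symb_mul_schwartz hs (𝓕 (conjS φ))).toLp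
  simp only [RCLike.re_to_complex] at h1
  rw [h1, L2.inner_def]
  congr 1
  refine integral_congr_ae ?_
  filter_upwards [hg.coeFn_toLp, (memLp_symb_mul_schwartz hs (𝓕 (conjS φ))).coeFn_toLp,
    ae_ne_zero hd] with ξ h2 h3 h4
  rw [h2, h3, RCLike.inner_apply, fourier_conjS, two_mul, symb_add _ _ h4, map_mul,
    RCLike.star_def, starRingEnd_self_apply]
  have : (starRingEnd ℂ) (symb s ξ) = symb s ξ := Complex.conj_ofReal _
  rw [this]
  ring

/-- Two complex linear expressions agree if their real parts do. -/
theorem eq_of_re_eq {A B : 𝓢(E d, ℂ) → ℂ} (hA : ∀ φ, A (Complex.I • φ) = Complex.I * A φ)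
    (hB : ∀ φ, B (Complex.I • φ) = Complex.I * B φ) (h : ∀ φ, (A φ).re = (B φ).re)
    (φ : 𝓢(E d, ℂ)) : A φ = B φ := by
  refine Complex.ext (h φ) ?_
  have h1 := h (Complex.I • φ)
  rw [hA, hB] at h1
  simpa using h1

theorem integral_mul_smul (F : E d → ℂ) (φ : 𝓢(E d, ℂ)) (c : ℂ) :
    ∫ x, F x * (c • φ) x = c * ∫ x, F x * φ x := by
  rw [← integral_const_mul]
  congr 1
  ext x
  rw [smul_apply, smul_eq_mul]
  ring

theorem integral_mul_fourierInv_smul (F : E d → ℂ) (φ : 𝓢(E d, ℂ)) (c : ℂ) :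
    ∫ x, F x * (𝓕⁻ (c • φ) : 𝓢(E d, ℂ)) x = c * ∫ x, F x * (𝓕⁻ φ : 𝓢(E d, ℂ)) x := by
  have : (𝓕⁻ (c • φ) : 𝓢(E d, ℂ)) = c • 𝓕⁻ φ :=
    map_smul (FourierTransform.fourierInvCLM ℂ 𝓢(E d, ℂ)) c φ
  rw [this, integral_mul_smul]

/-- The Euler–Lagrange equation in `L^{α_c} ∩ Ḣ²`. -/
theorem euler_lagrange_lp (ha : Adm d α) {e : Elt d α}
    (he : CritNorm.IsMax (lpNorm (alphaC d α)) e) (φ : 𝓢(E d, ℂ)) :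
    ((α * e.I (α + 2) / (lpNorm (alphaC d α) e.u).toReal ^ alphaC d α : ℝ) : ℂ)
        * (∫ x, ((‖e.f x‖ ^ (alphaC d α - 2) : ℝ) : ℂ) * e.f x * φ x)
      + ((2 * e.I (α + 2) / e.D : ℝ) : ℂ)
        * (∫ ξ, symb 4 ξ * e.g ξ * (𝓕⁻ φ : 𝓢(E d, ℂ)) ξ)
      = ((α + 2 : ℝ) : ℂ) * ∫ x, ((‖e.f x‖ ^ α : ℝ) : ℂ) * e.f x * φ x := by
  have hap := ha.pos
  have hq := ha.two_lt_alphaC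
  revert φ
  refine eq_of_re_eq (fun φ => ?_) (fun φ => ?_) fun φ => ?_
  · rw [integral_mul_smul, integral_mul_fourierInv_smul]
    ring
  · rw [integral_mul_smul]
    ring
  · set ψ := Elt.ofSchwartz ha (conjS φ) with hψ
    have hpow : ∀ w : Elt d α, (lpNorm (alphaC d α) w.u).toReal ^ alphaC d α = w.I (alphaC d α) := by
      intro w
      have := w.I_nonneg (alphaC d α)
      rw [w.lpNorm_alphaC ha, ENNReal.toReal_ofReal (by positivity), ← Real.rpow_mul this,
        inv_mul_cancel₀ (by linarith), Real.rpow_one]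
    have h1 := he.euler_lagrange (critNorm_lp ha) ha ψ (fun t => Elt.lpNorm_lt_top _)
      (θ := alphaC d α) (ρ := ∫ x, ‖e.f x‖ ^ (alphaC d α - 2) * inner ℝ (e.f x) (ψ.f x))
      (by linarith) (by
        simp only [hpow]
        exact hasDerivAt_integral_norm_add_rpow ha.one_lt_alphaC e.hf.2 ψ.hf.2)
    have h2 := integral_inner_conjS hq.le e.hf.2 φ
    have h3 := integral_inner_conjS (r := α + 2) (by linarith) (e.memLp_add_two ha) φ
    rw [add_sub_cancel_right] at h3
    have h4 := inner_symb_conjS ha.one_le zero_le_two e.hg.2 φ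
    norm_num only at h4
    change _ * (∫ x, ‖e.f x‖ ^ (alphaC d α - 2) * inner ℝ (e.f x) (conjS φ x)) +
      _ * (inner ℂ e.hg.2.toLp (memLp_symb_mul_schwartz zero_le_two (𝓕 (conjS φ))).toLp : ℂ).re
      = _ * ∫ x, ‖e.f x‖ ^ α * inner ℝ (e.f x) (conjS φ x) at h1
    rw [h2, h3, h4] at h1
    rw [Complex.add_re, Complex.re_ofReal_mul, Complex.re_ofReal_mul, Complex.re_ofReal_mul, h1]

/-- The Euler–Lagrange equation in `Ḣ^{γ_c} ∩ Ḣ²`. -/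
theorem euler_lagrange_hdot (ha : Adm d α) {e : Elt d α}
    (he : CritNorm.IsMax (hdotNorm (gammaC d α)) e) (φ : 𝓢(E d, ℂ)) :
    ((α * e.I (α + 2) / (hdotNorm (gammaC d α) e.u).toReal ^ (2 : ℝ) : ℝ) : ℂ)
        * (∫ ξ, symb (2 * gammaC d α) ξ * e.g ξ * (𝓕⁻ φ : 𝓢(E d, ℂ)) ξ)
      + ((2 * e.I (α + 2) / e.D : ℝ) : ℂ)
        * (∫ ξ, symb 4 ξ * e.g ξ * (𝓕⁻ φ : 𝓢(E d, ℂ)) ξ)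
      = ((α + 2 : ℝ) : ℂ) * ∫ x, ((‖e.f x‖ ^ α : ℝ) : ℂ) * e.f x * φ x := by
  have hap := ha.pos
  have hγ0 := ha.gammaC_pos.le
  have heγ := e.hg.of_hdot ha.one_le he.1
  revert φ
  refine eq_of_re_eq (fun φ => ?_) (fun φ => ?_) fun φ => ?_
  · rw [integral_mul_fourierInv_smul, integral_mul_fourierInv_smul]
    ring
  · rw [integral_mul_smul]
    ring
  · set ψ := Elt.ofSchwartz ha (conjS φ) with hψ
    have hψγ := Elt.ofSchwartz_isHdotFourier ha (conjS φ) hγ0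
    have hadd : ∀ t : ℝ, IsHdotFourier (gammaC d α) (e.add ha (ψ.smul (t : ℂ))).u
        (e.add ha (ψ.smul (t : ℂ))).g := by
      intro t
      refine ⟨(e.add ha (ψ.smul (t : ℂ))).hg.1, (heγ.2.add (hψγ.2.const_mul (t : ℂ))).ae_eq
        (Eventually.of_forall fun ξ => ?_)⟩
      simp only [Pi.add_apply, Elt.add, Elt.smul]
      ring
    have hnorm : ∀ t : ℝ, (hdotNorm (gammaC d α) (e.add ha (ψ.smul (t : ℂ))).u).toReal
        = ‖heγ.2.toLp + (t : ℂ) • hψγ.2.toLp‖ := by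
      intro t
      rw [hdotNorm_eq ha.one_le (hadd t), Lp.norm_def]
      congr 1
      refine eLpNorm_congr_ae ?_
      filter_upwards [heγ.2.coeFn_toLp, hψγ.2.coeFn_toLp,
        Lp.coeFn_add heγ.2.toLp ((t : ℂ) • hψγ.2.toLp), Lp.coeFn_smul (t : ℂ) hψγ.2.toLp]
        with ξ h1 h2 h3 h4
      rw [h3, Pi.add_apply, h4, Pi.smul_apply, h1, h2]
      simp only [Elt.add, Elt.smul, smul_eq_mul]
      ring
    have h1 := he.euler_lagrange (critNorm_hdot ha) ha ψ
      (fun t => (iInf₂_le _ (hadd t)).trans_lt (hadd t).2.2)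
      (θ := 2) (ρ := (inner ℂ heγ.2.toLp hψγ.2.toLp : ℂ).re) two_pos (by
        simp only [hnorm, Real.rpow_two]
        exact hasDerivAt_norm_add_sq _ _)
    have h3 := integral_inner_conjS (r := α + 2) (by linarith) (e.memLp_add_two ha) φ
    rw [add_sub_cancel_right] at h3
    have h4 := inner_symb_conjS ha.one_le zero_le_two e.hg.2 φ
    have h5 := inner_symb_conjS ha.one_le hγ0 heγ.2 φ
    norm_num only at h4
    change _ * (inner ℂ heγ.2.toLp (memLp_symb_mul_schwartz hγ0 (𝓕 (conjS φ))).toLp : ℂ).re +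
      _ * (inner ℂ e.hg.2.toLp (memLp_symb_mul_schwartz zero_le_two (𝓕 (conjS φ))).toLp : ℂ).re
      = _ * ∫ x, ‖e.f x‖ ^ α * inner ℝ (e.f x) (conjS φ x) at h1
    rw [h5, h3, h4] at h1
    rw [Complex.add_re, Complex.re_ofReal_mul, Complex.re_ofReal_mul, Complex.re_ofReal_mul, h1]

end EulerLagrange

/-! ### Ground states and the common value of their norm -/

section GroundStates

variable {α : ℝ}

/-- Sums of functions in Lebesgue spaces contain no nonzero polynomials. -/
theorem add_ae_eq_zero_of_S0 (hd : 1 ≤ d) {p q : ℝ} (hp : 1 < p) (hq : 1 < q) {f g : E d → ℂ}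
    (hf : MemLp f (ENNReal.ofReal p) volume) (hg : MemLp g (ENNReal.ofReal q) volume)
    (h : ∀ φ : S0 d, ∫ x, (f x + g x) * (φ : 𝓢(E d, ℂ)) x = 0) :
    (fun x => f x + g x) =ᵐ[volume] 0 := by
  have hd0 : (0 : ℝ) < d := by exact_mod_cast hd
  have hloc : LocallyIntegrable (fun x => f x + g x) volume :=
    (hf.locallyIntegrable (by simpa using hp.le)).add (hg.locallyIntegrable (by simpa using hq.le))
  refine ae_eq_zero_of_schwartz hloc fun φ => ?_
  -- The low-frequency part of each summand tends to 0 by Bernstein in its own Lebesgue space, so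
  -- the sum vanishes on all Schwartz functions and not only on 𝒮₀.
  have key : ∀ {r : ℝ} (_ : 1 < r) {F : E d → ℂ} (_ : MemLp F (ENNReal.ofReal r) volume),
      Tendsto (fun n : ℕ => ∫ x, F x * conv (𝓕 (cutoff (1 / ((n : ℝ) + 1))
        Nat.one_div_pos_of_nat)) φ x) atTop (𝓝 0) := by
    intro r hr F hF
    set B := (eLpNorm F (ENNReal.ofReal r) volume).toReal * kerNorm d r * ∫ x, ‖φ x‖ with hB
    have hlim : Tendsto (fun n : ℕ => B * (1 / ((n : ℝ) + 1)) ^ (d / r : ℝ)) atTop (𝓝 0) := by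
      have h1 := (tendsto_one_div_add_atTop_nhds_zero_nat (𝕜 := ℝ)).rpow_const
        (p := (d / r : ℝ)) (Or.inr (by positivity))
      rw [Real.zero_rpow (by positivity)] at h1
      simpa using h1.const_mul B
    refine squeeze_zero_norm (fun n => ?_) hlim
    set t : ℝ := 1 / ((n : ℝ) + 1)
    have ht : 0 < t := Nat.one_div_pos_of_nat
    rw [← integral_smooth_mul hr hF]
    refine (norm_integral_le_integral_norm _).trans ?_
    calc ∫ x, ‖smooth (𝓕 (cutoff t ht)) F x * φ x‖
        ≤ ∫ x, (eLpNorm F (ENNReal.ofReal r) volume).toReal * (t ^ (d / r : ℝ) * kerNorm d r)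
            * ‖φ x‖ := by
          refine integral_mono_of_nonneg (Eventually.of_forall fun x => norm_nonneg _)
            (φ.integrable.norm.const_mul _) (Eventually.of_forall fun x => ?_)
          simp only
          rw [norm_mul]
          gcongr
          exact norm_smooth_cutoff_le hr hF ht x
      _ = B * t ^ (d / r : ℝ) := by
          rw [integral_const_mul, hB]
          ring
  have hsum := (key hp hf).add (key hq hg)
  rw [add_zero] at hsum
  refine tendsto_nhds_unique (tendsto_const_nhds.congr fun n => ?_) hsum
  have ht : (0 : ℝ) < 1 / ((n : ℝ) + 1) := Nat.one_div_pos_of_nat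
  have h1 := h ⟨φ - conv (𝓕 (cutoff _ ht)) φ, sub_conv_mem_S0 (cutoff_eventually ht) φ⟩
  have hi : ∀ θ : 𝓢(E d, ℂ), ∫ x, (f x + g x) * θ x = (∫ x, f x * θ x) + ∫ x, g x * θ x := by
    intro θ
    simp only [add_mul]
    exact integral_add (integrable_mul_schwartz hp hf θ) (integrable_mul_schwartz hq hg θ)
  have hs : ∀ {r : ℝ} (_ : 1 < r) {F : E d → ℂ} (_ : MemLp F (ENNReal.ofReal r) volume),
      ∫ x, F x * (φ - conv (𝓕 (cutoff _ ht)) φ) x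
        = (∫ x, F x * φ x) - ∫ x, F x * conv (𝓕 (cutoff _ ht)) φ x := by
    intro r hr F hF
    rw [← integral_sub (integrable_mul_schwartz hr hF _) (integrable_mul_schwartz hr hF _)]
    congr 1
    ext x
    rw [sub_apply, mul_sub]
  rw [hi, hs hp hf, hs hq hg] at h1
  rw [hi]
  linear_combination h1

/-- A nontrivial combination of two different symbols vanishes at most on a sphere. -/
theorem ae_symb_comb_ne_zero (hd : 1 ≤ d) {a b : ℝ} (hab : a ≠ b) {c₁ c₂ : ℝ}
    (hc : c₁ ≠ 0 ∨ c₂ ≠ 0) :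
    ∀ᵐ ξ : E d, (c₁ : ℂ) * symb a ξ + (c₂ : ℂ) * symb b ξ ≠ 0 := by
  -- The only radius at which the combination can vanish off the origin, from (2π‖ξ‖)^{a−b} =
  -- −c₂/c₁. A sphere of nonzero radius is a null set.
  set ρ : ℝ := (-c₂ / c₁) ^ (a - b)⁻¹ / (2 * Real.pi) with hρ
  have hsub : ∀ ξ : E d, ξ ≠ 0 → (c₁ : ℂ) * symb a ξ + (c₂ : ℂ) * symb b ξ = 0 → ‖ξ‖ = ρ := by
    intro ξ hξ h
    have hx : (0 : ℝ) < 2 * Real.pi * ‖ξ‖ := by positivity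
    unfold symb at h
    have h' : c₁ * (2 * Real.pi * ‖ξ‖) ^ a + c₂ * (2 * Real.pi * ‖ξ‖) ^ b = 0 := by
      exact_mod_cast h
    set x := 2 * Real.pi * ‖ξ‖ with hxdef
    have hb : 0 < x ^ b := Real.rpow_pos_of_pos hx b
    have hc₁ : c₁ ≠ 0 := by
      rintro rfl
      rw [zero_mul, zero_add, mul_eq_zero] at h'
      rcases h' with h' | h'
      · simp [h'] at hc
      · exact hb.ne' h'
    have h2 : x ^ (a - b) = -c₂ / c₁ := by
      rw [Real.rpow_sub hx, div_eq_div_iff hb.ne' hc₁]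
      linarith
    have h3 : x = (-c₂ / c₁) ^ (a - b)⁻¹ := by
      rw [← h2, ← Real.rpow_mul hx.le, mul_inv_cancel₀ (sub_ne_zero.2 hab), Real.rpow_one]
    rw [hρ, ← h3, hxdef]
    field_simp
  have hnull : ∀ᵐ ξ : E d, ξ ≠ 0 → ‖ξ‖ ≠ ρ := by
    by_cases h0 : ρ = 0
    · refine Eventually.of_forall fun ξ hξ h => ?_
      rw [h0, norm_eq_zero] at h
      exact hξ h
    · have h1 := Measure.addHaar_sphere_of_ne_zero volume (0 : E d) h0
      rw [measure_eq_zero_iff_ae_notMem] at h1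
      filter_upwards [h1] with ξ hξ _ h
      exact hξ (by simpa using h)
  filter_upwards [hnull, ae_ne_zero hd] with ξ h1 h2 h
  exact h1 h2 (hsub ξ h2 h)

theorem Elt.u_eq_zero_of_g {e : Elt d α} (h : e.g =ᵐ[volume] 0) : e.u = 0 := by
  ext φ
  rw [e.hg.1 φ]
  simp only [zero_apply]
  refine integral_eq_zero_of_ae ?_
  filter_upwards [h] with x hx
  rw [hx, Pi.zero_apply, zero_mul]

theorem locallyIntegrableOn_symb (hd : 1 ≤ d) {s t : ℝ} {g : E d → ℂ}
    (hg : MemLp (fun ξ => symb s ξ * g ξ) 2 volume) :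
    LocallyIntegrableOn (fun ξ => symb t ξ * g ξ) {0}ᶜ volume := by
  refine locallyIntegrableOn_of_hdot (s := s - t) hd (hg.ae_eq ?_)
  filter_upwards [ae_ne_zero hd] with ξ hξ
  rw [← mul_assoc, ← symb_add _ _ hξ, sub_add_cancel]

/-- An element of `Ḣ² ∩ L^{α_c}` annihilated by a combination of symbols is zero. -/
theorem Elt.u_eq_zero_of_symb (hd : 1 ≤ d) {e : Elt d α} {a b : ℝ} (hab : a ≠ b) {c₁ c₂ : ℝ}
    (hc : c₁ ≠ 0 ∨ c₂ ≠ 0)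
    (h : ∀ φ : S0 d, (c₁ : ℂ) * (∫ ξ, symb a ξ * e.g ξ * (𝓕⁻ (φ : 𝓢(E d, ℂ)) : 𝓢(E d, ℂ)) ξ)
      + (c₂ : ℂ) * (∫ ξ, symb b ξ * e.g ξ * (𝓕⁻ (φ : 𝓢(E d, ℂ)) : 𝓢(E d, ℂ)) ξ) = 0) :
    e.u = 0 := by
  have la := locallyIntegrableOn_symb hd (t := a) e.hg.2
  have lb := locallyIntegrableOn_symb hd (t := b) e.hg.2
  have key := ae_eq_zero_of_fourierInv hd
    (k := fun ξ => (c₁ : ℂ) • (symb a ξ * e.g ξ) + (c₂ : ℂ) • (symb b ξ * e.g ξ))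
    ((la.smul (c₁ : ℂ)).add (lb.smul (c₂ : ℂ))) fun φ hcs hts => by
      have ia := integrable_mul_of_tsupport la hcs hts
      have ib := integrable_mul_of_tsupport lb hcs hts
      rw [← h φ, ← integral_const_mul, ← integral_const_mul,
        ← integral_add (ia.const_mul _) (ib.const_mul _)]
      congr 1
      ext ξ
      simp only [smul_eq_mul]
      ring
  refine Elt.u_eq_zero_of_g ?_
  filter_upwards [key, ae_symb_comb_ne_zero hd hab hc] with ξ h1 h2
  have h3 : ((c₁ : ℂ) * symb a ξ + (c₂ : ℂ) * symb b ξ) * e.g ξ = 0 := by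
    simp only [Pi.zero_apply, smul_eq_mul] at h1
    rw [← h1]
    ring
  exact (mul_eq_zero.1 h3).resolve_left h2

/-- The equation of Sobolev ground states, for the representatives of an element. -/
theorem SolvesSobolev.eq (ha : Adm d α) {e : Elt d α} (h : SolvesSobolev α e.u) (φ : S0 d) :
    (∫ ξ, symb 4 ξ * e.g ξ * (𝓕⁻ (φ : 𝓢(E d, ℂ)) : 𝓢(E d, ℂ)) ξ)
      + (∫ ξ, symb (2 * gammaC d α) ξ * e.g ξ * (𝓕⁻ (φ : 𝓢(E d, ℂ)) : 𝓢(E d, ℂ)) ξ)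
      = ∫ x, ((‖e.f x‖ ^ α : ℝ) : ℂ) * e.f x * (φ : 𝓢(E d, ℂ)) x := by
  obtain ⟨f, g, hf, -, hg, heq⟩ := h
  have hf' := IsFunction.ae_eq ha.one_le ha.one_lt hf (e.isLpFunction_add_two ha)
  have hg' := IsFourier.ae_eq ha.one_le hg e.hg
  rw [← sub_eq_zero, ← heq φ]
  congr 1
  · congr 1
    all_goals
      refine integral_congr_ae ?_
      filter_upwards [hg'] with ξ hξ
      rw [hξ]
  · refine integral_congr_ae ?_
    filter_upwards [hf'] with x hx
    rw [hx]

/-- The equation of Lebesgue ground states, for the representatives of an element. -/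
theorem SolvesLebesgue.eq (ha : Adm d α) {e : Elt d α} (h : SolvesLebesgue α e.u) (φ : S0 d) :
    (∫ ξ, symb 4 ξ * e.g ξ * (𝓕⁻ (φ : 𝓢(E d, ℂ)) : 𝓢(E d, ℂ)) ξ)
      + (∫ x, ((‖e.f x‖ ^ (alphaC d α - 2) : ℝ) : ℂ) * e.f x * (φ : 𝓢(E d, ℂ)) x)
      = ∫ x, ((‖e.f x‖ ^ α : ℝ) : ℂ) * e.f x * (φ : 𝓢(E d, ℂ)) x := by
  obtain ⟨f, g, -, hf, hg, heq⟩ := h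
  have hf' := IsFunction.ae_eq ha.one_le ha.one_lt hf (e.isLpFunction_add_two ha)
  have hg' := IsFourier.ae_eq ha.one_le hg e.hg
  rw [← sub_eq_zero, ← heq φ]
  congr 1
  · congr 1
    · refine integral_congr_ae ?_
      filter_upwards [hg'] with ξ hξ
      rw [hξ]
    · refine integral_congr_ae ?_
      filter_upwards [hf'] with x hx
      rw [hx]
  · refine integral_congr_ae ?_
    filter_upwards [hf'] with x hx
    rw [hx]

/-- The two normalizations turn both coefficients of the Euler–Lagrange equation into α + 2, which
is also the coefficient of the nonlinearity and cancels. -/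
theorem solvesSobolev_of_isMax (ha : Adm d α) {e : Elt d α}
    (he : CritNorm.IsMax (hdotNorm (gammaC d α)) e) (h1 : 2 * e.I (α + 2) = (α + 2) * e.D)
    (h2 : α * e.I (α + 2) = (α + 2) * (hdotNorm (gammaC d α) e.u).toReal ^ (2 : ℝ)) :
    SolvesSobolev α e.u := by
  have hap := ha.pos
  have hD := Elt.D_pos_of_ne_zero ha he.2.1
  have hn := (critNorm_hdot ha).toReal_pos ha he.1 he.2.1
  refine ⟨e.f, e.g, e.isLpFunction_add_two ha, e.hg.of_hdot ha.one_le he.1, e.hg, fun φ => ?_⟩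
  have h3 := euler_lagrange_hdot ha he (φ : 𝓢(E d, ℂ))
  rw [h1, h2, mul_div_cancel_right₀ _ hD.ne', mul_div_cancel_right₀ _ (by positivity),
    ← mul_add] at h3
  have h4 := mul_left_cancel₀ (by exact_mod_cast (by linarith : α + 2 ≠ 0)) h3
  rw [← h4]
  ring

theorem solvesLebesgue_of_isMax (ha : Adm d α) {e : Elt d α}
    (he : CritNorm.IsMax (lpNorm (alphaC d α)) e) (h1 : 2 * e.I (α + 2) = (α + 2) * e.D)
    (h2 : α * e.I (α + 2) = (α + 2) * (lpNorm (alphaC d α) e.u).toReal ^ alphaC d α) :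
    SolvesLebesgue α e.u := by
  have hap := ha.pos
  have hD := Elt.D_pos_of_ne_zero ha he.2.1
  have hn := (critNorm_lp ha).toReal_pos ha he.1 he.2.1
  refine ⟨e.f, e.g, e.hf, e.isLpFunction_add_two ha, e.hg, fun φ => ?_⟩
  have h3 := euler_lagrange_lp ha he (φ : 𝓢(E d, ℂ))
  rw [h1, h2, mul_div_cancel_right₀ _ hD.ne', mul_div_cancel_right₀ _ (by positivity),
    ← mul_add] at h3
  have h4 := mul_left_cancel₀ (by exact_mod_cast (by linarith : α + 2 ≠ 0)) h3
  rw [← h4]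
  ring

/-- Subtracting α + 2 times the equation from the Euler–Lagrange equation removes the nonlinearity
and leaves a combination of (−Δ)^{γ_c} and Δ² that annihilates u. Were the coefficient of Δ²
nonzero, û would vanish off a sphere and u would be 0. This replaces a Pohozaev identity and needs
no regularity or decay. -/
theorem two_mul_I_eq_of_solvesSobolev (ha : Adm d α) {e : Elt d α}
    (he : CritNorm.IsMax (hdotNorm (gammaC d α)) e) (h : SolvesSobolev α e.u) :
    2 * e.I (α + 2) = (α + 2) * e.D := by
  have hD := Elt.D_pos_of_ne_zero ha he.2.1
  by_contra hne
  obtain ⟨A, hA₀⟩ : ∃ A, A = α * e.I (α + 2) / (hdotNorm (gammaC d α) e.u).toReal ^ (2 : ℝ) := ⟨_, rfl⟩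
  obtain ⟨B, hB⟩ : ∃ B, B = 2 * e.I (α + 2) / e.D := ⟨_, rfl⟩
  have hBp : B - (α + 2) ≠ 0 := by
    rw [hB, sub_ne_zero]
    intro h
    rw [div_eq_iff hD.ne'] at h
    exact hne h
  refine he.2.1 (Elt.u_eq_zero_of_symb ha.one_le (a := 2 * gammaC d α) (b := 4)
    (c₁ := A - (α + 2)) (c₂ := B - (α + 2)) (by linarith [ha.gammaC_lt_two]) (Or.inr hBp) fun φ => ?_)
  have h1 := euler_lagrange_hdot ha he (φ : 𝓢(E d, ℂ))
  rw [← h.eq ha φ, ← hA₀, ← hB] at h1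
  push_cast at h1 ⊢
  linear_combination h1

/-- If the identity failed, the equation and the Euler–Lagrange equation would express Δ²u and |u|^α
u both as constant multiples of |u|^{α_c−2}u. Then |u| is constant where it does not vanish, so Δ²u
is a constant multiple of u, which is impossible for u ≠ 0. -/
theorem two_mul_I_eq_of_solvesLebesgue (ha : Adm d α) {e : Elt d α}
    (he : CritNorm.IsMax (lpNorm (alphaC d α)) e) (h : SolvesLebesgue α e.u) :
    2 * e.I (α + 2) = (α + 2) * e.D := by
  have hap := ha.pos
  have hq := ha.two_lt_alphaC
  have hqp := ha.alphaC_lt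
  have hD := Elt.D_pos_of_ne_zero ha he.2.1
  by_contra hne
  obtain ⟨A, hA₀⟩ : ∃ A, A = α * e.I (α + 2) / (lpNorm (alphaC d α) e.u).toReal ^ alphaC d α := ⟨_, rfl⟩
  obtain ⟨B, hB⟩ : ∃ B, B = 2 * e.I (α + 2) / e.D := ⟨_, rfl⟩
  have hBp : B - (α + 2) ≠ 0 := by
    rw [hB, sub_ne_zero]
    intro h
    rw [div_eq_iff hD.ne'] at h
    exact hne h
  -- The difference of the two equations reads (A − (α+2))|u|^{α_c−2}u + (B − (α+2))Δ²u = 0; κ is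
  -- the resulting factor in Δ²u = κ|u|^{α_c−2}u.
  obtain ⟨κ, hκ⟩ : ∃ κ, κ = -(A - (α + 2)) / (B - (α + 2)) := ⟨_, rfl⟩
  have hA : A - (α + 2) = -κ * (B - (α + 2)) := by
    rw [hκ]
    field_simp
  have hBc : ((B - (α + 2) : ℝ) : ℂ) ≠ 0 := by exact_mod_cast hBp
  have hQ : ∀ φ : S0 d, (∫ ξ, symb 4 ξ * e.g ξ * (𝓕⁻ (φ : 𝓢(E d, ℂ)) : 𝓢(E d, ℂ)) ξ)
      = (κ : ℂ) * ∫ x, ((‖e.f x‖ ^ (alphaC d α - 2) : ℝ) : ℂ) * e.f x * (φ : 𝓢(E d, ℂ)) x := by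
    intro φ
    have h1 := euler_lagrange_lp ha he (φ : 𝓢(E d, ℂ))
    rw [← h.eq ha φ, ← hA₀, ← hB] at h1
    have hA' : (A : ℂ) - (α + 2) = -κ * (B - (α + 2)) := by exact_mod_cast hA
    push_cast at hBc
    refine mul_left_cancel₀ hBc ?_
    push_cast at h1
    linear_combination h1 - (∫ x, ((‖e.f x‖ ^ (alphaC d α - 2) : ℝ) : ℂ) * e.f x
      * (φ : 𝓢(E d, ℂ)) x) * hA'
  have hF := memLp_rpow_mul (r := α + 2) (by linarith) (e.memLp_add_two ha)
  have hG := (memLp_rpow_mul hq.le e.hf.2).const_mul (-((1 + κ : ℝ) : ℂ))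
  have hzero := add_ae_eq_zero_of_S0 ha.one_le
    (Real.HolderConjugate.conjExponent ha.one_lt).symm.lt
    (Real.HolderConjugate.conjExponent ha.one_lt_alphaC).symm.lt hF hG fun φ => by
      have i1 := integrable_rpow_mul_schwartz (r := α + 2) (by linarith) (e.memLp_add_two ha)
        (φ : 𝓢(E d, ℂ))
      have i2 := integrable_rpow_mul_schwartz hq.le e.hf.2 (φ : 𝓢(E d, ℂ))
      have h1 := h.eq ha φ
      rw [hQ φ] at h1
      simp only [add_mul, mul_assoc (-((1 + κ : ℝ) : ℂ))]
      rw [integral_add i1 (i2.const_mul _), integral_const_mul]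
      simp only [add_sub_cancel_right]
      rw [← h1]
      push_cast
      ring
  -- Where f ≠ 0 the pointwise identity gives |f|^{α+2−α_c} = 1 + κ, and τ is the value of
  -- |f|^{α_c−2} computed from it.
  obtain ⟨τ, hτ⟩ : ∃ τ, τ = ((1 + κ) ^ (α + 2 - alphaC d α)⁻¹) ^ (alphaC d α - 2) := ⟨_, rfl⟩
  have hconst : ∀ᵐ x, ((‖e.f x‖ ^ (alphaC d α - 2) : ℝ) : ℂ) * e.f x = (τ : ℂ) * e.f x := by
    filter_upwards [hzero] with x hx
    by_cases h0 : e.f x = 0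
    · rw [h0, mul_zero, mul_zero]
    · have hpos : 0 < ‖e.f x‖ := norm_pos_iff.2 h0
      congr 2
      simp only [add_sub_cancel_right, Pi.zero_apply] at hx
      have h1 : (((‖e.f x‖ ^ α - (1 + κ) * ‖e.f x‖ ^ (alphaC d α - 2) : ℝ)) : ℂ) * e.f x = 0 := by
        rw [← hx]
        push_cast
        ring
      have h2 : ‖e.f x‖ ^ α - (1 + κ) * ‖e.f x‖ ^ (alphaC d α - 2) = 0 := by
        exact_mod_cast (mul_eq_zero.1 h1).resolve_right h0
      have h3 : ‖e.f x‖ ^ (α + 2 - alphaC d α) = 1 + κ := by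
        have h4 : ‖e.f x‖ ^ α = ‖e.f x‖ ^ (α + 2 - alphaC d α) * ‖e.f x‖ ^ (alphaC d α - 2) := by
          rw [← Real.rpow_add hpos]
          congr 1
          ring
        rw [h4, ← sub_mul] at h2
        have h5 := (mul_eq_zero.1 h2).resolve_right (by positivity)
        linarith
      rw [hτ, ← h3, ← Real.rpow_mul hpos.le, mul_inv_cancel₀ (by linarith), Real.rpow_one]
  refine he.2.1 (Elt.u_eq_zero_of_symb ha.one_le (a := 4) (b := 0) (c₁ := 1) (c₂ := -(κ * τ))
    (by norm_num) (Or.inl one_ne_zero) fun φ => ?_)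
  have h1 : ∫ x, ((‖e.f x‖ ^ (alphaC d α - 2) : ℝ) : ℂ) * e.f x * (φ : 𝓢(E d, ℂ)) x
      = (τ : ℂ) * ∫ ξ, e.g ξ * (𝓕⁻ (φ : 𝓢(E d, ℂ)) : 𝓢(E d, ℂ)) ξ := by
    rw [← e.hfg φ, ← integral_const_mul]
    refine integral_congr_ae ?_
    filter_upwards [hconst] with x hx
    rw [hx, mul_assoc]
  rw [hQ φ, h1]
  simp only [symb_zero, one_mul]
  push_cast
  ring

/-- The common norm of the normalized maximizers, and its relation to the best constant. -/
theorem CritNorm.exists_commonNorm {N : S0Dual d → ℝ≥0∞} (hN : CritNorm α N) (ha : Adm d α) (θ : ℝ)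
    {P : S0Dual d → Prop}
    (h1 : ∀ e : Elt d α, IsMax N e → 2 * e.I (α + 2) = (α + 2) * e.D →
      α * e.I (α + 2) = (α + 2) * (N e.u).toReal ^ θ → P e.u)
    (h2 : ∀ e : Elt d α, IsMax N e → P e.u → 2 * e.I (α + 2) = (α + 2) * e.D) :
    ∃ S C : ℝ, 0 < C ∧ IsCommonNorm N {u | IsMaximizer (fun u => N u + hdotNorm 2 u)
        (fun u => lpNorm (α + 2) u ^ (α + 2) / (N u ^ α * hdotNorm 2 u ^ 2)) u ∧ P u} S ∧
      S ^ α = (α + 2) / (2 * C) ∧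
      ∀ w : Elt d α, N w.u < ⊤ → w.I (α + 2) ≤ C * ((N w.u).toReal ^ α * w.D) := by
  have hap := ha.pos
  obtain ⟨e₀, he₀, hD₀, hθ₀⟩ := hN.exists_isMax_normalized ha θ
  -- Insert I = C N^α D into 2I = (α+2)D and cancel D: the norm depends on the best constant only,
  -- and that is shared by all maximizers.
  have key : ∀ e : Elt d α, IsMax N e → 2 * e.I (α + 2) = (α + 2) * e.D →
      (N e.u).toReal ^ α = (α + 2) / (2 * ratio N e) := by
    intro e he h
    have hn := hN.toReal_pos ha he.1 he.2.1
    have hD := Elt.D_pos_of_ne_zero ha he.2.1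
    have hC := hN.ratio_pos ha he.1 he.2.1
    rw [hN.I_eq ha he.1 he.2.1] at h
    rw [eq_div_iff (by positivity)]
    refine mul_right_cancel₀ hD.ne' ?_
    linarith
  have hn₀ := hN.toReal_pos ha he₀.1 he₀.2.1
  refine ⟨(N e₀.u).toReal, ratio N e₀, hN.ratio_pos ha he₀.1 he₀.2.1,
    ⟨⟨e₀.u, (hN.isMaximizer_iff ha e₀).2 he₀, h1 e₀ he₀ hD₀ hθ₀⟩, hn₀, ?_⟩,
    key e₀ he₀ hD₀, fun w hw => ?_⟩
  · rintro u ⟨hu, hP⟩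
    obtain ⟨S, hS⟩ := hN.exists_elt
    obtain ⟨e, rfl, -⟩ := hS u hu.1
    have he := (hN.isMaximizer_iff ha e).1 hu
    have hn := hN.toReal_pos ha he.1 he.2.1
    have hr : ratio N e = ratio N e₀ :=
      le_antisymm (he₀.2.2 e he.1 he.2.1) (he.2.2 e₀ he₀.1 he₀.2.1)
    have h3 := key e he (h2 e he hP)
    rw [hr, ← key e₀ he₀ hD₀] at h3
    rw [← (Real.rpow_left_inj hn.le hn₀.le hap.ne').1 h3, ENNReal.ofReal_toReal he.1.ne]
  · by_cases h0 : w.u = 0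
    · rw [Elt.I_eq_zero_of_u ha h0 (by linarith)]
      have := (hN.ratio_pos ha he₀.1 he₀.2.1).le
      have := w.D_nonneg
      positivity
    · rw [hN.I_eq ha hw h0]
      have := w.D_nonneg
      exact mul_le_mul_of_nonneg_right (he₀.2.2 w hw h0) (by positivity)

end GroundStates

/-! ### Concentration along bounded sequences -/

section Concentration

variable {α : ℝ}

theorem translate_zero (u : S0Dual d) : translate u 0 = u := by
  ext φ
  refine congrArg u (Subtype.ext (SchwartzMap.ext fun x => ?_))
  simp [shiftS0]

namespace Elt

theorem exists_isProfile (ha : Adm d α) {e : ℕ → Elt d α} {K : ℝ}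
    (hI : ∀ n, (e n).I (alphaC d α) ≤ K) (hD : ∀ n, (e n).D ≤ K) : ∃ V, IsProfile e V := by
  obtain ⟨k, V, hk, hV, -, -⟩ := exists_subseq ha hI hD
  refine ⟨V, k, 0, hk, fun φ => (hV φ).congr fun n => ?_⟩
  exact congrArg (fun u : S0Dual d => u φ) (translate_zero _).symm

/-- A subsequence along which the two norms converge, with limits bounded by the upper limits. -/
theorem exists_subseq_norms (ha : Adm d α) {e : ℕ → Elt d α} {K m M : ℝ}
    (hI : ∀ n, (e n).I (alphaC d α) ≤ K) (hD : ∀ n, (e n).D ≤ K) (hm : 0 < m) (hM : 0 < M)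
    (hlM : limsup (fun n => hdotNorm 2 (e n).u) atTop ≤ ENNReal.ofReal M)
    (hlm : ENNReal.ofReal m ≤ limsup (fun n => lpNorm (α + 2) (e n).u) atTop) :
    ∃ (k : ℕ → ℕ) (D₀ N₀ : ℝ), StrictMono k ∧ Tendsto (fun n => (e (k n)).D) atTop (𝓝 D₀) ∧
      Tendsto (fun n => (e (k n)).I (α + 2)) atTop (𝓝 N₀) ∧ D₀ ≤ M ^ 2 ∧ m ^ (α + 2) ≤ N₀ := by
  have hap := ha.pos
  have hq := ha.two_lt_alphaC
  -- The lower bound on the upper limit holds for infinitely many indices only, while the upper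
  -- bound on the other holds eventually. So both hold infinitely often, and one subsequence serves
  -- for both.
  have hfreq : ∀ n : ℕ, ∃ᶠ j in atTop, m - 1 / ((n : ℝ) + 1) < (e j).I (α + 2) ^ (α + 2)⁻¹ ∧
      ‖(e j).h‖ < M + 1 / ((n : ℝ) + 1) := by
    intro n
    have hn : (0 : ℝ) < 1 / ((n : ℝ) + 1) := by positivity
    have h1 := frequently_lt_of_lt_limsup (f := atTop) (by isBoundedDefault)
      (((ENNReal.ofReal_lt_ofReal_iff hm).2 (sub_lt_self m hn)).trans_le hlm)
    have h2 := eventually_lt_of_limsup_lt (f := atTop) (hlM.trans_lt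
      ((ENNReal.ofReal_lt_ofReal_iff (by linarith)).2 (lt_add_of_pos_right M hn)))
    refine (h1.and_eventually h2).mono fun j hj => ?_
    rw [(e j).lpNorm_add_two ha, (e j).hdotNorm_eq ha.one_le] at hj
    exact ⟨(ENNReal.ofReal_lt_ofReal_iff'.1 hj.1).1, (ENNReal.ofReal_lt_ofReal_iff'.1 hj.2).1⟩
  obtain ⟨k, hk, hkP⟩ := extraction_forall_of_frequently hfreq
  have hK : 0 ≤ K := ((e 0).I_nonneg _).trans (hI 0)
  set R := gnConst d α * K ^ (α / alphaC d α) * K with hR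
  have hNR : ∀ n, (e n).I (α + 2) ≤ R := by
    intro n
    have hg := gnConst_nonneg (d := d) hap
    refine ((e n).gn ha).trans ?_
    refine mul_le_mul (mul_le_mul_of_nonneg_left ?_ hg) (hD n) (e n).D_nonneg (by positivity)
    exact Real.rpow_le_rpow ((e n).I_nonneg _) (hI n) (by positivity)
  obtain ⟨⟨D₀, N₀⟩, -, j, hj, hlim⟩ := (isCompact_Icc.prod isCompact_Icc).tendsto_subseq
    (s := Set.Icc 0 K ×ˢ Set.Icc 0 R) (x := fun n => ((e (k n)).D, (e (k n)).I (α + 2)))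
    fun n => ⟨⟨(e _).D_nonneg, hD _⟩, ⟨(e _).I_nonneg _, hNR _⟩⟩
  have hlD : Tendsto (fun n => (e (k (j n))).D) atTop (𝓝 D₀) :=
    (continuous_fst.tendsto _).comp hlim
  have hlN : Tendsto (fun n => (e (k (j n))).I (α + 2)) atTop (𝓝 N₀) :=
    (continuous_snd.tendsto _).comp hlim
  have hN₀ : 0 ≤ N₀ := ge_of_tendsto' hlN fun n => (e _).I_nonneg _
  have hone : Tendsto (fun n => 1 / ((j n : ℝ) + 1)) atTop (𝓝 0) :=
    tendsto_one_div_add_atTop_nhds_zero_nat.comp hj.tendsto_atTop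
  refine ⟨k ∘ j, D₀, N₀, hk.comp hj, hlD, hlN, ?_, ?_⟩
  · have h1 : Tendsto (fun n => (M + 1 / ((j n : ℝ) + 1)) ^ 2) atTop (𝓝 (M ^ 2)) := by
      simpa using (hone.const_add M).pow 2
    refine le_of_tendsto_of_tendsto' hlD h1 fun n => ?_
    exact pow_le_pow_left₀ (norm_nonneg _) (hkP (j n)).2.le 2
  · have h1 : Tendsto (fun n => m - 1 / ((j n : ℝ) + 1)) atTop (𝓝 m) := by
      simpa using hone.const_sub m
    have h2 : m ≤ N₀ ^ (α + 2)⁻¹ := le_of_tendsto_of_tendsto' h1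
      (hlN.rpow_const (Or.inr (by positivity))) fun n => (hkP (j n)).1.le
    have h3 := Real.rpow_le_rpow hm.le h2 (by linarith : 0 ≤ α + 2)
    rwa [← Real.rpow_mul hN₀, inv_mul_cancel₀ (by linarith), Real.rpow_one] at h3

/-- Concentration: some profile is at least as large as the optimal inequality allows. -/
theorem exists_profile_norm_ge (ha : Adm d α) {N : S0Dual d → ℝ≥0∞} {C : ℝ} (hC : 0 < C)
    (hN : ∀ w : Elt d α, N w.u < ⊤ → w.I (α + 2) ≤ C * ((N w.u).toReal ^ α * w.D))
    {e : ℕ → Elt d α} {K m M : ℝ}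
    (hI : ∀ n, (e n).I (alphaC d α) ≤ K) (hD : ∀ n, (e n).D ≤ K)
    (hfin : ∀ W, IsProfile e W → N W.u < ⊤) (hm : 0 ≤ m) (hM : 0 < M)
    (hlM : limsup (fun n => hdotNorm 2 (e n).u) atTop ≤ ENNReal.ofReal M)
    (hlm : ENNReal.ofReal m ≤ limsup (fun n => lpNorm (α + 2) (e n).u) atTop) :
    ∃ V, IsProfile e V ∧ m ^ (α + 2) / M ^ 2 / C ≤ (N V.u).toReal ^ α := by
  have hap := ha.pos
  -- For m = 0 the bound is empty and any profile will do.
  rcases hm.eq_or_lt with rfl | hm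
  · obtain ⟨V, hV⟩ := exists_isProfile ha hI hD
    refine ⟨V, hV, ?_⟩
    rw [Real.zero_rpow (by linarith), zero_div, zero_div]
    positivity
  obtain ⟨k, D₀, N₀, hk, hlD, hlN, hD₀, hN₀⟩ := exists_subseq_norms ha hI hD hm hM hlM hlm
  by_contra! hcon
  set B := m ^ (α + 2) / M ^ 2 with hB
  have hB0 : 0 < B := by positivity
  have hlt : ∀ W, IsProfile e W → C * (N W.u).toReal ^ α < B := fun W hW => by
    have h := hcon W hW
    rw [lt_div_iff₀ hC] at h
    linarith
  have hle : ∀ W, IsProfile e W → W.I (α + 2) ≤ C * (N W.u).toReal ^ α * W.D := fun W hW => by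
    rw [mul_assoc]
    exact hN W (hfin W hW)
  -- Every profile satisfies I ≤ B D, so this holds also for what is left after removing V. For V
  -- itself the inequality is strict since D(V) > 0, and adding the two contradicts lim I ≥ m^{α+2}
  -- ≥ B lim D.
  obtain ⟨V, hV, hV0, hge⟩ := exists_profile_ge ha (B := B) (fun n => e (k n)) (fun n => hI _)
    hlD hlN ((by positivity : 0 < m ^ (α + 2)).trans_le hN₀) hB0.le fun W hW =>
      (hle W (hW.of_subseq hk)).trans
        (mul_le_mul_of_nonneg_right (hlt W (hW.of_subseq hk)).le W.D_nonneg)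
  have hV' := hV.of_subseq hk
  have h1 : V.I (α + 2) < B * V.D := (hle V hV').trans_lt
    (mul_lt_mul_of_pos_right (hlt V hV') (D_pos_of_ne_zero ha hV0))
  have h2 : B * D₀ ≤ m ^ (α + 2) :=
    (mul_le_mul_of_nonneg_left hD₀ hB0.le).trans (by rw [hB, div_mul_cancel₀ _ (by positivity)])
  linarith

/-- A bounded sequence of `Ḣ^{γ_c} ∩ Ḣ²` is given by a bounded sequence of elements. -/
theorem exists_seq_of_sobNorm (ha : Adm d α) {v : ℕ → S0Dual d} {C : ℝ≥0}
    (hC : ∀ n, sobNorm α (v n) ≤ C) : ∃ (e : ℕ → Elt d α) (K : ℝ), (∀ n, (e n).u = v n) ∧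
      (∀ n, (e n).I (alphaC d α) ≤ K) ∧ ∀ n, (e n).D ≤ K := by
  have hq : 0 < alphaC d α := by linarith [ha.two_lt_alphaC]
  choose e he _ hle using fun n => exists_of_sobNorm ha ((hC n).trans_lt ENNReal.coe_lt_top)
  set c := Real.toNNReal (sobConst d (gammaC d α) (alphaC d α)) * C with hc
  refine ⟨e, max ((c : ℝ) ^ alphaC d α) ((C : ℝ) ^ 2), he, fun n => ?_, fun n => ?_⟩
  · refine le_trans ?_ (le_max_left _ _)
    have h1 : lpNorm (alphaC d α) (e n).u ≤ (c : ℝ≥0∞) := by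
      rw [he, hc, ENNReal.coe_mul]
      exact (hle n).trans (mul_le_mul_right (le_self_add.trans (hC n)) _)
    rw [(e n).lpNorm_alphaC ha, ENNReal.ofReal_le_iff_le_toReal ENNReal.coe_ne_top,
      ENNReal.coe_toReal] at h1
    exact (Real.rpow_inv_le_iff_of_pos ((e n).I_nonneg _) c.coe_nonneg hq).1 h1
  · refine le_trans ?_ (le_max_right _ _)
    have h1 : hdotNorm 2 (e n).u ≤ (C : ℝ≥0∞) := by
      rw [he]
      exact le_add_self.trans (hC n)
    rw [(e n).hdotNorm_eq ha.one_le, ENNReal.ofReal_le_iff_le_toReal ENNReal.coe_ne_top,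
      ENNReal.coe_toReal] at h1
    exact pow_le_pow_left₀ (norm_nonneg _) h1 2

end Elt

/-- The constant 2/(α+2) is that of S^α = (α+2)/(2C), so the asserted bound equals m^{α+2}/(M²C),
the one supplied by `Elt.exists_profile_norm_ge`. Weak convergence is obtained in the smaller space
whichever norm N is measured. -/
theorem exists_weakConv_norm_ge (ha : Adm d α) {N : S0Dual d → ℝ≥0∞} {C S : ℝ} (hC : 0 < C)
    (hS : S ^ α = (α + 2) / (2 * C))
    (hN : ∀ w : Elt d α, N w.u < ⊤ → w.I (α + 2) ≤ C * ((N w.u).toReal ^ α * w.D))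
    (hfin : ∀ u, sobNorm α u < ⊤ → N u < ⊤) {v : ℕ → S0Dual d} {m M : ℝ} (hm : 0 ≤ m) (hM : 0 < M)
    {C' : ℝ≥0} (hC' : ∀ n, sobNorm α (v n) ≤ C')
    (hlM : limsup (fun n => hdotNorm 2 (v n)) atTop ≤ ENNReal.ofReal M)
    (hlm : ENNReal.ofReal m ≤ limsup (fun n => lpNorm (α + 2) (v n)) atTop) :
    ∃ (x : ℕ → E d) (k : ℕ → ℕ) (V : S0Dual d), StrictMono k ∧
      WeakConv (sobNorm α) (fun n => translate (v (k n)) (x (k n))) V ∧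
      2 / (α + 2) * (m ^ (α + 2) / M ^ 2) * S ^ α ≤ (N V).toReal ^ α := by
  have hap := ha.pos
  obtain ⟨e, K, he, hI, hD⟩ := Elt.exists_seq_of_sobNorm ha hC'
  obtain rfl : (fun n => (e n).u) = v := funext he
  have hweak := fun (V : Elt d α) (hV : Elt.IsProfile e V) =>
    (hV.exists_weakConv ha.one_le hC' fun n => le_self_add.trans (hC' n)).2
  obtain ⟨V, hV, hle⟩ := Elt.exists_profile_norm_ge ha hC hN hI hD (fun W hW => by
    obtain ⟨_, _, -, h⟩ := hweak W hW
    exact hfin _ h.2.1) hm hM hlM hlm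
  obtain ⟨x, k, hk, hw⟩ := hweak V hV
  refine ⟨x, k, V.u, hk, hw, le_trans (le_of_eq ?_) hle⟩
  rw [hS]
  field_simp

end Concentration

end NL4S

/-! ### The theorem -/

theorem mainTheorem3 (d : ℕ) (hd : 1 ≤ d) (α : ℝ) (hα₁ : 8 / (d : ℝ) < α)
    (hα₂ : 5 ≤ d → α < 8 / ((d : ℝ) - 4)) :
    ∃ Sgs Lgs : ℝ,
      NL4S.IsCommonNorm (NL4S.hdotNorm (NL4S.gammaC d α)) (NL4S.sobolevGroundStates d α) Sgs ∧
      NL4S.IsCommonNorm (NL4S.lpNorm (NL4S.alphaC d α)) (NL4S.lebesgueGroundStates d α) Lgs ∧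
      ∀ (v : ℕ → NL4S.S0Dual d) (m M : ℝ), 0 ≤ m → 0 < M →
        (∃ C : ℝ≥0, ∀ n, NL4S.sobNorm α (v n) ≤ C) →
        limsup (fun n => NL4S.hdotNorm 2 (v n)) atTop ≤ ENNReal.ofReal M →
        ENNReal.ofReal m ≤ limsup (fun n => NL4S.lpNorm (α + 2) (v n)) atTop →
        (∃ (x : ℕ → NL4S.E d) (k : ℕ → ℕ) (V : NL4S.S0Dual d), StrictMono k ∧
          NL4S.WeakConv (NL4S.sobNorm α) (fun n => NL4S.translate (v (k n)) (x (k n))) V ∧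
          2 / (α + 2) * (m ^ (α + 2) / M ^ 2) * Sgs ^ α
            ≤ (NL4S.hdotNorm (NL4S.gammaC d α) V).toReal ^ α) ∧
        (∃ (y : ℕ → NL4S.E d) (k : ℕ → ℕ) (W : NL4S.S0Dual d), StrictMono k ∧
          NL4S.WeakConv (NL4S.lebNorm α) (fun n => NL4S.translate (v (k n)) (y (k n))) W ∧
          2 / (α + 2) * (m ^ (α + 2) / M ^ 2) * Lgs ^ α
            ≤ (NL4S.lpNorm (NL4S.alphaC d α) W).toReal ^ α) := by
  have ha : NL4S.Adm d α := ⟨hd, hα₁, hα₂⟩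
  obtain ⟨S, A, hA, hS, hSA, hAle⟩ := (NL4S.critNorm_hdot ha).exists_commonNorm ha 2
    (P := NL4S.SolvesSobolev α) (fun e he => NL4S.solvesSobolev_of_isMax ha he)
    (fun e he => NL4S.two_mul_I_eq_of_solvesSobolev ha he)
  obtain ⟨T, B, hB, hT, hTB, hBle⟩ := (NL4S.critNorm_lp ha).exists_commonNorm ha (NL4S.alphaC d α)
    (P := NL4S.SolvesLebesgue α) (fun e he => NL4S.solvesLebesgue_of_isMax ha he)
    (fun e he => NL4S.two_mul_I_eq_of_solvesLebesgue ha he)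
  refine ⟨S, T, hS, hT, fun v m M hm hM ⟨C, hC⟩ hlM hlm => ⟨?_, ?_⟩⟩
  · exact NL4S.exists_weakConv_norm_ge ha hA hSA hAle (fun u hu => (ENNReal.add_lt_top.1 hu).1)
      hm hM hC hlM hlm
  -- The Lebesgue part may need another profile, hence other centres, than the Sobolev part. Its
  -- weak convergence holds in Ḣ^{γ_c} ∩ Ḣ² and is then weakened.
  · obtain ⟨y, k, W, hk, hw, hle⟩ := NL4S.exists_weakConv_norm_ge ha hB hTB hBle (fun u hu => by
      obtain ⟨e, rfl, -⟩ := NL4S.Elt.exists_of_sobNorm ha hu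
      exact e.lpNorm_lt_top) hm hM hC hlM hlm
    exact ⟨y, k, W, hk, hw.leb_of_sob ha, hle⟩
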